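/- **Setting.** Let $K$ be a non-empty poset (order $\subseteq$) with a relation $\subset$ such that $o\subset a$ implies $o\subseteq a$ and $o\ne a$, and with a symmetric irreflexive relation $\perp$ (causal disjointness); write $o^\perp=\{a\in K: a\perp o\}$. Assume: (K1) for every $o$ there are $\hat o,\tilde o$ with $\hat o\subset o\subset\tilde o$; (K2) $o\perp a$ and $\hat o\subseteq o$ imply $\hat o\perp a$; (K3) $\{\tilde o:\tilde o\perp a\ \forall a\in o^\perp\}=\{a: a\subseteq o\}$ for every $o$; (K4) if $o\perp a$ then $o^\perp\cap a^\perp\neq\emptyset$, and otherwise there is $\tilde o\subset o$ with $\tilde o^\perp\cap a^\perp\ne\emptyset$; (K5) a group $\mathcal P$ acts on $K$ preserving $\subseteq$, $\subset$ and $\perp$. A 1-simplex $b$ consists of $\partial_0b,\partial_1b\subseteq|b|$ in $K$. A 2-simplex $c$ consists of 1-simplices $\partial_0c,\partial_1c,\partial_2c$ with supports contained in $|c|\in K$ and with $\partial_0\partial_0c=\partial_0\partial_1c$, $\partial_1\partial_0c=\partial_0\partial_2c$, $\partial_1\partial_1c=\partial_1\partial_2c$. The group $\mathcal P$ acts on simplices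 through faces and supports. A path $p=b_n*\cdots*b_1:a\to o$ ($n\ge1$) satisfies $\partial_1b_1=a$, $\partial_1b_{i+1}=\partial_0b_i$, $\partial_0b_n=o$. Homotopy of paths is generated by replacing $\partial_1c$ by $\partial_0c*\partial_2c$, for 2-simplices $c$. Assume further: (K6) $K$ and every $o^\perp$ are pathwise connected (by paths of 1-simplices of the set); (K7) any two paths with the same endpoints are homotopic. Let $\mathcal H$ be a Hilbert space, $o\mapsto\mathcal A(o)\subseteq\mathcal B(\mathcal H)$ a net of von Neumann algebras over $K$, each containing a projection different from $0$ and $1$ (i.e. $\mathcal A(o)\ne\mathbb C1$), and $U$ a unitary representation of $\mathcal P$ on $\mathcal H$; put $\alpha_\lambda=\mathrm{ad}_{U(\lambda)}$. Let $\mathcal A(K)$ be the C*-algebra generated by all the $\mathcal A(o)$. Assume isotony; causality ($\mathcal A(o)$ and $\mathcal A(a)$ commute if $o\perp a$); covariance ($\alpha_\lambda(\mathcal A(o))=\mathcal A(\lambda o)$); factoriality ($\mathcal A(K)'\cap\mathcal A(K)''=\mathbb C1$); the Borchers property (if $o\subset a$ and $0\ne E\in\mathcal A(o)$ is a projection, then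 $VV^*=E$ for some isometry $V\in\mathcal A(a)$); and relative Haag duality ($\mathcal A(o)=\mathcal A(K)''\cap\bigcap_{a\perp o}\mathcal A(a)'$). **The category $Z^1_{\mathrm c}(\mathcal A_K)$.** A covariant 1-cocycle $X$ is a family of unitaries $X_b(\lambda)\in\mathcal A(|b|)$, for $b$ a 1-simplex and $\lambda\in\mathcal P$, with $X_{\partial_1c}(\sigma\lambda)=\alpha_\lambda^{-1}(X_{\lambda\partial_0c}(\sigma))X_{\partial_2c}(\lambda)$ for all 2-simplices $c$ and all $\sigma,\lambda\in\mathcal P$. An arrow $t\in(X,Y)$ is a family $t_a\in\mathcal A(a)$, $a\in K$, with $\alpha_\lambda^{-1}(t_{\lambda\partial_0b})X_b(\lambda)=Y_b(\lambda)t_{\partial_1b}$ for all $b,\lambda$. Composition, linear structure, adjoint and identities are componentwise, and $\|t\|=\|t_a\|$ (independent of $a$). Put $X_b=X_b(e)$ and $X_p=X_{b_n}\cdots X_{b_1}$ for a path $p=b_n*\cdots*b_1$, and let $\rho^X(o)_a(A)=X_pAX_p^*$ for $A\in\mathcal A(a)$, where $p$ is any path to $o$ from some $\tilde a\perp a$.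 Define $$(X\otimes Y)_b(\lambda)=X_b(\lambda)\,\rho^X(\partial_1b)_{|b|}(Y_b(\lambda)),\qquad (t\otimes s)_a=t_a\,\rho^X(a)_a(s_a)$$ ($X$ the source of $t$), $I_b(\lambda)=1$, and $$\epsilon(X,Y)_a=(Y\times X)_{q,p}^*\,(X\times Y)_{p,q},\qquad (X\times Y)_{p,q}=\prod_{i=n}^{1}X_{b_i}\,\rho^X(\partial_1b_i)_{|d_i|}(Y_{d_i}),$$ where $p=b_n*\cdots*b_1$ and $q=d_n*\cdots*d_1$ are any paths of equal length from $a$ to two causally disjoint elements of $K$. These definitions do not depend on the choices made. **Finite statistics.** A left inverse of $X$ is a family of linear maps $\phi_{Z,Y}:(X\otimes Z,X\otimes Y)\to(Z,Y)$, for all covariant 1-cocycles $Z,Y$, with $\phi_{Z\otimes W,Y\otimes W}(t\otimes1_W)=\phi_{Z,Y}(t)\otimes1_W$ and $\phi_{Z',Y'}((1_X\otimes s)\cdot t\cdot(1_X\otimes r))=s\cdot\phi_{Z,Y}(t)\cdot r$ for $t\in(X\otimes Z,X\otimes Y)$, $s\in(Y,Y')$, $r\in(Z',Z)$. It is standard if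 it is positive (each $\phi_{Y,Y}$ maps positive elements to positive elements), normalized ($\phi_{I,I}(1_X)=1_I$), and $\phi_{X,X}(\epsilon(X,X))^2=c\,1_X$ for some $c>0$. A covariant 1-cocycle has finite statistics if it admits a standard left inverse. Let $Z^1_{\mathrm{c,f}}(\mathcal A_K)$ be the full subcategory of $Z^1_{\mathrm c}(\mathcal A_K)$ of the objects with finite statistics. **Proposition.** With the operations above, $Z^1_{\mathrm{c,f}}(\mathcal A_K)$ is a symmetric tensor C*-category: it contains $I$ and is closed under $\otimes$; it is a C*-category; $\otimes$ is a strictly associative and unital bilinear bifunctor compatible with the adjoint; $\epsilon$ is a unitary symmetry; and $(I,I)=\mathbb C1_I$. It is closed under subobjects: for every object $X$ and every projection $0\ne e\in(X,X)$ there are an object $Y$ and an isometry $w\in(Y,X)$ with $w\cdot w^*=e$. It is closed under direct sums: for all objects $X,Y$ there are an object $Z$ and isometries $w\in(X,Z)$, $v\in(Y,Z)$ with $w\cdot w^*+v\cdot v^*=1_Z$. Moreover, every subobject and every direct sum, formed in $Z^1_{\mathrm c}(\mathcal A_K)$, of objects with finite statistics has finite statistics. Every object of $Z^1_{\mathrm{c,f}}(\mathcal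 A_K)$ is a finite direct sum of irreducible objects of it, i.e. there are irreducible $Y_1,\dots,Y_n$ (meaning $(Y_i,Y_i)=\mathbb C1_{Y_i}$) with finite statistics and isometries $w_i\in(Y_i,X)$ with $\sum_iw_i\cdot w_i^*=1_X$. -/

import Mathlib

open CategoryTheory

universe u v w

set_option linter.unusedSectionVars false
set_option linter.unusedVariables false

/-! ### Singular simplices and paths of a poset -/

section Poset

variable {K : Type v} [PartialOrder K]

/-- A singular 1-simplex `b`: faces `∂₀b`, `∂₁b` contained in the support `|b|`. -/
@[ext]
structure Simplex1 (K : Type v) [PartialOrder K] where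
  d0 : K
  d1 : K
  supp : K
  d0_le : d0 ≤ supp
  d1_le : d1 ≤ supp

/-- The degenerate 1-simplex with faces and support equal to `o`. -/
def Simplex1.degenerate (o : K) : Simplex1 K := ⟨o, o, o, le_rfl, le_rfl⟩

/-- A singular 2-simplex `c`: three 1-simplices with supports contained in `|c|`, whose faces fit
together (`∂₀∂₀c = ∂₀∂₁c`, `∂₁∂₀c = ∂₀∂₂c`, `∂₁∂₁c = ∂₁∂₂c`). -/
structure Simplex2 (K : Type v) [PartialOrder K] where
  d0 : Simplex1 K
  d1 : Simplex1 K
  d2 : Simplex1 K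
  supp : K
  d0_le : d0.supp ≤ supp
  d1_le : d1.supp ≤ supp
  d2_le : d2.supp ≤ supp
  d00 : d0.d0 = d1.d0
  d10 : d0.d1 = d2.d0
  d11 : d1.d1 = d2.d1

/-- `IsPath p a o`: the list `p = [b₁, …, bₙ]`, `n ≥ 1`, is a path `bₙ * ⋯ * b₁` from `a` to `o`,
i.e. `∂₁b₁ = a`, `∂₀bᵢ = ∂₁bᵢ₊₁` and `∂₀bₙ = o`. -/
def IsPath : List (Simplex1 K) → K → K → Prop
  | [], _, _ => False
  | [b], a, o => b.d1 = a ∧ b.d0 = o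
  | b :: b' :: l, a, o => b.d1 = a ∧ IsPath (b' :: l) b.d0 o

/-- An elementary deformation: one 1-simplex `∂₁c` of the path is replaced by the pair
`∂₀c * ∂₂c`, for a 2-simplex `c`. -/
inductive ElementaryDeformation : List (Simplex1 K) → List (Simplex1 K) → Prop
  | mk (l l' : List (Simplex1 K)) (c : Simplex2 K) :
      ElementaryDeformation (l ++ c.d1 :: l') (l ++ c.d2 :: c.d0 :: l')

/-- Homotopy of paths: the equivalence relation generated by elementary deformations. -/
def PathHomotopic (p q : List (Simplex1 K)) : Prop :=
  Relation.EqvGen ElementaryDeformation p q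

/-- A set of 0-simplices is pathwise connected if any two of its elements are joined by a path of
1-simplices of the set. -/
def PathwiseConnected (S : Set K) : Prop :=
  ∀ a ∈ S, ∀ o ∈ S, ∃ p, IsPath p a o ∧ ∀ b ∈ p, b.d0 ∈ S ∧ b.d1 ∈ S ∧ b.supp ∈ S

end Poset

/-! ### The set of indices -/

/-- A strict inclusion relation `ssub` and a relation `perp` of causal disjointness on a poset. -/
class CausalRelations (K : Type v) where
  ssub : K → K → Prop
  perp : K → K → Prop

/-- The causal complement `o^⊥`. -/
def causalCompl {K : Type v} [CausalRelations K] (o : K) : Set K :=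
  {a | CausalRelations.perp a o}

open CausalRelations in
/-- The properties of a set of indices that do not involve the symmetry. -/
class IsIndexSet (K : Type v) [PartialOrder K] [CausalRelations K] : Prop where
  nonempty : Nonempty K
  lt_of_ssub : ∀ {o a : K}, ssub o a → o < a
  exists_ssub : ∀ o : K, (∃ o', ssub o' o) ∧ ∃ o', ssub o o'
  perp_symm : ∀ {o a : K}, perp o a → perp a o
  perp_irrefl : ∀ o : K, ¬ perp o o
  perp_of_le : ∀ {o a o' : K}, perp o a → o' ≤ o → perp o' a
  /-- causal completeness: `o^⊥⊥ = {a | a ⊆ o}` -/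
  causally_complete : ∀ o : K, {o' : K | ∀ a ∈ causalCompl o, perp o' a} = {a | a ≤ o}
  compl_inter_of_perp : ∀ o a : K, perp o a → (causalCompl o ∩ causalCompl a).Nonempty
  compl_inter_of_not_perp : ∀ o a : K, ¬ perp o a →
    ∃ o', ssub o' o ∧ (causalCompl o' ∩ causalCompl a).Nonempty
  connected : PathwiseConnected (Set.univ : Set K)
  compl_connected : ∀ o : K, PathwiseConnected (causalCompl o)
  /-- simple connectedness: paths with the same endpoints are homotopic -/
  simply_connected : ∀ (a o : K) (p q : List (Simplex1 K)),
    IsPath p a o → IsPath q a o → PathHomotopic p q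

open CausalRelations in
/-- Compatibility of the action of the symmetry group with the structure of the set of indices. -/
class IsSymmetry (P : Type w) (K : Type v) [Group P] [PartialOrder K] [CausalRelations K]
    [MulAction P K] : Prop where
  smul_le : ∀ (g : P) {a o : K}, a ≤ o → g • a ≤ g • o
  smul_ssub : ∀ (g : P) {a o : K}, ssub a o → ssub (g • a) (g • o)
  smul_perp : ∀ (g : P) {a o : K}, perp a o → perp (g • a) (g • o)

section IndexSet

variable {K : Type v} [PartialOrder K] [CausalRelations K]

/-- The action of the symmetry on 1-simplices. -/
def Simplex1.act {P : Type w} [Group P] [MulAction P K] [IsSymmetry P K] (g : P)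
    (b : Simplex1 K) : Simplex1 K :=
  ⟨g • b.d0, g • b.d1, g • b.supp, IsSymmetry.smul_le g b.d0_le, IsSymmetry.smul_le g b.d1_le⟩

theorem exists_perp [IsIndexSet K] (a : K) : ∃ e : K, CausalRelations.perp e a := by
  by_contra h
  push Not at h
  obtain ⟨-, a', ha'⟩ := IsIndexSet.exists_ssub a
  have h1 : a' ∈ {o' : K | ∀ x ∈ causalCompl a, CausalRelations.perp o' x} :=
    fun x hx => absurd hx (h x)
  rw [IsIndexSet.causally_complete a] at h1
  exact absurd (IsIndexSet.lt_of_ssub ha') (not_lt_of_ge h1)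

theorem exists_path [IsIndexSet K] (a o : K) : ∃ p : List (Simplex1 K), IsPath p a o := by
  obtain ⟨p, hp, -⟩ := IsIndexSet.connected (K := K) a trivial o trivial
  exact ⟨p, hp⟩

/-- There is a path to `o` from some region causally disjoint from `a`. -/
theorem exists_transport [IsIndexSet K] (o a : K) :
    ∃ p : List (Simplex1 K), ∃ e : K, CausalRelations.perp e a ∧ IsPath p e o := by
  obtain ⟨e, he⟩ := exists_perp a
  obtain ⟨p, hp⟩ := exists_path e o
  exact ⟨p, e, he, hp⟩

theorem isPath_replicate (a : K) : ∀ n : ℕ,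
    IsPath (List.replicate (n + 1) (Simplex1.degenerate a)) a a
  | 0 => ⟨rfl, rfl⟩
  | n + 1 => ⟨rfl, isPath_replicate a n⟩

/-- There are two paths of the same length from `a` to causally disjoint regions. -/
theorem exists_exchange [IsIndexSet K] (a : K) :
    ∃ pq : List (Simplex1 K) × List (Simplex1 K), pq.1.length = pq.2.length ∧
      ∃ o o' : K, IsPath pq.1 a o ∧ IsPath pq.2 a o' ∧ CausalRelations.perp o o' := by
  obtain ⟨e, he⟩ := exists_perp a
  obtain ⟨q, hq⟩ := exists_path a e
  cases q with
  | nil => exact hq.elim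
  | cons b l =>
    exact ⟨(List.replicate (l.length + 1) (Simplex1.degenerate a), b :: l), by simp,
      a, e, isPath_replicate a _, hq, IsIndexSet.perp_symm he⟩

end IndexSet

/-! ### The observable net -/

open CausalRelations in
/-- An observable net over `K` in the Hilbert space `H`, covariant under the symmetry `P`. -/
structure ObservableNet (P : Type w) (K : Type v) (H : Type u) [Group P] [PartialOrder K]
    [CausalRelations K] [MulAction P K] [NormedAddCommGroup H] [InnerProductSpace ℂ H]
    [CompleteSpace H] where
  /-- the local von Neumann algebras `𝒜(o)` -/
  alg : K → VonNeumannAlgebra H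
  /-- the unitary representation of the symmetry -/
  U : P →* unitary (H →L[ℂ] H)
  isotony : ∀ {o a : K}, o ≤ a → alg o ≤ alg a
  causality : ∀ {o a : K}, perp o a → ∀ S ∈ alg o, ∀ T ∈ alg a, S * T = T * S
  covariance : ∀ (g : P) (o : K) (T : H →L[ℂ] H),
    T ∈ alg o ↔ (U g : H →L[ℂ] H) * T * star (U g : H →L[ℂ] H) ∈ alg (g • o)
  /-- the local algebras are nontrivial: they are different from `ℂ 1` -/
  nontrivial : ∀ o : K, ∃ E ∈ alg o, IsStarProjection E ∧ E ≠ 0 ∧ E ≠ 1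
  /-- factoriality, for the C*-algebra `𝒜(K)` generated by the local algebras -/
  factoriality :
    let AK : Set (H →L[ℂ] H) :=
      (StarAlgebra.adjoin ℂ (⋃ o : K, (alg o : Set (H →L[ℂ] H)))).topologicalClosure
    Set.centralizer AK ∩ Set.centralizer (Set.centralizer AK) = {T | ∃ c : ℂ, T = c • 1}
  /-- the Borchers property -/
  borchers : ∀ {o a : K}, ssub o a → ∀ E ∈ alg o, IsStarProjection E → E ≠ 0 →
    ∃ V ∈ alg a, star V * V = 1 ∧ V * star V = E
  /-- relative Haag duality -/
  haag_duality : ∀ o : K,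
    let AK : Set (H →L[ℂ] H) :=
      (StarAlgebra.adjoin ℂ (⋃ o : K, (alg o : Set (H →L[ℂ] H)))).topologicalClosure
    (alg o : Set (H →L[ℂ] H)) = Set.centralizer (Set.centralizer AK) ∩
      ⋂ a ∈ causalCompl o, Set.centralizer (alg a : Set (H →L[ℂ] H))

namespace ObservableNet

variable {P : Type w} {K : Type v} {H : Type u} [Group P] [PartialOrder K] [CausalRelations K]
  [IsIndexSet K] [MulAction P K] [IsSymmetry P K] [NormedAddCommGroup H] [InnerProductSpace ℂ H]
  [CompleteSpace H]

/-- `α_g⁻¹ = ad U(g)⁻¹`. -/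
noncomputable def αinv (N : ObservableNet P K H) (g : P) (T : H →L[ℂ] H) : H →L[ℂ] H :=
  star (N.U g : H →L[ℂ] H) * T * (N.U g : H →L[ℂ] H)

/-! ### Covariant 1-cocycles and their intertwiners -/

/-- Fields of operators `(g, b) ↦ X_b(g)` on `P × Σ₁(K)`. -/
abbrev Field1 (_N : ObservableNet P K H) := P → Simplex1 K → H →L[ℂ] H

/-- Fields of operators `a ↦ t_a` on `Σ₀(K)`. -/
abbrev Field0 (_N : ObservableNet P K H) := K → H →L[ℂ] H

/-- Covariant 1-cocycles. -/
@[ext]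
structure Cocycle (N : ObservableNet P K H) where
  val : N.Field1
  unitary_mem : ∀ g b, val g b ∈ unitary (H →L[ℂ] H)
  mem_alg : ∀ g b, val g b ∈ N.alg b.supp
  cocycle : ∀ (c : Simplex2 K) (s g : P),
    val (s * g) c.d1 = N.αinv g (val s (c.d0.act g)) * val g c.d2

/-- The intertwiners `(X, Y)`. -/
def homs (N : ObservableNet P K H) (X Y : N.Field1) : Submodule ℂ N.Field0 where
  carrier := {t | (∀ a, t a ∈ N.alg a) ∧
    ∀ (g : P) (b : Simplex1 K), N.αinv g (t (g • b.d0)) * X g b = Y g b * t b.d1}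
  add_mem' := by
    rintro s t ⟨hs, hs'⟩ ⟨ht, ht'⟩
    refine ⟨fun a => add_mem (hs a) (ht a), fun g b => ?_⟩
    have h1 := hs' g b
    have h2 := ht' g b
    simp only [αinv, Pi.add_apply, mul_add, add_mul] at *
    rw [h1, h2]
  zero_mem' := ⟨fun a => zero_mem _, fun g b => by simp [αinv]⟩
  smul_mem' := by
    rintro c t ⟨ht, ht'⟩
    refine ⟨fun a => (N.alg a).toStarSubalgebra.smul_mem (ht a) c, fun g b => ?_⟩
    have h2 := ht' g b
    simp only [αinv, Pi.smul_apply, mul_smul_comm, smul_mul_assoc] at *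
    rw [h2]

theorem one_mem_homs (N : ObservableNet P K H) (X : N.Field1) : 1 ∈ N.homs X X := by
  refine ⟨fun a => one_mem _, fun g b => ?_⟩
  have h := (Unitary.mem_iff.mp (N.U g).2).1
  simp [αinv, h]

theorem mul_mem_homs (N : ObservableNet P K H) {X Y Z : N.Field1} {t s : N.Field0}
    (ht : t ∈ N.homs X Y) (hs : s ∈ N.homs Z X) : t * s ∈ N.homs Z Y := by
  refine ⟨fun a => mul_mem (ht.1 a) (hs.1 a), fun g b => ?_⟩
  have h := (Unitary.mem_iff.mp (N.U g).2).2
  have h1 := ht.2 g b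
  have h2 := hs.2 g b
  have h3 : N.αinv g ((t * s) (g • b.d0)) =
      N.αinv g (t (g • b.d0)) * N.αinv g (s (g • b.d0)) := by
    simp only [αinv, Pi.mul_apply]
    calc _ = star (N.U g : H →L[ℂ] H) * t (g • b.d0) * 1 * s (g • b.d0) *
          (N.U g : H →L[ℂ] H) := by simp only [mul_one, mul_assoc]
      _ = _ := by rw [← h]; simp only [mul_assoc]
  rw [h3, mul_assoc, h2, ← mul_assoc, h1, mul_assoc, Pi.mul_apply]

/-- The category `Z¹_c(𝒜_K)` of covariant 1-cocycles; `f ≫ g` is the componentwise product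
`(g · f)_a = g_a f_a`. -/
instance (N : ObservableNet P K H) : Category N.Cocycle where
  Hom X Y := N.homs X.val Y.val
  id X := ⟨1, N.one_mem_homs X.val⟩
  comp f g := ⟨g.1 * f.1, N.mul_mem_homs g.2 f.2⟩
  id_comp f := Subtype.ext (mul_one _)
  comp_id f := Subtype.ext (one_mul _)
  assoc f g h := Subtype.ext (mul_assoc h.1 g.1 f.1).symm

instance (N : ObservableNet P K H) : Preadditive N.Cocycle where
  homGroup X Y := inferInstanceAs (AddCommGroup (N.homs X.val Y.val))
  add_comp _ _ _ f f' g := Subtype.ext (mul_add g.1 f.1 f'.1)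
  comp_add _ _ _ f g g' := Subtype.ext (add_mul g.1 g'.1 f.1)

instance (N : ObservableNet P K H) : Linear ℂ N.Cocycle where
  homModule X Y := inferInstanceAs (Module ℂ (N.homs X.val Y.val))
  smul_comp _ _ _ c f g := Subtype.ext (mul_smul_comm c g.1 f.1)
  comp_smul _ _ _ f c g := Subtype.ext (smul_mul_assoc c g.1 f.1)

/-! ### Tensor product and permutation symmetry -/

/-- The value `X_p = X_{bₙ} ⋯ X_{b₁}` of (the Roberts 1-cocycle of) `X` on a path. -/
def pathOp (N : ObservableNet P K H) (X : N.Field1) : List (Simplex1 K) → H →L[ℂ] H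
  | [] => 1
  | b :: p => pathOp N X p * X 1 b

/-- The morphism `ρ(o)_a(A) = X_p A X_p*`, where `p : ã → o` is any path starting at some `ã ⊥ a`
(for a covariant 1-cocycle `X` and `A ∈ 𝒜(a)` the choice of `ã` and `p` is immaterial). -/
noncomputable def rho (N : ObservableNet P K H) (X : N.Field1) (o a : K) (A : H →L[ℂ] H) :
    H →L[ℂ] H :=
  N.pathOp X (exists_transport o a).choose * A * star (N.pathOp X (exists_transport o a).choose)

/-- `(X ⊗ Y)_b(g) = X_b(g) ρ(∂₁b)_{|b|}(Y_b(g))`, with `ρ` the morphism defined by `X`. -/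
noncomputable def tensorObj (N : ObservableNet P K H) (X Y : N.Field1) : N.Field1 :=
  fun g b => X g b * N.rho X b.d1 b.supp (Y g b)

/-- `(t ⊗ s)_a = t_a ρ(a)_a(s_a)` for `t` with source `X`, with `ρ` the morphism defined by `X`. -/
noncomputable def tensorHom (N : ObservableNet P K H) (X : N.Field1) (t s : N.Field0) :
    N.Field0 :=
  fun a => t a * N.rho X a a (s a)

/-- `(X × Y)_{p,q}` for paths `p`, `q` of the same length: the product
`(X × Y)_{bₙ,dₙ} ⋯ (X × Y)_{b₁,d₁}`, where `(X × Y)_{b,d} = X_b ρ(∂₁b)_{|d|}(Y_d)`. -/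
noncomputable def cross (N : ObservableNet P K H) (X Y : N.Field1) :
    List (Simplex1 K) → List (Simplex1 K) → H →L[ℂ] H
  | b :: p, d :: q => cross N X Y p q * (X 1 b * N.rho X b.d1 d.supp (Y 1 d))
  | _, _ => 1

/-- The permutation symmetry `ε(X, Y)_a = (Y × X)_{q,p}* (X × Y)_{p,q}`, where `p`, `q` are any two
paths of the same length starting at `a` and ending in causally disjoint regions (for covariant
1-cocycles the choice of `p`, `q` is immaterial). -/
noncomputable def eps (N : ObservableNet P K H) (X Y : N.Field1) : N.Field0 :=
  fun a => star (N.cross Y X (exists_exchange a).choose.2 (exists_exchange a).choose.1) *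
    N.cross X Y (exists_exchange a).choose.1 (exists_exchange a).choose.2

/-! ### Finite statistics -/

/-- Left inverses of `X`: linear maps `φ Z Y : (X ⊗ Z, X ⊗ Y) → (Z, Y)`, for all covariant
1-cocycles `Z`, `Y`, satisfying the two compatibility relations. (Only the values of `φ Z Y` on
`(X ⊗ Z, X ⊗ Y)`, with `Z`, `Y` covariant 1-cocycles, matter.) -/
structure IsLeftInverse (N : ObservableNet P K H) (X : N.Cocycle)
    (φ : N.Field1 → N.Field1 → N.Field0 → N.Field0) : Prop where
  mem : ∀ (Z Y : N.Cocycle), ∀ t ∈ N.homs (N.tensorObj X.val Z.val) (N.tensorObj X.val Y.val),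
    φ Z.val Y.val t ∈ N.homs Z.val Y.val
  map_add : ∀ (Z Y : N.Cocycle),
    ∀ t ∈ N.homs (N.tensorObj X.val Z.val) (N.tensorObj X.val Y.val),
    ∀ t' ∈ N.homs (N.tensorObj X.val Z.val) (N.tensorObj X.val Y.val),
    φ Z.val Y.val (t + t') = φ Z.val Y.val t + φ Z.val Y.val t'
  map_smul : ∀ (Z Y : N.Cocycle) (c : ℂ),
    ∀ t ∈ N.homs (N.tensorObj X.val Z.val) (N.tensorObj X.val Y.val),
    φ Z.val Y.val (c • t) = c • φ Z.val Y.val t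
  tensor_one : ∀ (Z Y W : N.Cocycle),
    ∀ t ∈ N.homs (N.tensorObj X.val Z.val) (N.tensorObj X.val Y.val),
    φ (N.tensorObj Z.val W.val) (N.tensorObj Y.val W.val)
        (N.tensorHom (N.tensorObj X.val Z.val) t 1) =
      N.tensorHom Z.val (φ Z.val Y.val t) 1
  comp : ∀ (Z Y Z' Y' : N.Cocycle),
    ∀ t ∈ N.homs (N.tensorObj X.val Z.val) (N.tensorObj X.val Y.val),
    ∀ s ∈ N.homs Y.val Y'.val, ∀ r ∈ N.homs Z'.val Z.val,
    φ Z'.val Y'.val (N.tensorHom X.val 1 s * t * N.tensorHom X.val 1 r) =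
      s * φ Z.val Y.val t * r

/-- The identity 1-cocycle `I`. -/
def unitField (N : ObservableNet P K H) : N.Field1 := fun _ _ => 1

/-- Standard left inverses: positive, normalized, and `φ_{X,X}(ε(X,X))² = c 1` with `c > 0`.
An arrow of `(Z, Z)` is positive if it is of the form `s* s` with `s ∈ (Z, Z)`. -/
structure IsStandardLeftInverse (N : ObservableNet P K H) (X : N.Cocycle)
    (φ : N.Field1 → N.Field1 → N.Field0 → N.Field0) : Prop extends N.IsLeftInverse X φ where
  positive : ∀ (Y : N.Cocycle),
    ∀ s ∈ N.homs (N.tensorObj X.val Y.val) (N.tensorObj X.val Y.val),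
    ∃ r ∈ N.homs Y.val Y.val, φ Y.val Y.val (star s * s) = star r * r
  normalized : φ N.unitField N.unitField 1 = 1
  standard : ∃ c : ℝ, 0 < c ∧
    φ X.val X.val (N.eps X.val X.val) * φ X.val X.val (N.eps X.val X.val) = (c : ℂ) • 1

/-- Finite statistics: existence of a standard left inverse. -/
def HasFiniteStatistics (N : ObservableNet P K H) : ObjectProperty N.Cocycle :=
  fun X => ∃ φ, N.IsStandardLeftInverse X φ

/-- The full subcategory `Z¹_{c,f}(𝒜_K)` of the covariant 1-cocycles with finite statistics. -/
abbrev FinStat (N : ObservableNet P K H) := N.HasFiniteStatistics.FullSubcategory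

end ObservableNet

/-! ### C*-categories -/

/-- A C*-category structure on a `ℂ`-linear category: complete norms and an antilinear,
contravariant, involutive `*`-operation `adj`, with the C*-identity and positivity of `f* · f`. -/
structure CStarCategory (C : Type*) [Category C] [Preadditive C] [Linear ℂ C] where
  adj : ∀ {X Y : C}, (X ⟶ Y) → (Y ⟶ X)
  norm : ∀ {X Y : C}, (X ⟶ Y) → ℝ
  adj_add : ∀ {X Y : C} (f g : X ⟶ Y), adj (f + g) = adj f + adj g
  adj_smul : ∀ {X Y : C} (c : ℂ) (f : X ⟶ Y), adj (c • f) = (starRingEnd ℂ) c • adj f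
  adj_adj : ∀ {X Y : C} (f : X ⟶ Y), adj (adj f) = f
  adj_comp : ∀ {X Y Z : C} (f : X ⟶ Y) (g : Y ⟶ Z), adj (f ≫ g) = adj g ≫ adj f
  norm_add_le : ∀ {X Y : C} (f g : X ⟶ Y), norm (f + g) ≤ norm f + norm g
  norm_smul : ∀ {X Y : C} (c : ℂ) (f : X ⟶ Y), norm (c • f) = ‖c‖ * norm f
  eq_zero_of_norm : ∀ {X Y : C} (f : X ⟶ Y), norm f = 0 → f = 0
  complete : ∀ {X Y : C} (f : ℕ → (X ⟶ Y)),
    (∀ ε > 0, ∃ n, ∀ i ≥ n, ∀ j ≥ n, norm (f i - f j) < ε) →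
    ∃ g : X ⟶ Y, ∀ ε > 0, ∃ n, ∀ i ≥ n, norm (f i - g) < ε
  norm_comp_le : ∀ {X Y Z : C} (f : X ⟶ Y) (g : Y ⟶ Z), norm (f ≫ g) ≤ norm g * norm f
  norm_adj_comp : ∀ {X Y : C} (f : X ⟶ Y), norm (f ≫ adj f) = norm f ^ 2
  positive : ∀ {X Y : C} (f : X ⟶ Y), ∃ g : X ⟶ X, f ≫ adj f = g ≫ adj g

namespace CStarCategory

variable {C : Type*} [Category C] [Preadditive C] [Linear ℂ C] (S : CStarCategory C)

/-- `e* · e = e`. -/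
def IsProjection {X : C} (e : X ⟶ X) : Prop := e ≫ S.adj e = e

/-- `w* · w = 1`. -/
def IsIsometry {X Y : C} (w : X ⟶ Y) : Prop := w ≫ S.adj w = 𝟙 X

/-- `(X, X) = ℂ 1_X`. -/
def _root_.IsIrreducibleObj (X : C) : Prop := ∀ f : X ⟶ X, ∃ c : ℂ, f = c • 𝟙 X

/-- Every nonzero projection `e ∈ (X, X)` is of the form `w · w*`, with `w ∈ (Y, X)` an isometry. -/
def HasSubobjects : Prop :=
  ∀ (X : C) (e : X ⟶ X), S.IsProjection e → e ≠ 0 →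
    ∃ (Y : C) (w : Y ⟶ X), S.IsIsometry w ∧ S.adj w ≫ w = e

/-- `Z` is the direct sum of `X` and `Y`, through the isometries `w` and `v`. -/
def IsDirectSum {X Y Z : C} (w : X ⟶ Z) (v : Y ⟶ Z) : Prop :=
  S.IsIsometry w ∧ S.IsIsometry v ∧ S.adj w ≫ w + S.adj v ≫ v = 𝟙 Z

/-- Every pair of objects has a direct sum. -/
def HasDirectSums : Prop :=
  ∀ X Y : C, ∃ (Z : C) (w : X ⟶ Z) (v : Y ⟶ Z), S.IsDirectSum w v

/-- `X` is a finite direct sum of irreducible objects. -/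
def IsFiniteSumOfIrreducibles (X : C) : Prop :=
  ∃ (n : ℕ) (Y : Fin n → C) (w : ∀ i, Y i ⟶ X), (∀ i, IsIrreducibleObj (Y i)) ∧
    (∀ i, S.IsIsometry (w i)) ∧ ∑ i, S.adj (w i) ≫ w i = 𝟙 X

open MonoidalCategory in
/-- A symmetric monoidal structure makes the C*-category a symmetric tensor C*-category: the tensor
product of arrows is bilinear and compatible with the adjoint, the constraints are unitary, and the
tensor unit is irreducible. -/
structure IsSymmetricTensor [MonoidalCategory C] [SymmetricCategory C] : Prop where
  add_tensor : ∀ {X Y Z W : C} (f f' : X ⟶ Y) (g : Z ⟶ W),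
    (f + f') ⊗ₘ g = f ⊗ₘ g + f' ⊗ₘ g
  tensor_add : ∀ {X Y Z W : C} (f : X ⟶ Y) (g g' : Z ⟶ W),
    f ⊗ₘ (g + g') = f ⊗ₘ g + f ⊗ₘ g'
  smul_tensor : ∀ {X Y Z W : C} (c : ℂ) (f : X ⟶ Y) (g : Z ⟶ W),
    (c • f) ⊗ₘ g = c • (f ⊗ₘ g)
  tensor_smul : ∀ {X Y Z W : C} (c : ℂ) (f : X ⟶ Y) (g : Z ⟶ W),
    f ⊗ₘ (c • g) = c • (f ⊗ₘ g)
  adj_tensor : ∀ {X Y Z W : C} (f : X ⟶ Y) (g : Z ⟶ W),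
    S.adj (f ⊗ₘ g) = S.adj f ⊗ₘ S.adj g
  adj_associator : ∀ X Y Z : C, S.adj (α_ X Y Z).hom = (α_ X Y Z).inv
  adj_leftUnitor : ∀ X : C, S.adj (λ_ X).hom = (λ_ X).inv
  adj_rightUnitor : ∀ X : C, S.adj (ρ_ X).hom = (ρ_ X).inv
  adj_braiding : ∀ X Y : C, S.adj (β_ X Y).hom = (β_ X Y).inv
  irreducible_unit : IsIrreducibleObj (𝟙_ C)

end CStarCategory

namespace ObservableNet

variable {P : Type w} {K : Type v} {H : Type u} [Group P] [PartialOrder K] [CausalRelations K]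
  [IsIndexSet K] [MulAction P K] [IsSymmetry P K] [NormedAddCommGroup H] [InnerProductSpace ℂ H]
  [CompleteSpace H]

/-- The 1-cocycle field of an object of `Z¹_{c,f}(𝒜_K)`. -/
def FinStat.field {N : ObservableNet P K H} (X : N.FinStat) : N.Field1 := X.obj.val

/-- The components `a ↦ t_a` of an arrow of `Z¹_{c,f}(𝒜_K)`. -/
def FinStat.comp {N : ObservableNet P K H} {X Y : N.FinStat} (t : X ⟶ Y) : N.Field0 :=
  (show N.homs X.obj.val Y.obj.val from t.hom).1

/-- The involution and the norm of the C*-category `Z¹_{c,f}(𝒜_K)` are those of `ℬ(H)`. -/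
def IsOperatorCStar {N : ObservableNet P K H} (S : CStarCategory N.FinStat) : Prop :=
  (∀ (X Y : N.FinStat) (t : X ⟶ Y), FinStat.comp (S.adj t) = star (FinStat.comp t)) ∧
  (∀ (X Y : N.FinStat) (t : X ⟶ Y) (a : K), S.norm t = ‖FinStat.comp t a‖)

open MonoidalCategory in
/-- The monoidal structure of `Z¹_{c,f}(𝒜_K)` has the tensor product `tensorObj`, `tensorHom`, the
unit `I` and trivial associativity and unit constraints (i.e. it is strict), and its symmetry is
`eps`. -/
structure IsCocycleTensor (N : ObservableNet P K H) [MonoidalCategory N.FinStat]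
    [SymmetricCategory N.FinStat] : Prop where
  unit : FinStat.field (𝟙_ N.FinStat) = N.unitField
  obj : ∀ X Y : N.FinStat, (X ⊗ Y).field = N.tensorObj X.field Y.field
  hom : ∀ {X Y Z W : N.FinStat} (t : X ⟶ Y) (s : Z ⟶ W),
    FinStat.comp (t ⊗ₘ s) = N.tensorHom X.field (FinStat.comp t) (FinStat.comp s)
  associator : ∀ X Y Z : N.FinStat, FinStat.comp (α_ X Y Z).hom = 1
  leftUnitor : ∀ X : N.FinStat, FinStat.comp (λ_ X).hom = 1
  rightUnitor : ∀ X : N.FinStat, FinStat.comp (ρ_ X).hom = 1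
  symmetry : ∀ X Y : N.FinStat, FinStat.comp (β_ X Y).hom = N.eps X.field Y.field

/-- Finite statistics pass to subobjects in `Z¹_c(𝒜_K)`. -/
def FinStatClosedUnderSubobjects (N : ObservableNet P K H) : Prop :=
  ∀ X Y : N.Cocycle, N.HasFiniteStatistics X →
    ∀ w ∈ N.homs Y.val X.val, star w * w = 1 → N.HasFiniteStatistics Y

/-- Finite statistics pass to direct sums in `Z¹_c(𝒜_K)`. -/
def FinStatClosedUnderDirectSums (N : ObservableNet P K H) : Prop :=
  ∀ X Y Z : N.Cocycle, N.HasFiniteStatistics X → N.HasFiniteStatistics Y →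
    ∀ w ∈ N.homs X.val Z.val, ∀ v ∈ N.homs Y.val Z.val,
      star w * w = 1 → star v * v = 1 → w * star w + v * star v = 1 → N.HasFiniteStatistics Z

end ObservableNet

/-!
The mechanism behind the theorem is the field calculus of `1_X ⊗ -`. Since `K` is simply connected,
the value `X_p` of a covariant 1-cocycle `X` on a path depends only on the endpoints of `p`; call it
the transport `X(o, a)`. If `e` is causally disjoint from `a`, then `ρ(o)_a = ad X(o, e)` on `𝒜(a)`,
and `t ↦ ρ(a)_a(t_a)` is a *-endomorphism `X.amp` of the algebra of all fields of operators, which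
preserves the local ones by relative Haag duality. In these terms `t ⊗ s = t * X.amp s`, tensoring
with an identity arrow from the right does not change components, and the tensor category axioms
reduce to `amp_tensor` and to the fact that intertwiners exchange the endomorphisms
(`homs_amp_comm`). The symmetry `ε` is independent of the paths because any two pairs of causally
disjoint regions are joined by moving one region at a time (`exchange_eq`); it is natural and
satisfies the hexagon identities (`eps_natural`, `eps_tensor_right`). Subobjects and direct sums in
`Z¹_c(𝒜_K)` come from the Borchers property (`exists_subobject`, `exists_directSum`).

For a left inverse `φ` of `X` put `λ = φ(ε(X, X))`. The Cauchy–Schwarz inequality for `φ` gives the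
Pimsner–Popa bound `λ* T* T λ ≤ φ(1) (1_X ⊗ φ(T* T))` (`IsPositiveLeftInverse.pimsnerPopa`). If `φ`
is standard, `λ² = c`, it bounds the number of disjoint projections of `(X, X)`, so that
self-adjoint elements of `(X, X)` have finite spectrum (`HasFiniteStatistics.exists_spectral`).
Left inverses of the unit, of tensor products and of direct sums are written down explicitly.

Subobjects are the delicate case: the compression of `φ` to a subobject is standard only if `λ` is
central in `(X, X)`, which is proved as follows. A nonzero intertwiner from one eigenspace of `λ` to
the other, cut down to a spectral projection on which it is a multiple of an isometry, exhibits an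
object `Y` as a subobject of both eigenspaces. This gives two left inverses of `Y`, whose statistics
operators have opposite signs, and a combination `Ψ` of them satisfies `Ψ(ε(Y, Y)) = 0` and still a
Pimsner–Popa bound `k T* T ≤ 1_Y ⊗ Ψ(T* T)`. In the algebra generated by the permutations of
`Y ⊗ ⋯ ⊗ Y` (`n + 1` factors), let `J` be the Jucys–Murphy element and `E` the sum of all
permutations. Then `(1 + J) E = (n + 1) E` and `E ≠ 0`, while `Ψ((1 + J)²) = (n + 1) Ψ(1)`, so the
bound gives `k (n + 1)² ≤ (n + 1) Ψ(1)`, which is false for large `n`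
(`IsLeftInverse.not_bound_of_statistics_eq_zero`). Finally `φ` is bounded below by `c` on the
nonzero projections of `(X, X)`, so that splitting an object repeatedly ends, after finitely many
steps, in a direct sum of irreducible objects.
-/

/-! ### Transport along paths -/

section Paths

variable {K : Type v} [PartialOrder K]

theorem IsPath.append {p q : List (Simplex1 K)} {a o e : K} (hp : IsPath p a o)
    (hq : IsPath q o e) : IsPath (p ++ q) a e := by
  induction p generalizing a with
  | nil => exact hp.elim
  | cons b p ih =>
    cases p with
    | nil =>
      obtain ⟨rfl, rfl⟩ := hp
      cases q with
      | nil => exact hq.elim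
      | cons d q => exact ⟨rfl, hq⟩
    | cons b' p => exact ⟨hp.1, ih hp.2⟩

end Paths

namespace ObservableNet

variable {P : Type w} {K : Type v} {H : Type u} [Group P] [PartialOrder K] [CausalRelations K]
  [IsIndexSet K] [MulAction P K] [IsSymmetry P K] [NormedAddCommGroup H] [InnerProductSpace ℂ H]
  [CompleteSpace H] (N : ObservableNet P K H)

/-- A field on 1-simplices which, at the identity of the symmetry group, is a unitary 1-cocycle
with values in `ℬ(H)` (no localization is required). -/
structure IsPathField (F : N.Field1) : Prop where
  unitary_mem : ∀ b, F 1 b ∈ unitary (H →L[ℂ] H)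
  cocycle : ∀ c : Simplex2 K, F 1 c.d1 = F 1 c.d0 * F 1 c.d2

/-- The value of a 1-cocycle on any path from `a` to `o`. -/
noncomputable def transport (F : N.Field1) (o a : K) : H →L[ℂ] H :=
  N.pathOp F (exists_path a o).choose

variable {N}

theorem pathOp_append (F : N.Field1) (p q : List (Simplex1 K)) :
    N.pathOp F (p ++ q) = N.pathOp F q * N.pathOp F p := by
  induction p with
  | nil => simp [pathOp]
  | cons b p ih => simp [pathOp, ih, mul_assoc]

theorem IsPathField.pathOp_eq_of_homotopic {F : N.Field1} (hF : N.IsPathField F)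
    {p q : List (Simplex1 K)} (h : PathHomotopic p q) : N.pathOp F p = N.pathOp F q := by
  induction h with
  | rel p q h =>
    obtain ⟨l, l', c⟩ := h
    simp [pathOp_append, pathOp, hF.cocycle c, mul_assoc]
  | refl => rfl
  | symm _ _ _ ih => exact ih.symm
  | trans _ _ _ _ _ ih ih' => exact ih.trans ih'

theorem IsPathField.pathOp_mem_unitary {F : N.Field1} (hF : N.IsPathField F)
    (p : List (Simplex1 K)) : N.pathOp F p ∈ unitary (H →L[ℂ] H) := by
  induction p with
  | nil => exact one_mem _
  | cons b p ih => exact mul_mem ih (hF.unitary_mem b)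

theorem IsPathField.transport_mem_unitary {F : N.Field1} (hF : N.IsPathField F) (o a : K) :
    N.transport F o a ∈ unitary (H →L[ℂ] H) :=
  hF.pathOp_mem_unitary _

theorem IsPathField.pathOp_eq {F : N.Field1} (hF : N.IsPathField F) {p : List (Simplex1 K)}
    {a o : K} (hp : IsPath p a o) : N.pathOp F p = N.transport F o a :=
  hF.pathOp_eq_of_homotopic
    (IsIndexSet.simply_connected a o _ _ hp (exists_path a o).choose_spec)

theorem IsPathField.transport_mul {F : N.Field1} (hF : N.IsPathField F) (o e a : K) :
    N.transport F o e * N.transport F e a = N.transport F o a := by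
  rw [transport, transport, ← pathOp_append]
  exact hF.pathOp_eq ((exists_path a e).choose_spec.append (exists_path e o).choose_spec)

theorem IsPathField.transport_mul_assoc {F : N.Field1} (hF : N.IsPathField F) (o e a : K)
    (T : H →L[ℂ] H) :
    N.transport F o e * (N.transport F e a * T) = N.transport F o a * T := by
  rw [← mul_assoc, hF.transport_mul]

theorem IsPathField.transport_self {F : N.Field1} (hF : N.IsPathField F) (a : K) :
    N.transport F a a = 1 := by
  have h := (Unitary.mem_iff.mp (hF.transport_mem_unitary a a)).1
  calc N.transport F a a
      = star (N.transport F a a) * (N.transport F a a * N.transport F a a) := by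
        rw [← mul_assoc, h, one_mul]
    _ = 1 := by rw [hF.transport_mul, h]

theorem IsPathField.star_transport {F : N.Field1} (hF : N.IsPathField F) (o a : K) :
    star (N.transport F o a) = N.transport F a o := by
  have h := (Unitary.mem_iff.mp (hF.transport_mem_unitary o a)).1
  calc star (N.transport F o a)
      = star (N.transport F o a) * (N.transport F o a * N.transport F a o) := by
        rw [hF.transport_mul, hF.transport_self, mul_one]
    _ = _ := by rw [← mul_assoc, h, one_mul]

theorem IsPathField.transport_simplex {F : N.Field1} (hF : N.IsPathField F) (b : Simplex1 K) :
    N.transport F b.d0 b.d1 = F 1 b :=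
  (hF.pathOp_eq (p := [b]) ⟨rfl, rfl⟩).symm.trans (by simp [pathOp])

/-- Operators intertwining two 1-cocycles on the 1-simplices of a connected set intertwine the
transports between points of that set. -/
theorem transport_intertwine {F G : N.Field1} (hF : N.IsPathField F) (hG : N.IsPathField G)
    {S : Set K} (hS : PathwiseConnected S) (m : K → H →L[ℂ] H)
    (h : ∀ b : Simplex1 K, b.d0 ∈ S → b.d1 ∈ S → b.supp ∈ S → m b.d0 * F 1 b = G 1 b * m b.d1)
    {o a : K} (ho : o ∈ S) (ha : a ∈ S) :
    m o * N.transport F o a = N.transport G o a * m a := by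
  obtain ⟨p, hp, hpS⟩ := hS a ha o ho
  rw [← hF.pathOp_eq hp, ← hG.pathOp_eq hp]
  clear ha
  induction p generalizing a with
  | nil => exact hp.elim
  | cons b p ih =>
    have hb := hpS b (by simp)
    have hb' := h b hb.1 hb.2.1 hb.2.2
    cases p with
    | nil =>
      obtain ⟨rfl, rfl⟩ := hp
      simpa [pathOp] using hb'
    | cons b' p =>
      have ih' := ih hp.2 (fun d hd => hpS d (by simp [hd]))
      rw [pathOp, ← mul_assoc, ih', mul_assoc, hb', ← hp.1, ← mul_assoc]
      rfl

/-! ### The automorphisms implemented by the symmetry -/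

theorem U_mul_star (g : P) : (N.U g : H →L[ℂ] H) * star (N.U g : H →L[ℂ] H) = 1 :=
  (Unitary.mem_iff.mp (N.U g).2).2

theorem αinv_mul (g : P) (S T : H →L[ℂ] H) : N.αinv g (S * T) = N.αinv g S * N.αinv g T := by
  simp only [αinv]
  calc _ = star (N.U g : H →L[ℂ] H) * S * ((N.U g : H →L[ℂ] H) * star (N.U g : H →L[ℂ] H)) * T
        * (N.U g : H →L[ℂ] H) := by rw [U_mul_star, mul_one]; simp only [mul_assoc]
    _ = _ := by simp only [mul_assoc]

@[simp] theorem αinv_one (g : P) : N.αinv g 1 = 1 := by simp [αinv]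

theorem αinv_star (g : P) (T : H →L[ℂ] H) : N.αinv g (star T) = star (N.αinv g T) := by
  simp [αinv, mul_assoc]

theorem αinv_add (g : P) (S T : H →L[ℂ] H) : N.αinv g (S + T) = N.αinv g S + N.αinv g T := by
  simp [αinv, mul_add, add_mul]

@[simp] theorem αinv_id (T : H →L[ℂ] H) : N.αinv 1 T = T := by simp [αinv]

theorem αinv_αinv (g h : P) (T : H →L[ℂ] H) : N.αinv g (N.αinv h T) = N.αinv (h * g) T := by
  simp [αinv, mul_assoc]

theorem αinv_mem_unitary (g : P) {T : H →L[ℂ] H} (hT : T ∈ unitary (H →L[ℂ] H)) :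
    N.αinv g T ∈ unitary (H →L[ℂ] H) := by
  rw [Unitary.mem_iff] at hT ⊢
  rw [← αinv_star, ← αinv_mul, ← αinv_mul, hT.1, hT.2]
  simp

theorem αinv_mem (g : P) {o : K} {T : H →L[ℂ] H} (hT : T ∈ N.alg (g • o)) :
    N.αinv g T ∈ N.alg o := by
  rw [N.covariance g]
  convert hT using 1
  calc _ = ((N.U g : H →L[ℂ] H) * star (N.U g : H →L[ℂ] H)) * T *
        ((N.U g : H →L[ℂ] H) * star (N.U g : H →L[ℂ] H)) := by simp only [αinv, mul_assoc]
    _ = _ := by simp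

theorem IsPath.act {p : List (Simplex1 K)} {a o : K} (hp : IsPath p a o) (g : P) :
    IsPath (p.map (Simplex1.act g)) (g • a) (g • o) := by
  induction p generalizing a with
  | nil => exact hp.elim
  | cons b p ih =>
    cases p with
    | nil =>
      obtain ⟨rfl, rfl⟩ := hp
      exact ⟨rfl, rfl⟩
    | cons b' p => exact ⟨by rw [← hp.1]; rfl, ih hp.2⟩

/-- The transport of the translated 1-cocycle is the translated transport. -/
theorem transport_act {F G : N.Field1} (hF : N.IsPathField F) (hG : N.IsPathField G) (g : P)
    (h : ∀ b, G 1 b = N.αinv g (F 1 (b.act g))) (o a : K) :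
    N.transport G o a = N.αinv g (N.transport F (g • o) (g • a)) := by
  obtain ⟨p, hp⟩ := exists_path a o
  rw [← hG.pathOp_eq hp, ← hF.pathOp_eq (IsPath.act hp g)]
  clear hp
  induction p with
  | nil => simp [pathOp]
  | cons b p ih => simp [pathOp, ih, h, αinv_mul]

/-! ### Locality of cocycles -/

variable (N) in
/-- The weak closure `𝒜(K)''` of the global algebra. -/
def global : Set (H →L[ℂ] H) :=
  Set.centralizer (Set.centralizer
    ((StarAlgebra.adjoin ℂ (⋃ o : K, (N.alg o : Set (H →L[ℂ] H)))).topologicalClosure :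
      Set (H →L[ℂ] H)))

theorem mem_global {o : K} {T : H →L[ℂ] H} (hT : T ∈ N.alg o) : T ∈ N.global := by
  apply Set.subset_centralizer_centralizer
  exact subset_closure (StarAlgebra.subset_adjoin ℂ _ (Set.mem_iUnion.mpr ⟨o, hT⟩))

theorem mul_mem_global {S T : H →L[ℂ] H} (hS : S ∈ N.global) (hT : T ∈ N.global) :
    S * T ∈ N.global :=
  Set.mul_mem_centralizer hS hT

theorem mem_alg_of_global {o : K} {T : H →L[ℂ] H} (hT : T ∈ N.global)
    (h : ∀ e, CausalRelations.perp e o → ∀ B ∈ N.alg e, B * T = T * B) : T ∈ N.alg o := by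
  have h' := N.haag_duality o
  change T ∈ (N.alg o : Set (H →L[ℂ] H))
  simp only at h'
  rw [h']
  refine ⟨hT, Set.mem_iInter₂.mpr fun e he => ?_⟩
  exact fun B hB => h e he B hB

theorem mem_centralizer_global {T : H →L[ℂ] H} (h : ∀ o, ∀ B ∈ N.alg o, B * T = T * B) :
    T ∈ Set.centralizer
      ((StarAlgebra.adjoin ℂ (⋃ o : K, (N.alg o : Set (H →L[ℂ] H)))).topologicalClosure :
        Set (H →L[ℂ] H)) := by
  have h1 : StarAlgebra.adjoin ℂ (⋃ o : K, (N.alg o : Set (H →L[ℂ] H))) ≤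
      StarSubalgebra.centralizer ℂ {T} := by
    rw [StarAlgebra.adjoin_le_iff]
    intro B hB
    obtain ⟨o, hB⟩ := Set.mem_iUnion.mp hB
    rw [SetLike.mem_coe, StarSubalgebra.mem_centralizer_iff]
    rintro _ rfl
    refine ⟨(h o B hB).symm, ?_⟩
    have := congrArg star (h o (star B) (star_mem hB))
    simpa using this
  have h2 := StarSubalgebra.topologicalClosure_minimal h1
    (by
      rw [StarSubalgebra.coe_centralizer]
      exact Set.isClosed_centralizer _)
  intro B hB
  exact ((StarSubalgebra.mem_centralizer_iff ℂ).mp (h2 hB) T rfl).1.symm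

/-- Operators commuting with the local algebras and contained in `𝒜(K)''` are scalar. -/
theorem eq_smul_one_of_global {T : H →L[ℂ] H} (hT : T ∈ N.global)
    (h : ∀ o, ∀ B ∈ N.alg o, B * T = T * B) : ∃ c : ℂ, T = c • 1 := by
  have h' := N.factoriality
  simp only at h'
  have : T ∈ {T : H →L[ℂ] H | ∃ c : ℂ, T = c • 1} := h' ▸ ⟨mem_centralizer_global h, hT⟩
  exact this

/-! ### Covariant 1-cocycles as localized objects -/

open CausalRelations (perp)

theorem Simplex1.act_one (b : Simplex1 K) : b.act (1 : P) = b := by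
  ext <;> simp [Simplex1.act]

theorem Cocycle.isPathField (X : N.Cocycle) : N.IsPathField X.val where
  unitary_mem := X.unitary_mem 1
  cocycle c := by simpa [Simplex1.act_one] using X.cocycle c 1 1

/-- The transport `X_p` of a covariant 1-cocycle along any path `p` from `a` to `o`. -/
noncomputable abbrev Cocycle.tr (X : N.Cocycle) (o a : K) : H →L[ℂ] H := N.transport X.val o a

/-- The value `V_a(g)` of a covariant 1-cocycle on the degenerate 1-simplex of `a`. Together with
the values at the identity of the symmetry group these determine the cocycle. -/
abbrev Cocycle.vert (X : N.Cocycle) (g : P) (a : K) : H →L[ℂ] H := X.val g (Simplex1.degenerate a)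

theorem Cocycle.vert_mem (X : N.Cocycle) (g : P) (a : K) : X.vert g a ∈ N.alg a :=
  X.mem_alg g (Simplex1.degenerate a)

theorem Cocycle.vert_mem_unitary (X : N.Cocycle) (g : P) (a : K) :
    X.vert g a ∈ unitary (H →L[ℂ] H) := X.unitary_mem g _

theorem Cocycle.val_eq_vert_mul (X : N.Cocycle) (g : P) (b : Simplex1 K) :
    X.val g b = X.vert g b.d0 * X.val 1 b := by
  simpa [Simplex1.act_one] using X.cocycle
    ⟨Simplex1.degenerate b.d0, b, b, b.supp, b.d0_le, le_rfl, le_rfl, rfl, rfl, rfl⟩ g 1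

theorem Cocycle.val_eq_mul_vert (X : N.Cocycle) (g : P) (b : Simplex1 K) :
    X.val g b = N.αinv g (X.val 1 (b.act g)) * X.vert g b.d1 := by
  simpa using X.cocycle
    ⟨b, b, Simplex1.degenerate b.d1, b.supp, le_rfl, le_rfl, b.d1_le, rfl, rfl, rfl⟩ 1 g

theorem IsPathField.act {F : N.Field1} (hF : N.IsPathField F) (g : P) :
    N.IsPathField (fun _ b => N.αinv g (F 1 (b.act g))) where
  unitary_mem b := αinv_mem_unitary g (hF.unitary_mem _)
  cocycle c := by
    rw [← αinv_mul]
    congr 1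
    exact hF.cocycle ⟨c.d0.act g, c.d1.act g, c.d2.act g, g • c.supp,
      IsSymmetry.smul_le g c.d0_le, IsSymmetry.smul_le g c.d1_le, IsSymmetry.smul_le g c.d2_le,
      congrArg (g • ·) c.d00, congrArg (g • ·) c.d10, congrArg (g • ·) c.d11⟩

theorem Cocycle.vert_tr (X : N.Cocycle) (g : P) (o a : K) :
    X.vert g o * X.tr o a = N.αinv g (X.tr (g • o) (g • a)) * X.vert g a := by
  rw [Cocycle.tr, Cocycle.tr, ← transport_act X.isPathField (X.isPathField.act g) g (fun _ => rfl)]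
  refine transport_intertwine X.isPathField (X.isPathField.act g) IsIndexSet.connected
    (fun a => X.vert g a) (fun b _ _ _ => ?_) trivial trivial
  rw [← X.val_eq_vert_mul, X.val_eq_mul_vert]

theorem Cocycle.αinv_tr (X : N.Cocycle) (g : P) (o a : K) :
    N.αinv g (X.tr (g • o) (g • a)) = X.vert g o * X.tr o a * star (X.vert g a) := by
  rw [X.vert_tr, mul_assoc, (Unitary.mem_iff.mp (X.vert_mem_unitary g a)).2, mul_one]

theorem Cocycle.tr_commute (X : N.Cocycle) {e o a : K} (ho : perp o e) (ha : perp a e)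
    {B : H →L[ℂ] H} (hB : B ∈ N.alg e) : B * X.tr o a = X.tr o a * B :=
  transport_intertwine X.isPathField X.isPathField (IsIndexSet.compl_connected e) (fun _ => B)
    (fun b _ _ hb => N.causality (IsIndexSet.perp_symm hb) B hB _ (X.mem_alg 1 b)) ho ha

theorem one_mem_global : (1 : H →L[ℂ] H) ∈ N.global := Set.one_mem_centralizer

theorem pathOp_mem_global {F : N.Field1} (h : ∀ b, F 1 b ∈ N.global) (p : List (Simplex1 K)) :
    N.pathOp F p ∈ N.global := by
  induction p with
  | nil => exact one_mem_global
  | cons b p ih => exact mul_mem_global ih (h b)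

theorem transport_mem_global {F : N.Field1} (h : ∀ b, F 1 b ∈ N.global) (o a : K) :
    N.transport F o a ∈ N.global := pathOp_mem_global h _

theorem Cocycle.tr_mem_global (X : N.Cocycle) (o a : K) : X.tr o a ∈ N.global :=
  transport_mem_global (fun b => mem_global (X.mem_alg 1 b)) o a

theorem Cocycle.tr_mem (X : N.Cocycle) {o a s : K} (ho : o ≤ s) (ha : a ≤ s) :
    X.tr o a ∈ N.alg s := by
  have := X.mem_alg 1 ⟨o, a, s, ho, ha⟩
  rwa [← X.isPathField.transport_simplex] at this

theorem Cocycle.tr_simplex (X : N.Cocycle) (b : Simplex1 K) : X.tr b.d0 b.d1 = X.val 1 b :=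
  X.isPathField.transport_simplex b

theorem Cocycle.tr_mul (X : N.Cocycle) (o e a : K) : X.tr o e * X.tr e a = X.tr o a :=
  X.isPathField.transport_mul o e a

theorem Cocycle.tr_mul_assoc (X : N.Cocycle) (o e a : K) (T : H →L[ℂ] H) :
    X.tr o e * (X.tr e a * T) = X.tr o a * T := X.isPathField.transport_mul_assoc o e a T

theorem Cocycle.tr_self (X : N.Cocycle) (a : K) : X.tr a a = 1 := X.isPathField.transport_self a

theorem Cocycle.star_tr (X : N.Cocycle) (o a : K) : star (X.tr o a) = X.tr a o :=
  X.isPathField.star_transport o a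

/-! ### The localized morphisms of a cocycle -/

theorem exists_perp_pair {d e : K} (h : perp d e) : ∃ f : K, perp f d ∧ perp f e := by
  obtain ⟨f, hd, he⟩ := IsIndexSet.compl_inter_of_perp d e h
  exact ⟨f, hd, he⟩

/-- The path defining `ρ(o)_a` may start at any region `e` causally disjoint from `a`: two such
regions are joined by a path in the causal complement of `a`, along which transports commute with
`𝒜(a)`. -/
theorem Cocycle.rho_eq (X : N.Cocycle) (o : K) {a e : K} (he : perp e a) {A : H →L[ℂ] H}
    (hA : A ∈ N.alg a) : N.rho X.val o a A = X.tr o e * A * X.tr e o := by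
  obtain ⟨e', he', hp⟩ := (exists_transport o a).choose_spec
  rw [rho, X.isPathField.pathOp_eq hp, X.isPathField.star_transport]
  change X.tr o e' * A * X.tr e' o = _
  rw [← X.tr_mul o e e', ← X.tr_mul e' e o, mul_assoc, mul_assoc, mul_assoc,
    ← mul_assoc A, X.tr_commute he' he hA, mul_assoc, X.tr_mul_assoc e e' e, X.tr_self, one_mul]

theorem Cocycle.pathOp_star_mul (X : N.Cocycle) (p : List (Simplex1 K)) :
    star (N.pathOp X.val p) * N.pathOp X.val p = 1 :=
  (Unitary.mem_iff.mp (X.isPathField.pathOp_mem_unitary p)).1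

theorem Cocycle.rho_one (X : N.Cocycle) (o a : K) : N.rho X.val o a 1 = 1 := by
  rw [rho, mul_one]
  exact (Unitary.mem_iff.mp (X.isPathField.pathOp_mem_unitary _)).2

theorem Cocycle.rho_mul (X : N.Cocycle) (o a : K) (A B : H →L[ℂ] H) :
    N.rho X.val o a (A * B) = N.rho X.val o a A * N.rho X.val o a B := by
  simp only [rho]
  generalize hW : N.pathOp X.val (exists_transport o a).choose = W
  have h : star W * W = 1 := hW ▸ X.pathOp_star_mul _
  calc W * (A * B) * star W = W * A * 1 * B * star W := by simp only [mul_one, mul_assoc]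
    _ = _ := by rw [← h]; simp only [mul_assoc]

theorem rho_add (X : N.Field1) (o a : K) (A B : H →L[ℂ] H) :
    N.rho X o a (A + B) = N.rho X o a A + N.rho X o a B := by simp [rho, mul_add, add_mul]

theorem rho_smul (X : N.Field1) (o a : K) (c : ℂ) (A : H →L[ℂ] H) :
    N.rho X o a (c • A) = c • N.rho X o a A := by simp [rho]

theorem rho_star (X : N.Field1) (o a : K) (A : H →L[ℂ] H) :
    N.rho X o a (star A) = star (N.rho X o a A) := by simp [rho, mul_assoc]

theorem Cocycle.rho_mem_unitary (X : N.Cocycle) (o a : K) {A : H →L[ℂ] H}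
    (hA : A ∈ unitary (H →L[ℂ] H)) : N.rho X.val o a A ∈ unitary (H →L[ℂ] H) := by
  rw [Unitary.mem_iff] at hA ⊢
  rw [← rho_star, ← X.rho_mul, ← X.rho_mul, hA.1, hA.2, X.rho_one]
  simp

theorem Cocycle.rho_of_le (X : N.Cocycle) (o : K) {a s : K} (h : a ≤ s) {A : H →L[ℂ] H}
    (hA : A ∈ N.alg a) : N.rho X.val o a A = N.rho X.val o s A := by
  obtain ⟨e, he⟩ := exists_perp s
  have he' : perp e a := IsIndexSet.perp_symm (IsIndexSet.perp_of_le (IsIndexSet.perp_symm he) h)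
  rw [X.rho_eq o he' hA, X.rho_eq o he (N.isotony h hA)]

theorem Cocycle.rho_of_perp (X : N.Cocycle) {o a : K} (h : perp o a) {A : H →L[ℂ] H}
    (hA : A ∈ N.alg a) : N.rho X.val o a A = A := by
  rw [X.rho_eq o h hA, X.tr_self, one_mul, mul_one]

theorem Cocycle.rho_mem_global (X : N.Cocycle) (o : K) {a : K} {A : H →L[ℂ] H}
    (hA : A ∈ N.alg a) : N.rho X.val o a A ∈ N.global := by
  obtain ⟨e, he⟩ := exists_perp a
  rw [X.rho_eq o he hA]
  exact mul_mem_global (mul_mem_global (X.tr_mem_global _ _) (mem_global hA)) (X.tr_mem_global _ _)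

theorem Cocycle.rho_commute (X : N.Cocycle) (o : K) {d e : K} (h : perp d e) {A B : H →L[ℂ] H}
    (hA : A ∈ N.alg d) (hB : B ∈ N.alg e) :
    N.rho X.val o d A * N.rho X.val o e B = N.rho X.val o e B * N.rho X.val o d A := by
  obtain ⟨f, hd, he⟩ := exists_perp_pair h
  have hAB := N.causality h A hA B hB
  rw [X.rho_eq o hd hA, X.rho_eq o he hB]
  simp only [mul_assoc, X.tr_mul_assoc f o f, X.tr_self, one_mul]
  rw [← mul_assoc A, hAB, mul_assoc]

theorem Cocycle.rho_commute_of_perp (X : N.Cocycle) {o d e : K} (h : perp d e) (ho : perp o e)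
    {A B : H →L[ℂ] H} (hA : A ∈ N.alg d) (hB : B ∈ N.alg e) :
    B * N.rho X.val o d A = N.rho X.val o d A * B := by
  have := X.rho_commute o h hA hB
  rw [X.rho_of_perp ho hB] at this
  exact this.symm

/-- The morphism `ρ(o)_a` maps `𝒜(a)` into itself if `o ≤ a`; this is where relative Haag duality
enters. -/
theorem Cocycle.rho_mem (X : N.Cocycle) {o a : K} (h : o ≤ a) {A : H →L[ℂ] H}
    (hA : A ∈ N.alg a) : N.rho X.val o a A ∈ N.alg a :=
  mem_alg_of_global (X.rho_mem_global o hA) fun _ he _ hB =>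
    X.rho_commute_of_perp (IsIndexSet.perp_symm he)
      (IsIndexSet.perp_of_le (IsIndexSet.perp_symm he) h) hA hB

theorem Cocycle.tr_rho (X : N.Cocycle) (o' o : K) {a : K} {A : H →L[ℂ] H} (hA : A ∈ N.alg a) :
    X.tr o' o * N.rho X.val o a A = N.rho X.val o' a A * X.tr o' o := by
  obtain ⟨e, he⟩ := exists_perp a
  rw [X.rho_eq o he hA, X.rho_eq o' he hA]
  simp only [mul_assoc, X.tr_mul_assoc, X.tr_mul]

/-- Covariance of the localized morphisms. -/
theorem Cocycle.vert_rho (X : N.Cocycle) (g : P) (o : K) {a : K} {B : H →L[ℂ] H}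
    (hB : B ∈ N.alg (g • a)) :
    X.vert g o * N.rho X.val o a (N.αinv g B) =
      N.αinv g (N.rho X.val (g • o) (g • a) B) * X.vert g o := by
  obtain ⟨e, he⟩ := exists_perp a
  have hV := Unitary.mem_iff.mp (X.vert_mem_unitary g e)
  have hB' : N.αinv g B ∈ N.alg a := αinv_mem g hB
  rw [X.rho_eq o he hB', X.rho_eq (g • o) (IsSymmetry.smul_perp g he) hB, αinv_mul, αinv_mul,
    X.αinv_tr]
  have hc : star (X.vert g e) * N.αinv g B = N.αinv g B * star (X.vert g e) :=
    N.causality he _ (star_mem (X.vert_mem g e)) _ hB'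
  have hc' : star (X.vert g e) * (N.αinv g B * (X.vert g e * X.tr e o)) =
      N.αinv g B * X.tr e o := by
    rw [← mul_assoc, hc, mul_assoc, ← mul_assoc (star _), hV.1, one_mul]
  rw [mul_assoc _ (N.αinv g (X.tr (g • e) (g • o))), ← X.vert_tr]
  simp only [mul_assoc, hc']

theorem homs_tr {X Y : N.Cocycle} {t : N.Field0} (ht : t ∈ N.homs X.val Y.val) (o a : K) :
    t o * X.tr o a = Y.tr o a * t a := by
  refine transport_intertwine X.isPathField Y.isPathField IsIndexSet.connected t
    (fun b _ _ _ => ?_) trivial trivial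
  simpa using ht.2 1 b

theorem homs_rho {X Y : N.Cocycle} {t : N.Field0} (ht : t ∈ N.homs X.val Y.val) (o : K) {a : K}
    {A : H →L[ℂ] H} (hA : A ∈ N.alg a) :
    t o * N.rho X.val o a A = N.rho Y.val o a A * t o := by
  obtain ⟨e, he⟩ := exists_perp a
  have hc := N.causality he (t e) (ht.1 e) A hA
  rw [X.rho_eq o he hA, Y.rho_eq o he hA, mul_assoc, ← mul_assoc, homs_tr ht, mul_assoc,
    ← mul_assoc (t e), hc, mul_assoc A, homs_tr ht]
  simp only [mul_assoc]

/-- A field of local operators is an intertwiner if it intertwines the transports and the values on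
degenerate 1-simplices. -/
theorem mem_homs_of_tr {X Y : N.Cocycle} {t : N.Field0} (hl : ∀ a, t a ∈ N.alg a)
    (htr : ∀ o a, t o * X.tr o a = Y.tr o a * t a)
    (hv : ∀ g a, N.αinv g (t (g • a)) * X.vert g a = Y.vert g a * t a) :
    t ∈ N.homs X.val Y.val := by
  refine ⟨hl, fun g b => ?_⟩
  rw [X.val_eq_vert_mul, Y.val_eq_vert_mul, ← mul_assoc, hv, mul_assoc, ← X.tr_simplex, htr,
    Y.tr_simplex, mul_assoc]

/-! ### The tensor product of covariant 1-cocycles -/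

theorem Cocycle.val_rho (X : N.Cocycle) (g : P) (b : Simplex1 K) {a : K} {B : H →L[ℂ] H}
    (hB : B ∈ N.alg (g • a)) :
    X.val g b * N.rho X.val b.d1 a (N.αinv g B) =
      N.αinv g (N.rho X.val (g • b.d0) (g • a) B) * X.val g b := by
  rw [X.val_eq_vert_mul, mul_assoc, ← X.tr_simplex, X.tr_rho _ _ (αinv_mem g hB), ← mul_assoc,
    X.vert_rho g _ hB, mul_assoc]

/-- The tensor product of covariant 1-cocycles. -/
noncomputable def Cocycle.tensor (X Y : N.Cocycle) : N.Cocycle where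
  val := N.tensorObj X.val Y.val
  unitary_mem g b := mul_mem (X.unitary_mem g b) (X.rho_mem_unitary _ _ (Y.unitary_mem g b))
  mem_alg g b := mul_mem (X.mem_alg g b) (X.rho_mem b.d1_le (Y.mem_alg g b))
  cocycle c s g := by
    have h0 : Y.val s (c.d0.act g) ∈ N.alg (g • c.d0.supp) := Y.mem_alg s (c.d0.act g)
    have h0' := N.isotony (IsSymmetry.smul_le g c.d0_le) h0
    simp only [tensorObj]
    rw [X.rho_of_le _ c.d1_le (Y.mem_alg _ _), c.d11, X.cocycle c s g, Y.cocycle c s g, X.rho_mul,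
      X.rho_of_le _ c.d2_le (Y.mem_alg g c.d2), αinv_mul, mul_assoc, ← mul_assoc (X.val g c.d2),
      X.val_rho g c.d2 h0', ← c.d10]
    change _ = _ * N.αinv g (N.rho X.val (g • c.d0.d1) (g • c.d0.supp) _) * _
    rw [X.rho_of_le _ (IsSymmetry.smul_le g c.d0_le) h0]
    simp only [mul_assoc]

/-- The identity 1-cocycle `I`. -/
def Cocycle.unit : N.Cocycle where
  val := N.unitField
  unitary_mem g b := one_mem _
  mem_alg g b := one_mem _
  cocycle c s g := by simp [unitField]

@[simp] theorem Cocycle.tensor_val (X Y : N.Cocycle) :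
    (X.tensor Y).val = N.tensorObj X.val Y.val := rfl

@[simp] theorem Cocycle.unit_val : (Cocycle.unit : N.Cocycle).val = N.unitField := rfl

/-- The 1-cocycle `b ↦ ρ(x)_{|b|}(Y_b)` with values in `ℬ(H)`: the image of `Y` under the morphisms
of `X` localized at `x`. -/
noncomputable def spread (N : ObservableNet P K H) (X Y : N.Field1) (x : K) : N.Field1 :=
  fun _ b => N.rho X x b.supp (Y 1 b)

theorem spread_isPathField (X Y : N.Cocycle) (x : K) : N.IsPathField (N.spread X.val Y.val x) where
  unitary_mem b := X.rho_mem_unitary _ _ (Y.unitary_mem 1 b)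
  cocycle c := by
    simp only [spread]
    rw [X.rho_of_le x c.d1_le (Y.mem_alg _ _), X.rho_of_le x c.d0_le (Y.mem_alg _ _),
      X.rho_of_le x c.d2_le (Y.mem_alg _ _), ← X.rho_mul, Y.isPathField.cocycle c]

/-- Along paths in the causal complement of `e`, all the morphisms localized at `x` are `ad X(x,
e)`. -/
theorem transport_spread (X Y : N.Cocycle) (x : K) {e o a : K} (ho : perp o e) (ha : perp a e) :
    N.transport (N.spread X.val Y.val x) o a = X.tr x e * Y.tr o a * X.tr e x := by
  have := transport_intertwine (spread_isPathField X Y x) Y.isPathField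
    (IsIndexSet.compl_connected e) (fun _ => X.tr e x) (fun b _ _ hb => by
      rw [spread, X.rho_eq x (IsIndexSet.perp_symm hb) (Y.mem_alg 1 b)]
      simp only [← mul_assoc, X.tr_mul, X.tr_self, one_mul]) ho ha
  rw [mul_assoc, ← this, X.tr_mul_assoc, X.tr_self, one_mul]

theorem transport_spread_mem_global (X Y : N.Cocycle) (x o a : K) :
    N.transport (N.spread X.val Y.val x) o a ∈ N.global :=
  transport_mem_global (fun b => X.rho_mem_global x (Y.mem_alg 1 b)) o a

theorem tr_transport_spread (X Y : N.Cocycle) (x y o a : K) :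
    X.tr y x * N.transport (N.spread X.val Y.val x) o a =
      N.transport (N.spread X.val Y.val y) o a * X.tr y x :=
  transport_intertwine (spread_isPathField X Y x) (spread_isPathField X Y y) IsIndexSet.connected
    (fun _ => X.tr y x) (fun b _ _ _ => X.tr_rho y x (Y.mem_alg 1 b)) trivial trivial

theorem tr_tensor_tr (X Y : N.Cocycle) (x o a : K) :
    X.tr x o * (X.tensor Y).tr o a = N.transport (N.spread X.val Y.val x) o a * X.tr x a := by
  refine transport_intertwine (X.tensor Y).isPathField (spread_isPathField X Y x)
    IsIndexSet.connected (fun a => X.tr x a) (fun b _ _ _ => ?_) trivial trivial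
  change X.tr x b.d0 * (X.val 1 b * N.rho X.val b.d1 b.supp (Y.val 1 b)) = _
  rw [← X.tr_simplex, X.tr_mul_assoc, X.tr_rho _ _ (Y.mem_alg 1 b), spread]

theorem tensor_tr (X Y : N.Cocycle) (o a : K) :
    (X.tensor Y).tr o a = N.transport (N.spread X.val Y.val o) o a * X.tr o a := by
  have := tr_tensor_tr X Y o o a
  rwa [X.tr_self, one_mul] at this

theorem tensor_tr_of_perp (X Y : N.Cocycle) {e o a : K} (ho : perp o e) (ha : perp a e) :
    (X.tensor Y).tr o a = X.tr o e * Y.tr o a * X.tr e a := by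
  rw [tensor_tr, transport_spread X Y o ho ha, mul_assoc, X.tr_mul]

theorem rho_tensor_of_le_of_perp (X Y : N.Cocycle) {o d e : K} (h : o ≤ d) (he : perp e d)
    {A : H →L[ℂ] H} (hA : A ∈ N.alg d) :
    N.rho (X.tensor Y).val o d A = X.tr o e * N.rho Y.val o d A * X.tr e o := by
  obtain ⟨f, hfe, hfd⟩ := exists_perp_pair he
  have hoe : perp o e := IsIndexSet.perp_of_le (IsIndexSet.perp_symm he) h
  rw [(X.tensor Y).rho_eq o hfd hA, Y.rho_eq o hfd hA, tensor_tr_of_perp X Y hoe hfe,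
    tensor_tr_of_perp X Y hfe hoe]
  have hc := X.tr_commute hfd he hA
  simp only [mul_assoc]
  rw [← mul_assoc A, hc]
  simp only [mul_assoc, X.tr_mul_assoc e f e, X.tr_self, one_mul]

/-- On `𝒜(d)`, the morphism of `X ⊗ Y` localized at a region `o` which need not be contained in `d`
is the morphism of `Y` followed by `ad X(o, e)`, provided that `e` is causally disjoint from both
`o` and `d`. -/
theorem rho_tensor_of_perp (X Y : N.Cocycle) {o d e : K} (ho : perp e o) (he : perp e d)
    {A : H →L[ℂ] H} (hA : A ∈ N.alg d) :
    N.rho (X.tensor Y).val o d A = X.tr o e * N.rho Y.val o d A * X.tr e o := by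
  have h1 := (X.tensor Y).tr_rho o d hA
  have h2 := Y.tr_rho o d hA
  have hu := (X.tensor Y).tr_mul o d o
  rw [(X.tensor Y).tr_self] at hu
  have hu' := Y.tr_mul o d o
  rw [Y.tr_self] at hu'
  calc N.rho (X.tensor Y).val o d A
      = (X.tensor Y).tr o d * N.rho (X.tensor Y).val d d A * (X.tensor Y).tr d o := by
        rw [h1, mul_assoc, hu, mul_one]
    _ = X.tr o e * (Y.tr o d * N.rho Y.val d d A * Y.tr d o) * X.tr e o := by
        rw [rho_tensor_of_le_of_perp X Y le_rfl he hA,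
          tensor_tr_of_perp X Y (IsIndexSet.perp_symm ho) (IsIndexSet.perp_symm he),
          tensor_tr_of_perp X Y (IsIndexSet.perp_symm he) (IsIndexSet.perp_symm ho)]
        simp only [mul_assoc, X.tr_mul_assoc e d e, X.tr_self, one_mul]
    _ = _ := by rw [h2, mul_assoc (N.rho Y.val o d A), hu', mul_one]

theorem rho_tensor (X Y : N.Cocycle) {o d : K} (h : o ≤ d) {A : H →L[ℂ] H} (hA : A ∈ N.alg d) :
    N.rho (X.tensor Y).val o d A = N.rho X.val o d (N.rho Y.val o d A) := by
  obtain ⟨e, he⟩ := exists_perp d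
  rw [rho_tensor_of_le_of_perp X Y h he hA, X.rho_eq o he (Y.rho_mem h hA)]

theorem rho_unit (o a : K) (A : H →L[ℂ] H) : N.rho N.unitField o a A = A := by
  have h : ∀ p, N.pathOp N.unitField p = 1 := fun p => by
    induction p with
    | nil => rfl
    | cons b p ih => rw [pathOp, ih, unitField, one_mul]
  simp [rho, h]

theorem tensor_assoc (X Y Z : N.Cocycle) :
    (X.tensor Y).tensor Z = X.tensor (Y.tensor Z) := by
  ext1
  funext g b
  change X.val g b * N.rho X.val b.d1 b.supp (Y.val g b) *
    N.rho (X.tensor Y).val b.d1 b.supp (Z.val g b) = X.val g b * N.rho X.val b.d1 b.supp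
      (Y.val g b * N.rho Y.val b.d1 b.supp (Z.val g b))
  rw [rho_tensor X Y b.d1_le (Z.mem_alg g b), X.rho_mul, mul_assoc]

theorem unit_tensor (X : N.Cocycle) : Cocycle.unit.tensor X = X := by
  ext1
  funext g b
  simp [tensorObj, rho_unit, unitField]

theorem tensor_unit (X : N.Cocycle) : X.tensor Cocycle.unit = X := by
  ext1
  funext g b
  simp [tensorObj, unitField, X.rho_one]

/-- The endomorphism `t ↦ 1_X ⊗ t` of the algebra of fields of operators, `(1_X ⊗ t)_a =
ρ(a)_a(t_a)`. It is defined on all fields, but is independent of the choices entering `rho` only on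
the fields of local operators. -/
noncomputable def Cocycle.amp (X : N.Cocycle) :
    (K → H →L[ℂ] H) →⋆ₐ[ℂ] (K → H →L[ℂ] H) where
  toFun t a := N.rho X.val a a (t a)
  map_one' := funext fun a => X.rho_one a a
  map_mul' s t := funext fun a => X.rho_mul a a _ _
  map_zero' := funext fun a => by simp [rho]
  map_add' s t := funext fun a => rho_add _ _ _ _ _
  commutes' c := funext fun a => by
    simp only [Algebra.algebraMap_eq_smul_one, Pi.smul_apply, Pi.one_apply, rho_smul, X.rho_one]
  map_star' t := funext fun a => rho_star _ _ _ _

theorem Cocycle.amp_apply (X : N.Cocycle) (t : N.Field0) (a : K) :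
    X.amp t a = N.rho X.val a a (t a) := rfl

theorem tensorHom_eq (X : N.Cocycle) (t s : N.Field0) :
    N.tensorHom X.val t s = t * X.amp s := rfl

variable (N) in
/-- The algebra of fields of local operators. -/
def localFields : StarSubalgebra ℂ (K → H →L[ℂ] H) where
  carrier := {t | ∀ a, t a ∈ N.alg a}
  mul_mem' hs ht a := mul_mem (hs a) (ht a)
  one_mem' a := one_mem _
  add_mem' hs ht a := add_mem (hs a) (ht a)
  zero_mem' a := zero_mem _
  algebraMap_mem' c a := (N.alg a).toStarSubalgebra.algebraMap_mem c
  star_mem' ht a := star_mem (ht a)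

theorem homs_le_localFields {X Y : N.Field1} {t : N.Field0} (ht : t ∈ N.homs X Y) :
    t ∈ N.localFields := ht.1

theorem Cocycle.amp_mem_localFields (X : N.Cocycle) {t : N.Field0} (ht : t ∈ N.localFields) :
    X.amp t ∈ N.localFields := fun a => X.rho_mem le_rfl (ht a)

theorem amp_tensor (X Y : N.Cocycle) {t : N.Field0} (ht : t ∈ N.localFields) :
    (X.tensor Y).amp t = X.amp (Y.amp t) :=
  funext fun a => rho_tensor X Y le_rfl (ht a)

theorem amp_unit (t : N.Field0) : (Cocycle.unit : N.Cocycle).amp t = t :=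
  funext fun a => rho_unit a a _

theorem star_mem_homs {X Y : N.Cocycle} {t : N.Field0} (ht : t ∈ N.homs X.val Y.val) :
    star t ∈ N.homs Y.val X.val := by
  refine ⟨fun a => star_mem (ht.1 a), fun g b => ?_⟩
  have hX := Unitary.mem_iff.mp (X.unitary_mem g b)
  have hY := Unitary.mem_iff.mp (Y.unitary_mem g b)
  have h := congrArg star (ht.2 g b)
  rw [star_mul, star_mul, ← αinv_star] at h
  change N.αinv g (star (t (g • b.d0))) * Y.val g b = X.val g b * star (t b.d1)
  calc _ = X.val g b * (star (X.val g b) * N.αinv g (star (t (g • b.d0)))) * Y.val g b := by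
        rw [← mul_assoc, hX.2, one_mul]
    _ = X.val g b * star (t b.d1) * (star (Y.val g b) * Y.val g b) := by
        rw [h]; simp only [mul_assoc]
    _ = _ := by rw [hY.1, mul_one]

/-- `t ⊗ 1_Z` is an intertwiner; its components are those of `t`. -/
theorem homs_tensor_right {X X' : N.Cocycle} {t : N.Field0} (ht : t ∈ N.homs X.val X'.val)
    (Z : N.Cocycle) : t ∈ N.homs (X.tensor Z).val (X'.tensor Z).val := by
  refine ⟨ht.1, fun g b => ?_⟩
  change _ * (X.val g b * N.rho X.val b.d1 b.supp (Z.val g b)) =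
    X'.val g b * N.rho X'.val b.d1 b.supp (Z.val g b) * _
  rw [← mul_assoc, ht.2, mul_assoc, homs_rho ht _ (Z.mem_alg g b), mul_assoc]

theorem amp_mem_homs (X : N.Cocycle) {Y Y' : N.Cocycle} {t : N.Field0}
    (ht : t ∈ N.homs Y.val Y'.val) : X.amp t ∈ N.homs (X.tensor Y).val (X.tensor Y').val := by
  refine ⟨X.amp_mem_localFields ht.1, fun g b => ?_⟩
  have h0 : t (g • b.d0) ∈ N.alg (g • b.supp) := N.isotony (IsSymmetry.smul_le g b.d0_le) (ht.1 _)
  change N.αinv g (N.rho X.val (g • b.d0) (g • b.d0) (t (g • b.d0))) *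
    (X.val g b * N.rho X.val b.d1 b.supp (Y.val g b)) =
    X.val g b * N.rho X.val b.d1 b.supp (Y'.val g b) * N.rho X.val b.d1 b.d1 (t b.d1)
  rw [X.rho_of_le _ (IsSymmetry.smul_le g b.d0_le) (ht.1 _), ← mul_assoc, ← X.val_rho g b h0,
    mul_assoc, ← X.rho_mul, ht.2, X.rho_mul, X.rho_of_le _ b.d1_le (ht.1 b.d1), mul_assoc]

theorem homs_amp_comm {X X' : N.Cocycle} {t s : N.Field0} (ht : t ∈ N.homs X.val X'.val)
    (hs : s ∈ N.localFields) : t * X.amp s = X'.amp s * t :=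
  funext fun a => homs_rho ht a (hs a)

theorem tensorHom_mem_homs {X X' Y Y' : N.Cocycle} {t s : N.Field0}
    (ht : t ∈ N.homs X.val X'.val) (hs : s ∈ N.homs Y.val Y'.val) :
    N.tensorHom X.val t s ∈ N.homs (X.tensor Y).val (X'.tensor Y').val :=
  N.mul_mem_homs (homs_tensor_right ht Y') (amp_mem_homs X hs)

/-! ### The permutation symmetry -/

variable (N) in
/-- The value of `(X × Y)_{p,q}` on any two paths `p`, `q` of equal length, from `a` to `x` and
from `a` to `x'`. -/
noncomputable def crossTransport (X Y : N.Field1) (x x' a : K) : H →L[ℂ] H :=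
  N.transport (N.spread X Y x) x' a * N.transport X x a

/-- The operator `(X × Y)_{p,q}` depends only on the endpoints of `p` and `q`. -/
theorem cross_eq (X Y : N.Cocycle) {p q : List (Simplex1 K)} {a a' x x' : K}
    (hp : IsPath p a x) (hq : IsPath q a' x') (hlen : p.length = q.length) :
    N.cross X.val Y.val p q = N.transport (N.spread X.val Y.val x) x' a' * X.tr x a := by
  have step : ∀ b d : Simplex1 K, X.tr x b.d0 * (X.val 1 b * N.rho X.val b.d1 d.supp (Y.val 1 d)) =
      N.transport (N.spread X.val Y.val x) d.d0 d.d1 * X.tr x b.d1 := fun b d => by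
    rw [← X.tr_simplex, X.tr_mul_assoc, X.tr_rho _ _ (Y.mem_alg 1 d),
      (spread_isPathField X Y x).transport_simplex, spread]
  induction p generalizing q a a' with
  | nil => exact hp.elim
  | cons b p ih =>
    cases q with
    | nil => exact hq.elim
    | cons d q =>
      cases p with
      | nil =>
        cases q with
        | nil =>
          obtain ⟨rfl, rfl⟩ := hp
          obtain ⟨rfl, rfl⟩ := hq
          have := step b d
          rw [X.tr_self, one_mul] at this
          simpa [cross] using this
        | cons d' q => simp at hlen
      | cons b' p =>
        cases q with
        | nil => simp at hlen
        | cons d' q =>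
          rw [cross, ih hp.2 hq.2 (by simpa using hlen), mul_assoc, step, ← mul_assoc,
            (spread_isPathField X Y x).transport_mul, hp.1, hq.1]

theorem crossTransport_mem_unitary (X Y : N.Cocycle) (x x' a : K) :
    N.crossTransport X.val Y.val x x' a ∈ unitary (H →L[ℂ] H) :=
  mul_mem ((spread_isPathField X Y x).transport_mem_unitary _ _)
    (X.isPathField.transport_mem_unitary _ _)

theorem crossTransport_move_left (X Y : N.Cocycle) (x y x' a : K) :
    N.crossTransport X.val Y.val y x' a = X.tr y x * N.crossTransport X.val Y.val x x' a := by
  rw [crossTransport, crossTransport, ← mul_assoc, tr_transport_spread, mul_assoc,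
    X.isPathField.transport_mul]

theorem crossTransport_move_right (X Y : N.Cocycle) (x x' y' a : K) (hx : perp x' x)
    (hy : perp y' x) :
    N.crossTransport X.val Y.val x y' a = Y.tr y' x' * N.crossTransport X.val Y.val x x' a := by
  rw [crossTransport, ← (spread_isPathField X Y x).transport_mul y' x' a,
    transport_spread X Y x hy hx, X.tr_self, one_mul, mul_one, mul_assoc]
  rfl

/-- The value of the permutation symmetry at `a`, computed from two paths from `a` to `x` and
from `a` to `x'`. -/
noncomputable def exchange (X Y : N.Cocycle) (x x' a : K) : H →L[ℂ] H :=
  star (N.crossTransport Y.val X.val x' x a) * N.crossTransport X.val Y.val x x' a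

theorem star_exchange (X Y : N.Cocycle) (x x' a : K) :
    star (exchange X Y x x' a) = exchange Y X x' x a := by
  simp [exchange]

theorem exchange_move_right (X Y : N.Cocycle) {x x' y' : K} (a : K) (hx : perp x' x)
    (hy : perp y' x) : exchange X Y x y' a = exchange X Y x x' a := by
  have hu := (Unitary.mem_iff.mp (Y.isPathField.transport_mem_unitary y' x')).1
  rw [exchange, exchange, crossTransport_move_right X Y x x' y' a hx hy,
    crossTransport_move_left Y X x' y' x a, star_mul, mul_assoc, ← mul_assoc (star (Y.tr _ _)),
    hu, one_mul]

theorem exchange_move_left (X Y : N.Cocycle) {x y x' : K} (a : K) (hx : perp x x')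
    (hy : perp y x') : exchange X Y y x' a = exchange X Y x x' a := by
  rw [← star_exchange, exchange_move_right Y X a hx hy, star_exchange]

/-- Any two pairs of causally disjoint regions can be joined by moving one region of the pair at a
time, so the exchange operator does not depend on the pair. -/
theorem exchange_eq (X Y : N.Cocycle) {x x' y y' : K} (a : K) (hx : perp x x') (hy : perp y y') :
    exchange X Y x x' a = exchange X Y y y' a := by
  have symm {o a : K} (h : perp o a) : perp a o := IsIndexSet.perp_symm h
  have key : ∀ z, perp z x → perp z y → exchange X Y x x' a = exchange X Y y y' a := by
    intro z hzx hzy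
    rw [exchange_move_right X Y a hzx (symm hx), exchange_move_left X Y a (symm hzy) (symm hzx),
      exchange_move_right X Y a (symm hy) hzy]
  by_cases h : perp x y
  · obtain ⟨z, hz, hz'⟩ := exists_perp_pair h
    exact key z hz hz'
  · obtain ⟨x₁, hx₁, z, hz, hz'⟩ := IsIndexSet.compl_inter_of_not_perp x y h
    have hx₁' : perp x₁ x' := IsIndexSet.perp_of_le hx (IsIndexSet.lt_of_ssub hx₁).le
    rw [exchange_move_left X Y a hx₁' hx, exchange_move_right X Y a hz (symm hx₁'),
      exchange_move_left X Y a (symm hz') (symm hz), exchange_move_right X Y a (symm hy) hz']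

/-- The permutation symmetry may be computed from any pair of causally disjoint regions. -/
theorem eps_apply (X Y : N.Cocycle) {x x' : K} (a : K) (hx : perp x x') :
    N.eps X.val Y.val a = exchange X Y x x' a := by
  obtain ⟨hlen, o, o', hp, hq, ho⟩ := (exists_exchange a).choose_spec
  rw [← exchange_eq X Y a ho hx, eps, cross_eq X Y hp hq hlen, cross_eq Y X hq hp hlen.symm]
  rfl

theorem star_eps (X Y : N.Cocycle) : star (N.eps X.val Y.val) = N.eps Y.val X.val := by
  funext a
  obtain ⟨e, he⟩ := exists_perp a
  rw [Pi.star_apply, eps_apply X Y a he, eps_apply Y X a (IsIndexSet.perp_symm he), star_exchange]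

theorem eps_mul_eps (X Y : N.Cocycle) : N.eps Y.val X.val * N.eps X.val Y.val = 1 := by
  rw [← star_eps]
  funext a
  obtain ⟨e, he⟩ := exists_perp a
  have : exchange X Y e a a ∈ unitary (H →L[ℂ] H) :=
    mul_mem (Unitary.star_mem (crossTransport_mem_unitary Y X _ _ _))
      (crossTransport_mem_unitary X Y _ _ _)
  rw [Pi.mul_apply, Pi.star_apply, eps_apply X Y a he, (Unitary.mem_iff.mp this).1, Pi.one_apply]

theorem eps_apply_left (X Y : N.Cocycle) {f a : K} (h : perp f a) :
    N.eps X.val Y.val a = Y.tr a f * N.transport (N.spread X.val Y.val a) f a := by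
  rw [eps_apply X Y a (IsIndexSet.perp_symm h), exchange, crossTransport, crossTransport,
    (spread_isPathField Y X f).transport_self, one_mul, X.isPathField.transport_self, mul_one,
    Y.isPathField.star_transport]

theorem eps_apply_right (X Y : N.Cocycle) {o a : K} (h : perp o a) :
    N.eps X.val Y.val a = star (N.transport (N.spread Y.val X.val a) o a) * X.tr o a := by
  rw [eps_apply X Y a h, exchange, crossTransport, crossTransport,
    (spread_isPathField X Y o).transport_self, one_mul, Y.isPathField.transport_self, mul_one]

theorem eps_mem_localFields (X Y : N.Cocycle) : N.eps X.val Y.val ∈ N.localFields := by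
  intro a
  apply mem_alg_of_global
  · obtain ⟨f, hf⟩ := exists_perp a
    rw [eps_apply_left X Y hf]
    exact mul_mem_global (Y.tr_mem_global _ _) (transport_spread_mem_global X Y _ _ _)
  · intro e he B hB
    obtain ⟨f, hfe, hfa⟩ := exists_perp_pair he
    have hae : perp a e := IsIndexSet.perp_symm he
    have hT : B * N.transport (N.spread X.val Y.val a) f a =
        N.transport (N.spread X.val Y.val a) f a * B :=
      transport_intertwine (spread_isPathField X Y a) (spread_isPathField X Y a)
        (IsIndexSet.compl_connected e) (fun _ => B)
        (fun b _ _ hb => X.rho_commute_of_perp hb hae (Y.mem_alg 1 b) hB) hfe hae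
    rw [eps_apply_left X Y hfa, ← mul_assoc, Y.tr_commute hae hfe hB, mul_assoc, hT, mul_assoc]

theorem crossTransport_tensor (X Y : N.Cocycle) (x x' o a : K) :
    N.crossTransport X.val Y.val x x' o * (X.tensor Y).tr o a =
      N.crossTransport X.val Y.val x x' a := by
  rw [crossTransport, mul_assoc, tr_tensor_tr, ← mul_assoc,
    (spread_isPathField X Y x).transport_mul]
  rfl

theorem crossTransport_vert (X Y : N.Cocycle) (g : P) {x x' : K} (h : perp x x') (a : K) :
    N.αinv g (N.crossTransport X.val Y.val (g • x) (g • x') (g • a)) * (X.tensor Y).vert g a =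
      X.vert g x * Y.vert g x' * N.crossTransport X.val Y.val x x' a := by
  have hS := spread_isPathField X Y x
  have hS' := spread_isPathField X Y (g • x)
  have key := transport_intertwine hS (hS'.act g) IsIndexSet.connected
    (fun a => X.vert g x * N.rho X.val x a (Y.vert g a)) (fun b _ _ _ => by
      have hb : Y.val 1 (b.act g) ∈ N.alg (g • b.supp) := Y.mem_alg 1 (b.act g)
      simp only [spread]
      change _ = N.αinv g (N.rho X.val (g • x) (g • b.supp) _) * _
      rw [← mul_assoc, ← X.vert_rho g x hb, X.rho_of_le x b.d0_le (Y.vert_mem g _),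
        X.rho_of_le x b.d1_le (Y.vert_mem g _), mul_assoc, mul_assoc, ← X.rho_mul, ← X.rho_mul,
        ← Y.val_eq_vert_mul, Y.val_eq_mul_vert]) (Set.mem_univ x') (Set.mem_univ a)
  rw [transport_act hS' (hS'.act g) g (fun _ => rfl), X.rho_of_perp h (Y.vert_mem g x')] at key
  rw [crossTransport, αinv_mul, crossTransport, ← mul_assoc (_ * _), key]
  change _ * (X.vert g a * N.rho X.val a a (Y.vert g a)) = _
  rw [mul_assoc, ← mul_assoc (N.αinv g (N.transport X.val _ _)), ← X.vert_tr,
    mul_assoc (X.vert g x), X.tr_rho _ _ (Y.vert_mem g a)]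
  simp only [mul_assoc]

theorem crossTransport_natural {X X' Y Y' : N.Cocycle} {t s : N.Field0}
    (ht : t ∈ N.homs X.val X'.val) (hs : s ∈ N.homs Y.val Y'.val) {x x' : K} (h : perp x x')
    (a : K) :
    N.crossTransport X'.val Y'.val x x' a * (t a * N.rho X.val a a (s a)) =
      t x * s x' * N.crossTransport X.val Y.val x x' a := by
  have key := transport_intertwine (spread_isPathField X Y x) (spread_isPathField X' Y' x)
    IsIndexSet.connected (fun a => t x * N.rho X.val x a (s a)) (fun b _ _ _ => by
      have hb : s b.d0 * Y.val 1 b = Y'.val 1 b * s b.d1 := by simpa using hs.2 1 b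
      simp only [spread]
      rw [← mul_assoc (N.rho X'.val _ _ _), ← homs_rho ht x (Y'.mem_alg 1 b),
        X.rho_of_le x b.d0_le (hs.1 _), X.rho_of_le x b.d1_le (hs.1 _), mul_assoc, mul_assoc,
        ← X.rho_mul, ← X.rho_mul, hb]) (Set.mem_univ x') (Set.mem_univ a)
  rw [X.rho_of_perp h (hs.1 x')] at key
  have h1 : X'.tr x a * (t a * N.rho X.val a a (s a)) =
      t x * N.rho X.val x a (s a) * X.tr x a := by
    rw [← mul_assoc, ← homs_tr ht, mul_assoc, X.tr_rho _ _ (hs.1 a), mul_assoc]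
  rw [crossTransport, crossTransport, ← mul_assoc (t x * s x'), key, mul_assoc, mul_assoc]
  exact congrArg _ h1

theorem eps_mem_homs (X Y : N.Cocycle) :
    N.eps X.val Y.val ∈ N.homs (X.tensor Y).val (Y.tensor X).val := by
  refine mem_homs_of_tr (eps_mem_localFields X Y) (fun o a => ?_) (fun g a => ?_)
  · obtain ⟨x, hx⟩ := exists_perp a
    have hu := (Unitary.mem_iff.mp ((Y.tensor X).isPathField.transport_mem_unitary o a)).2
    rw [eps_apply X Y o hx, eps_apply X Y a hx, exchange, exchange, mul_assoc,
      crossTransport_tensor, ← crossTransport_tensor Y X _ _ o a, star_mul, ← mul_assoc,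
      ← mul_assoc, hu, one_mul]
  · obtain ⟨x, hx⟩ := exists_perp a
    have hg := IsSymmetry.smul_perp g hx
    have h1 := crossTransport_vert X Y g hx a
    have h2 := congrArg star (crossTransport_vert Y X g (IsIndexSet.perp_symm hx) a)
    have hV := N.causality hx _ (X.vert_mem g x) _ (Y.vert_mem g a)
    have hu := (Unitary.mem_iff.mp ((Y.tensor X).vert_mem_unitary g a)).2
    have hw := (Unitary.mem_iff.mp (mul_mem (X.vert_mem_unitary g x) (Y.vert_mem_unitary g a))).1
    rw [star_mul, star_mul, ← αinv_star, ← hV] at h2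
    rw [eps_apply X Y _ hg, eps_apply X Y a hx, exchange, exchange, αinv_mul, mul_assoc, h1]
    calc _ = (Y.tensor X).vert g a * (star ((Y.tensor X).vert g a) *
          N.αinv g (star (N.crossTransport Y.val X.val (g • a) (g • x) (g • a)))) *
          (X.vert g x * Y.vert g a * N.crossTransport X.val Y.val x a a) := by
          rw [← mul_assoc _ (star _), hu, one_mul]
      _ = (Y.tensor X).vert g a * star (N.crossTransport Y.val X.val a x a) *
          (star (X.vert g x * Y.vert g a) * (X.vert g x * Y.vert g a)) *
          N.crossTransport X.val Y.val x a a := by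
          rw [h2]; simp only [mul_assoc]
      _ = _ := by rw [hw, mul_one, mul_assoc]

theorem eps_natural {X X' Y Y' : N.Cocycle} {t s : N.Field0}
    (ht : t ∈ N.homs X.val X'.val) (hs : s ∈ N.homs Y.val Y'.val) :
    N.eps X'.val Y'.val * (t * X.amp s) = s * Y.amp t * N.eps X.val Y.val := by
  funext a
  obtain ⟨x, hx⟩ := exists_perp a
  have h1 := crossTransport_natural ht hs hx a
  have h2 := congrArg star (crossTransport_natural (star_mem_homs hs) (star_mem_homs ht)
    (IsIndexSet.perp_symm hx) a)
  have h3 : s a * N.rho Y.val a a (t a) = N.rho Y'.val a a (t a) * s a := homs_rho hs a (ht.1 a)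
  simp only [star_mul, Pi.star_apply, star_star, rho_star] at h2
  have h4 := congrArg (· * N.crossTransport X.val Y.val x a a) h2
  simp only [Pi.mul_apply, Cocycle.amp_apply]
  rw [eps_apply X Y a hx, eps_apply X' Y' a hx, exchange, exchange, mul_assoc, h1, h3]
  simp only [mul_assoc] at h4 ⊢
  rw [h4]

/-- The hexagon identity. -/
theorem eps_tensor_right (X Y Z : N.Cocycle) :
    N.eps X.val (Y.tensor Z).val = Y.amp (N.eps X.val Z.val) * N.eps X.val Y.val := by
  funext a
  obtain ⟨o, ho⟩ := exists_perp a
  obtain ⟨e, heo, hea⟩ := exists_perp_pair ho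
  have hoe := IsIndexSet.perp_symm heo
  have hae := IsIndexSet.perp_symm hea
  have key := transport_intertwine (spread_isPathField (Y.tensor Z) X a)
    (spread_isPathField Z X a) (IsIndexSet.compl_connected e) (fun _ => Y.tr e a)
    (fun b _ _ hb => by
      simp only [spread]
      rw [rho_tensor_of_perp Y Z hea (IsIndexSet.perp_symm hb) (X.mem_alg 1 b)]
      simp only [← mul_assoc, Y.tr_mul, Y.tr_self, one_mul]) hoe hae
  have key' : star (N.transport (N.spread (Y.tensor Z).val X.val a) o a) =
      Y.tr a e * star (N.transport (N.spread Z.val X.val a) o a) * Y.tr e a := by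
    have := congrArg star key
    rw [star_mul, star_mul, Y.star_tr] at this
    rw [← this, mul_assoc, Y.tr_mul, Y.tr_self, mul_one]
  rw [Pi.mul_apply, Cocycle.amp_apply, Y.rho_eq a hea (eps_mem_localFields X Z a),
    eps_apply_right X (Y.tensor Z) ho, eps_apply_right X Z ho, eps_apply_right X Y ho, key',
    transport_spread Y X a hoe hae]
  simp only [star_mul, Y.star_tr, X.star_tr, mul_assoc, Y.tr_mul_assoc e a e, Y.tr_self, one_mul]
  rw [← mul_assoc (X.tr o a), X.tr_mul, X.tr_self, one_mul]

theorem eps_tensor_left (X Y Z : N.Cocycle) :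
    N.eps (X.tensor Y).val Z.val = N.eps X.val Z.val * X.amp (N.eps Y.val Z.val) := by
  rw [← star_eps Z (X.tensor Y), eps_tensor_right, star_mul, ← map_star, star_eps, star_eps]

theorem eps_unit_right (X : N.Cocycle) : N.eps X.val N.unitField = 1 := by
  have h := eps_tensor_right X Cocycle.unit Cocycle.unit
  rw [unit_tensor, amp_unit, Cocycle.unit_val] at h
  have hu := eps_mul_eps X Cocycle.unit
  rw [Cocycle.unit_val] at hu
  calc N.eps X.val N.unitField = N.eps N.unitField X.val *
        (N.eps X.val N.unitField * N.eps X.val N.unitField) := by rw [← mul_assoc, hu, one_mul]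
    _ = 1 := by rw [← h, hu]

/-! ### Spaces of intertwiners -/

/-- The only candidate for an intertwiner `X → Y` with component `T` at `a₀`. -/
noncomputable def extend (X Y : N.Cocycle) (a₀ : K) (T : H →L[ℂ] H) : N.Field0 :=
  fun a => Y.tr a a₀ * T * X.tr a₀ a

theorem extend_self (X Y : N.Cocycle) (a₀ : K) (T : H →L[ℂ] H) : extend X Y a₀ T a₀ = T := by
  simp [extend, X.isPathField.transport_self, Y.isPathField.transport_self]

theorem homs_eq_extend {X Y : N.Cocycle} {t : N.Field0} (ht : t ∈ N.homs X.val Y.val) (a₀ : K) :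
    t = extend X Y a₀ (t a₀) := by
  funext a
  rw [extend, ← homs_tr ht, mul_assoc, X.tr_mul, X.tr_self, mul_one]

/-- An intertwiner is determined by any of its components. -/
theorem homs_ext {X Y : N.Cocycle} {t s : N.Field0} (ht : t ∈ N.homs X.val Y.val)
    (hs : s ∈ N.homs X.val Y.val) (a₀ : K) (h : t a₀ = s a₀) : t = s := by
  rw [homs_eq_extend ht a₀, homs_eq_extend hs a₀, h]

theorem norm_homs {X Y : N.Cocycle} {t : N.Field0} (ht : t ∈ N.homs X.val Y.val) (a o : K) :
    ‖t a‖ = ‖t o‖ := by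
  rw [homs_eq_extend ht o, extend_self, extend,
    CStarRing.norm_mul_mem_unitary _ (X.isPathField.transport_mem_unitary _ _),
    CStarRing.norm_mem_unitary_mul _ (Y.isPathField.transport_mem_unitary _ _)]

theorem isClosed_alg (o : K) : IsClosed (N.alg o : Set (H →L[ℂ] H)) := by
  rw [← VonNeumannAlgebra.centralizer_centralizer]
  exact Set.isClosed_centralizer _

theorem isClosed_setOf_extend_mem (X Y : N.Cocycle) (a₀ : K) :
    IsClosed {T : H →L[ℂ] H | extend X Y a₀ T ∈ N.homs X.val Y.val} := by
  have hc : ∀ a, Continuous fun T : H →L[ℂ] H => extend X Y a₀ T a := fun a => by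
    unfold extend; fun_prop
  have : {T : H →L[ℂ] H | extend X Y a₀ T ∈ N.homs X.val Y.val} =
      (⋂ a, {T | extend X Y a₀ T a ∈ N.alg a}) ∩ ⋂ (g : P) (b : Simplex1 K),
        {T | N.αinv g (extend X Y a₀ T (g • b.d0)) * X.val g b =
          Y.val g b * extend X Y a₀ T b.d1} := by
    ext T
    simp only [Set.mem_inter_iff, Set.mem_iInter, Set.mem_ofPred_eq]
    rfl
  rw [this]
  refine (isClosed_iInter fun a => (isClosed_alg a).preimage (hc a)).inter
    (isClosed_iInter fun g => isClosed_iInter fun b => isClosed_eq ?_ ?_)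
  · have := hc (g • b.d0)
    unfold αinv
    fun_prop
  · have := hc b.d1
    fun_prop

/-- The components at `a₀` of the intertwiners `X → X` form a C*-algebra of operators. -/
noncomputable def endAlg (X : N.Cocycle) (a₀ : K) : StarSubalgebra ℂ (H →L[ℂ] H) where
  carrier := {T | ∃ t ∈ N.homs X.val X.val, t a₀ = T}
  mul_mem' := by
    rintro _ _ ⟨s, hs, rfl⟩ ⟨t, ht, rfl⟩
    exact ⟨s * t, N.mul_mem_homs hs ht, rfl⟩
  one_mem' := ⟨1, N.one_mem_homs _, rfl⟩
  add_mem' := by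
    rintro _ _ ⟨s, hs, rfl⟩ ⟨t, ht, rfl⟩
    exact ⟨s + t, add_mem hs ht, rfl⟩
  zero_mem' := ⟨0, zero_mem _, rfl⟩
  algebraMap_mem' c := ⟨c • 1, (N.homs X.val X.val).smul_mem c (N.one_mem_homs _), by
    rw [Algebra.algebraMap_eq_smul_one]; rfl⟩
  star_mem' := by
    rintro _ ⟨s, hs, rfl⟩
    exact ⟨star s, star_mem_homs hs, rfl⟩

theorem isClosed_endAlg (X : N.Cocycle) (a₀ : K) :
    IsClosed (endAlg X a₀ : Set (H →L[ℂ] H)) := by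
  convert isClosed_setOf_extend_mem X X a₀ using 1
  ext T
  constructor
  · rintro ⟨t, ht, rfl⟩
    have h := ht
    rw [homs_eq_extend ht a₀] at h
    exact h
  · exact fun h => ⟨_, h, extend_self X X a₀ T⟩

/-- The spaces of intertwiners are stable under the continuous functional calculus. -/
theorem exists_homs_cfc {X : N.Cocycle} {t : N.Field0} (ht : t ∈ N.homs X.val X.val) (a₀ : K)
    (f : ℝ → ℝ) : ∃ s ∈ N.homs X.val X.val, s a₀ = cfc f (t a₀) := by
  have := isClosed_endAlg X a₀
  have : cfc f (t a₀) ∈ endAlg X a₀ := cfc_mem (𝕜' := ℂ) f ⟨t, ht, rfl⟩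
  exact this

theorem homs_nonneg_iff {X : N.Cocycle} {t : N.Field0} (ht : t ∈ N.homs X.val X.val) (a₀ : K) :
    0 ≤ t ↔ 0 ≤ t a₀ := by
  refine ⟨fun h => h a₀, fun h a => ?_⟩
  rw [homs_eq_extend ht a₀, extend, ← X.star_tr]
  simpa using star_left_conjugate_nonneg h (X.tr a₀ a)

/-- Positive arrows are exactly those of the form `r* r`. -/
theorem exists_star_mul_self {X : N.Cocycle} {t : N.Field0} (ht : t ∈ N.homs X.val X.val)
    (h : 0 ≤ t) : ∃ r ∈ N.homs X.val X.val, t = star r * r := by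
  obtain ⟨a₀⟩ := IsIndexSet.nonempty (K := K)
  obtain ⟨r, hr, hr'⟩ := exists_homs_cfc ht a₀ Real.sqrt
  refine ⟨r, hr, homs_ext ht (N.mul_mem_homs (star_mem_homs hr) hr) a₀ ?_⟩
  have h0 := h a₀
  have hsa : IsSelfAdjoint (cfc Real.sqrt (t a₀)) := cfc_predicate _ _
  rw [Pi.mul_apply, Pi.star_apply, hr', hsa.star_eq, ← cfc_mul _ _ _]
  conv_lhs => rw [← cfc_id ℝ (t a₀) (IsSelfAdjoint.of_nonneg h0)]
  exact cfc_congr fun x hx => (Real.mul_self_sqrt (spectrum_nonneg_of_nonneg h0 hx)).symm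

theorem star_mul_self_nonneg_field (t : N.Field0) : 0 ≤ star t * t :=
  fun a => star_mul_self_nonneg (t a)

/-! ### Subobjects and direct sums of covariant 1-cocycles -/

theorem αinv_mem_of_le (g : P) {b : Simplex1 K} {T : H →L[ℂ] H} (hT : T ∈ N.alg (g • b.d0)) :
    N.αinv g T ∈ N.alg b.supp := N.isotony b.d0_le (αinv_mem g hT)

/-- The Borchers property, for a projection given by intertwiners: no enlargement of the region is
needed, since the projection can be transported to a smaller one. -/
theorem exists_isometry {X : N.Cocycle} {e : N.Field0} (he : e ∈ N.homs X.val X.val)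
    (hp : star e * e = e) (h0 : e ≠ 0) (a : K) :
    ∃ w ∈ N.alg a, star w * w = 1 ∧ w * star w = e a := by
  obtain ⟨o, ho⟩ := (IsIndexSet.exists_ssub a).1
  have hle : o ≤ a := (IsIndexSet.lt_of_ssub ho).le
  have hpo : star (e o) * e o = e o := congrFun hp o
  have hsa : star (e o) = e o := by
    have := congrArg star hpo
    rwa [star_mul, star_star, hpo, eq_comm] at this
  have h0' : e o ≠ 0 := fun h => h0 (homs_ext he (zero_mem _) o h)
  obtain ⟨V, hV, hV1, hV2⟩ := N.borchers ho (e o) (he.1 o)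
    ⟨by rw [IsIdempotentElem]; rwa [hsa] at hpo, hsa⟩ h0'
  refine ⟨X.tr a o * V, mul_mem (X.tr_mem le_rfl hle) hV, ?_, ?_⟩
  · rw [star_mul, X.star_tr, mul_assoc, X.tr_mul_assoc, X.tr_self, one_mul, hV1]
  · rw [star_mul, X.star_tr, mul_assoc, ← mul_assoc V, hV2, ← mul_assoc, ← homs_tr he, mul_assoc,
      X.tr_mul, X.tr_self, mul_one]

theorem exists_subobject {X : N.Cocycle} {e : N.Field0} (he : e ∈ N.homs X.val X.val)
    (hp : star e * e = e) (h0 : e ≠ 0) :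
    ∃ (Y : N.Cocycle) (w : N.Field0), w ∈ N.homs Y.val X.val ∧ star w * w = 1 ∧
      w * star w = e := by
  choose w hw hw1 hw2 using exists_isometry he hp h0
  have hw2' : ∀ a (T : H →L[ℂ] H), w a * (star (w a) * T) = e a * T := fun a T => by
    rw [← mul_assoc, hw2]
  have hee : ∀ a, e a * w a = w a := fun a => by rw [← hw2, mul_assoc, hw1, mul_one]
  have hwe : ∀ a, star (w a) * e a = star (w a) := fun a => by
    rw [← hw2, ← mul_assoc, hw1, one_mul]
  let Y : N.Cocycle :=
    { val := fun g b => N.αinv g (star (w (g • b.d0))) * (X.val g b * w b.d1)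
      unitary_mem := fun g b => by
        have hX := Unitary.mem_iff.mp (X.unitary_mem g b)
        rw [Unitary.mem_iff]
        constructor
        · rw [star_mul, star_mul, ← αinv_star, star_star]
          calc _ = star (w b.d1) * (star (X.val g b) * (N.αinv g (w (g • b.d0)) *
                N.αinv g (star (w (g • b.d0))) * X.val g b)) * w b.d1 := by simp only [mul_assoc]
            _ = 1 := by
              rw [← αinv_mul, hw2, he.2, ← mul_assoc (star (X.val g b)), hX.1, one_mul, hwe, hw1]
        · rw [star_mul, star_mul, ← αinv_star, star_star]
          calc _ = N.αinv g (star (w (g • b.d0))) * (X.val g b * (w b.d1 * star (w b.d1)) *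
                star (X.val g b)) * N.αinv g (w (g • b.d0)) := by simp only [mul_assoc]
            _ = 1 := by
              rw [hw2, ← he.2, mul_assoc, mul_assoc, mul_assoc, ← mul_assoc (X.val g b), hX.2,
                one_mul, ← αinv_mul, hee, ← αinv_mul, hw1, αinv_one]
      mem_alg := fun g b => mul_mem (αinv_mem_of_le g (star_mem (hw _)))
        (mul_mem (X.mem_alg g b) (N.isotony b.d1_le (hw _)))
      cocycle := fun c s g => by
        have hmid : N.αinv g (w (g • c.d0.d1)) * N.αinv g (star (w (g • c.d2.d0))) =
            N.αinv g (e (g • c.d2.d0)) := by rw [c.d10, ← αinv_mul, hw2]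
        calc _ = N.αinv g (N.αinv s (star (w (s • g • c.d0.d0)))) *
              (N.αinv g (X.val s (c.d0.act g)) * X.val g c.d2 * w c.d2.d1) := by
              rw [X.cocycle, αinv_αinv, c.d00, c.d11, mul_smul]
          _ = N.αinv g (N.αinv s (star (w (s • g • c.d0.d0)))) * N.αinv g (X.val s (c.d0.act g)) *
              (N.αinv g (e (g • c.d2.d0)) * X.val g c.d2 * w c.d2.d1) := by
              rw [he.2, mul_assoc (X.val g c.d2), hee]; simp only [mul_assoc]
          _ = _ := by
              rw [← hmid, αinv_mul, αinv_mul]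
              simp only [mul_assoc]
              rfl }
  refine ⟨Y, w, ⟨hw, fun g b => ?_⟩, funext hw1, funext hw2⟩
  change N.αinv g (w (g • b.d0)) * (N.αinv g (star (w (g • b.d0))) * (X.val g b * w b.d1)) =
    X.val g b * w b.d1
  rw [← mul_assoc, ← αinv_mul, hw2, ← mul_assoc, he.2, mul_assoc, hee]

/-- The Borchers property, for a nontrivial projection and its complement. -/
theorem exists_isometry_pair (N : ObservableNet P K H) (a : K) :
    ∃ w ∈ N.alg a, ∃ v ∈ N.alg a, star w * w = 1 ∧ star v * v = 1 ∧
      w * star w + v * star v = 1 := by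
  obtain ⟨o, ho⟩ := (IsIndexSet.exists_ssub a).1
  obtain ⟨E, hE, hp, h0, h1⟩ := N.nontrivial o
  obtain ⟨w, hw, hw1, hw2⟩ := N.borchers ho E hE hp h0
  obtain ⟨v, hv, hv1, hv2⟩ := N.borchers ho (1 - E) (sub_mem (one_mem _) hE) hp.one_sub
    (sub_ne_zero.mpr (Ne.symm h1))
  exact ⟨w, hw, v, hv, hw1, hv1, by rw [hw2, hv2]; abel⟩

theorem exists_directSum (X Y : N.Cocycle) :
    ∃ (Z : N.Cocycle) (w v : N.Field0), w ∈ N.homs X.val Z.val ∧ v ∈ N.homs Y.val Z.val ∧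
      star w * w = 1 ∧ star v * v = 1 ∧ w * star w + v * star v = 1 := by
  choose w hw v hv hw1 hv1 hwv using exists_isometry_pair N
  have horth : ∀ a, star (w a) * v a = 0 := fun a => by
    have h : star (w a) * (w a * star (w a) + v a * star (v a)) * v a = star (w a) * v a := by
      rw [hwv, mul_one]
    have h' : star (w a) * (w a * star (w a) + v a * star (v a)) * v a =
        star (w a) * w a * (star (w a) * v a) + star (w a) * v a * (star (v a) * v a) := by
      simp only [mul_add, add_mul, mul_assoc]
    rw [h', hw1, hv1, one_mul, mul_one] at h
    simpa using h
  have horth' : ∀ a, star (v a) * w a = 0 := fun a => by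
    have := congrArg star (horth a)
    simpa using this
  have hw1' : ∀ a (T : H →L[ℂ] H), star (w a) * (w a * T) = T := fun a T => by
    rw [← mul_assoc, hw1, one_mul]
  have hv1' : ∀ a (T : H →L[ℂ] H), star (v a) * (v a * T) = T := fun a T => by
    rw [← mul_assoc, hv1, one_mul]
  have ho1 : ∀ a (T : H →L[ℂ] H), star (w a) * (v a * T) = 0 := fun a T => by
    rw [← mul_assoc, horth, zero_mul]
  have ho2 : ∀ a (T : H →L[ℂ] H), star (v a) * (w a * T) = 0 := fun a T => by
    rw [← mul_assoc, horth', zero_mul]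
  have conj_mul : ∀ (g : P) (S T : H →L[ℂ] H), N.αinv g S * (N.αinv g T) = N.αinv g (S * T) :=
    fun g S T => (αinv_mul g S T).symm
  have conj_mul' : ∀ (g : P) (S T R : H →L[ℂ] H),
      N.αinv g S * (N.αinv g T * R) = N.αinv g (S * T) * R := fun g S T R => by
    rw [← mul_assoc, αinv_mul]
  have hα0 : ∀ g : P, N.αinv g 0 = 0 := fun g => by simp [αinv]
  have hX : ∀ g b (T : H →L[ℂ] H), star (X.val g b) * (X.val g b * T) = T := fun g b T => by
    rw [← mul_assoc, (Unitary.mem_iff.mp (X.unitary_mem g b)).1, one_mul]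
  have hY : ∀ g b (T : H →L[ℂ] H), star (Y.val g b) * (Y.val g b * T) = T := fun g b T => by
    rw [← mul_assoc, (Unitary.mem_iff.mp (Y.unitary_mem g b)).1, one_mul]
  have hX' : ∀ g b (T : H →L[ℂ] H), X.val g b * (star (X.val g b) * T) = T := fun g b T => by
    rw [← mul_assoc, (Unitary.mem_iff.mp (X.unitary_mem g b)).2, one_mul]
  have hY' : ∀ g b (T : H →L[ℂ] H), Y.val g b * (star (Y.val g b) * T) = T := fun g b T => by
    rw [← mul_assoc, (Unitary.mem_iff.mp (Y.unitary_mem g b)).2, one_mul]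
  let Z : N.Cocycle :=
    { val := fun g b => N.αinv g (w (g • b.d0)) * (X.val g b * star (w b.d1)) +
        N.αinv g (v (g • b.d0)) * (Y.val g b * star (v b.d1))
      unitary_mem := fun g b => by
        rw [Unitary.mem_iff]
        constructor
        · simp only [star_add, star_mul, star_star, ← αinv_star, mul_add, add_mul, mul_assoc,
            conj_mul', hw1, hv1, horth, horth', αinv_one, hα0, one_mul, zero_mul, mul_zero, hX, hY,
            add_zero, zero_add, hwv]
        · simp only [star_add, star_mul, star_star, ← αinv_star, mul_add, add_mul, mul_assoc,
            hw1', hv1', ho1, ho2, hX', hY', mul_zero, add_zero, zero_add, conj_mul]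
          rw [← αinv_add, hwv, αinv_one]
      mem_alg := fun g b => add_mem
        (mul_mem (αinv_mem_of_le g (hw _))
          (mul_mem (X.mem_alg g b) (N.isotony b.d1_le (star_mem (hw _)))))
        (mul_mem (αinv_mem_of_le g (hv _))
          (mul_mem (Y.mem_alg g b) (N.isotony b.d1_le (star_mem (hv _)))))
      cocycle := fun c s g => by
        simp only [X.cocycle, Y.cocycle, αinv_add, αinv_mul, mul_add, add_mul, mul_assoc]
        simp only [Simplex1.act, c.d10, conj_mul', hw1, hv1, horth, horth', αinv_one, hα0, one_mul,
          zero_mul, mul_zero, add_zero, zero_add, αinv_αinv, ← c.d00, c.d11, mul_smul] }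
  refine ⟨Z, w, v, ⟨hw, fun g b => ?_⟩, ⟨hv, fun g b => ?_⟩, funext hw1, funext hv1, funext hwv⟩
  · change _ = (N.αinv g (w (g • b.d0)) * (X.val g b * star (w b.d1)) +
      N.αinv g (v (g • b.d0)) * (Y.val g b * star (v b.d1))) * w b.d1
    simp only [add_mul, mul_assoc, hw1, horth', mul_one, mul_zero, add_zero]
  · change _ = (N.αinv g (w (g • b.d0)) * (X.val g b * star (w b.d1)) +
      N.αinv g (v (g • b.d0)) * (Y.val g b * star (v b.d1))) * v b.d1
    simp only [add_mul, mul_assoc, hv1, horth, mul_one, mul_zero, zero_add]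

/-! ### The symmetric monoidal category of covariant 1-cocycles -/

/-- The components of an arrow of `Z¹_c(𝒜_K)`. -/
def Cocycle.components {X Y : N.Cocycle} (f : X ⟶ Y) : N.Field0 :=
  (show N.homs X.val Y.val from f).1

/-- The arrow of `Z¹_c(𝒜_K)` with given components. -/
def Cocycle.homMk {X Y : N.Cocycle} (t : N.Field0) (ht : t ∈ N.homs X.val Y.val) : X ⟶ Y :=
  (⟨t, ht⟩ : N.homs X.val Y.val)

open Cocycle (components homMk)

theorem components_mem {X Y : N.Cocycle} (f : X ⟶ Y) : components f ∈ N.homs X.val Y.val :=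
  (show N.homs X.val Y.val from f).2

theorem components_injective {X Y : N.Cocycle} {f g : X ⟶ Y}
    (h : components f = components g) : f = g := Subtype.ext h

@[simp] theorem components_homMk {X Y : N.Cocycle} (t : N.Field0)
    (ht : t ∈ N.homs X.val Y.val) : components (homMk (X := X) (Y := Y) t ht) = t := rfl

@[simp] theorem components_comp {X Y Z : N.Cocycle} (f : X ⟶ Y) (g : Y ⟶ Z) :
    components (f ≫ g) = components g * components f := rfl

@[simp] theorem components_id (X : N.Cocycle) : components (𝟙 X) = 1 := rfl

/-- Objects with the same underlying 1-cocycle are isomorphic through the arrow with trivial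
components. -/
def isoOfEq {X Y : N.Cocycle} (h : X = Y) : X ≅ Y where
  hom := homMk 1 (h ▸ N.one_mem_homs _)
  inv := homMk 1 (h ▸ N.one_mem_homs _)
  hom_inv_id := components_injective (by simp)
  inv_hom_id := components_injective (by simp)

/-- The tensor product of arrows. -/
noncomputable def homTensor {X X' Y Y' : N.Cocycle} (f : X ⟶ X') (g : Y ⟶ Y') :
    X.tensor Y ⟶ X'.tensor Y' :=
  homMk (N.tensorHom X.val (components f) (components g))
    (tensorHom_mem_homs (components_mem f) (components_mem g))

open MonoidalCategory

noncomputable instance : MonoidalCategoryStruct N.Cocycle where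
  tensorObj := Cocycle.tensor
  tensorHom := homTensor
  whiskerLeft X _ _ g := homTensor (𝟙 X) g
  whiskerRight f Y := homTensor f (𝟙 Y)
  tensorUnit := Cocycle.unit
  associator := fun X Y Z => isoOfEq (tensor_assoc X Y Z)
  leftUnitor := fun X => isoOfEq (unit_tensor X)
  rightUnitor := fun X => isoOfEq (tensor_unit X)

theorem components_tensorHom {X X' Y Y' : N.Cocycle} (f : X ⟶ X') (g : Y ⟶ Y') :
    components (f ⊗ₘ g) = components f * X.amp (components g) := rfl

theorem components_associator_hom (X Y Z : N.Cocycle) : components (α_ X Y Z).hom = 1 := rfl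

theorem components_leftUnitor_hom (X : N.Cocycle) : components (λ_ X).hom = 1 := rfl

theorem components_rightUnitor_hom (X : N.Cocycle) : components (ρ_ X).hom = 1 := rfl

noncomputable instance : MonoidalCategory N.Cocycle :=
  MonoidalCategory.ofTensorHom
    (id_tensorHom_id := fun X Y => components_injective (by
      rw [components_tensorHom, components_id, components_id, map_one, one_mul, components_id]))
    (tensorHom_comp_tensorHom := fun {X Y Z X' Y' Z'} f g h k => components_injective (by
      simp only [components_tensorHom, components_comp, map_mul]
      rw [mul_assoc, ← mul_assoc _ (components f), ← homs_amp_comm (components_mem f)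
        (homs_le_localFields (components_mem _))]
      simp only [mul_assoc]))
    (associator_naturality := fun {X Y Z X' Y' Z'} f g h => components_injective (by
      simp only [components_tensorHom, components_comp, components_associator_hom, one_mul, mul_one]
      change _ * (X.tensor Y).amp _ = _
      rw [amp_tensor X Y (homs_le_localFields (components_mem h)), map_mul, mul_assoc]))
    (leftUnitor_naturality := fun {X Y} f => components_injective (by
      simp only [components_tensorHom, components_comp, components_leftUnitor_hom, one_mul, mul_one,
        components_id]
      exact amp_unit _))
    (rightUnitor_naturality := fun {X Y} f => components_injective (by
      simp only [components_tensorHom, components_comp, components_rightUnitor_hom, one_mul,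
        mul_one, components_id, map_one]))
    (pentagon := fun W X Y Z => components_injective (by
      simp only [components_tensorHom, components_comp, components_associator_hom,
        mul_one, components_id, map_one]))
    (triangle := fun X Y => components_injective (by
      simp only [components_tensorHom, components_comp, components_associator_hom, mul_one,
        components_id, map_one, components_leftUnitor_hom, components_rightUnitor_hom]))

theorem components_whiskerLeft (X : N.Cocycle) {Y Y' : N.Cocycle} (g : Y ⟶ Y') :
    components (X ◁ g) = X.amp (components g) := one_mul _

theorem components_whiskerRight {X X' : N.Cocycle} (f : X ⟶ X') (Y : N.Cocycle) :
    components (f ▷ Y) = components f := by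
  change components f * X.amp 1 = _
  rw [map_one, mul_one]

noncomputable instance : BraidedCategory N.Cocycle where
  braiding X Y :=
    { hom := homMk (N.eps X.val Y.val) (eps_mem_homs X Y)
      inv := homMk (N.eps Y.val X.val) (eps_mem_homs Y X)
      hom_inv_id := components_injective (eps_mul_eps X Y)
      inv_hom_id := components_injective (eps_mul_eps Y X) }
  braiding_naturality_right X Y Z f := components_injective (by
    rw [components_comp, components_comp, components_whiskerLeft, components_whiskerRight]
    simpa using eps_natural (N.one_mem_homs X.val) (components_mem f))
  braiding_naturality_left {X Y} f Z := components_injective (by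
    rw [components_comp, components_comp, components_whiskerLeft, components_whiskerRight]
    simpa using eps_natural (components_mem f) (N.one_mem_homs Z.val))
  hexagon_forward X Y Z := components_injective (by
    simp only [components_comp, components_whiskerLeft, components_whiskerRight]
    change 1 * N.eps X.val (Y.tensor Z).val * 1 = Y.amp (N.eps X.val Z.val) *
      (1 * N.eps X.val Y.val)
    rw [one_mul, mul_one, one_mul, eps_tensor_right])
  hexagon_reverse X Y Z := components_injective (by
    simp only [components_comp, components_whiskerLeft, components_whiskerRight]
    change 1 * N.eps (X.tensor Y).val Z.val * 1 = N.eps X.val Z.val *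
      (1 * X.amp (N.eps Y.val Z.val))
    rw [one_mul, mul_one, one_mul, eps_tensor_left])

noncomputable instance : SymmetricCategory N.Cocycle where
  symmetry X Y := components_injective (eps_mul_eps X Y)

/-! ### Positive left inverses -/

/-- `(I, I) = ℂ 1_I`. -/
theorem homs_unit_eq_smul_one {t : N.Field0} (ht : t ∈ N.homs N.unitField N.unitField) :
    ∃ c : ℂ, t = c • 1 := by
  obtain ⟨a₀⟩ := IsIndexSet.nonempty (K := K)
  have hconst : ∀ a, t a = t a₀ := fun a => by
    have h := homs_tr (X := Cocycle.unit) (Y := Cocycle.unit) ht a a₀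
    have h1 : (Cocycle.unit : N.Cocycle).tr a a₀ = 1 := by
      have : ∀ p, N.pathOp N.unitField p = 1 := fun p => by
        induction p with
        | nil => rfl
        | cons b p ih => rw [pathOp, ih, unitField, one_mul]
      exact this _
    rwa [h1, one_mul, mul_one] at h
  obtain ⟨c, hc⟩ := eq_smul_one_of_global (mem_global (ht.1 a₀)) (fun o B hB => by
    obtain ⟨e, he⟩ := exists_perp o
    rw [← hconst e]
    exact (N.causality he _ (ht.1 e) _ hB).symm)
  exact ⟨c, funext fun a => by rw [hconst a, hc]; rfl⟩

theorem nontrivial_operators (N : ObservableNet P K H) : Nontrivial (H →L[ℂ] H) := by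
  obtain ⟨a₀⟩ := IsIndexSet.nonempty (K := K)
  obtain ⟨E, -, -, h0, -⟩ := N.nontrivial a₀
  exact ⟨E, 0, h0⟩

/-- A left inverse of `X` which is monotone, without any normalization. -/
structure IsPositiveLeftInverse (N : ObservableNet P K H) (X : N.Cocycle)
    (φ : N.Field1 → N.Field1 → N.Field0 → N.Field0) : Prop extends N.IsLeftInverse X φ where
  nonneg : ∀ (Y : N.Cocycle),
    ∀ t ∈ N.homs (X.tensor Y).val (X.tensor Y).val, 0 ≤ t → 0 ≤ φ Y.val Y.val t

theorem IsStandardLeftInverse.isPositiveLeftInverse {X : N.Cocycle}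
    {φ : N.Field1 → N.Field1 → N.Field0 → N.Field0} (h : N.IsStandardLeftInverse X φ) :
    N.IsPositiveLeftInverse X φ where
  toIsLeftInverse := h.toIsLeftInverse
  nonneg Y t ht h0 := by
    obtain ⟨s, hs, rfl⟩ := exists_star_mul_self (X := X.tensor Y) ht h0
    obtain ⟨r, -, hr⟩ := h.positive Y s hs
    rw [hr]
    exact star_mul_self_nonneg_field r

section LeftInverse

variable {X : N.Cocycle} {φ : N.Field1 → N.Field1 → N.Field0 → N.Field0}

theorem IsLeftInverse.map_zero (h : N.IsLeftInverse X φ) (Z Y : N.Cocycle) :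
    φ Z.val Y.val 0 = 0 := by
  simpa using h.map_smul Z Y 0 0 (zero_mem _)

theorem IsLeftInverse.map_sub (h : N.IsLeftInverse X φ) (Z Y : N.Cocycle) {t t' : N.Field0}
    (ht : t ∈ N.homs (X.tensor Z).val (X.tensor Y).val)
    (ht' : t' ∈ N.homs (X.tensor Z).val (X.tensor Y).val) :
    φ Z.val Y.val (t - t') = φ Z.val Y.val t - φ Z.val Y.val t' := by
  have h1 : t - t' = t + (-1 : ℂ) • t' := by simp [sub_eq_add_neg]
  rw [h1, h.map_add Z Y t ht _ (Submodule.smul_mem _ _ ht'), h.map_smul Z Y _ t' ht']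
  simp [sub_eq_add_neg]

theorem IsLeftInverse.map_sum (h : N.IsLeftInverse X φ) (Z Y : N.Cocycle) {ι : Type*}
    (s : Finset ι) (t : ι → N.Field0)
    (ht : ∀ i ∈ s, t i ∈ N.homs (X.tensor Z).val (X.tensor Y).val) :
    φ Z.val Y.val (∑ i ∈ s, t i) = ∑ i ∈ s, φ Z.val Y.val (t i) := by
  classical
  induction s using Finset.induction_on with
  | empty => simpa using h.map_zero Z Y
  | insert i s hi ih =>
    rw [Finset.sum_insert hi, Finset.sum_insert hi, h.map_add Z Y _ (ht i (by simp)) _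
      (sum_mem fun j hj => ht j (by simp [hj])), ih fun j hj => ht j (by simp [hj])]

/-- A left inverse does not see tensoring with an identity arrow from the right, which leaves the
components of an arrow unchanged. -/
theorem IsLeftInverse.apply_tensor (h : N.IsLeftInverse X φ) (Z Y W : N.Cocycle) {t : N.Field0}
    (ht : t ∈ N.homs (X.tensor Z).val (X.tensor Y).val) :
    φ (Z.tensor W).val (Y.tensor W).val t = φ Z.val Y.val t := by
  have := h.tensor_one Z Y W t ht
  change φ _ _ (t * (X.tensor Z).amp 1) = _ * Z.amp 1 at this
  rwa [map_one, map_one, mul_one, mul_one] at this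

theorem IsLeftInverse.apply_comp (h : N.IsLeftInverse X φ) {Z Y Z' Y' : N.Cocycle}
    {t s r : N.Field0} (ht : t ∈ N.homs (X.tensor Z).val (X.tensor Y).val)
    (hs : s ∈ N.homs Y.val Y'.val) (hr : r ∈ N.homs Z'.val Z.val) :
    φ Z'.val Y'.val (X.amp s * t * X.amp r) = s * φ Z.val Y.val t * r := by
  have := h.comp Z Y Z' Y' t ht s hs r hr
  rwa [tensorHom_eq, tensorHom_eq, one_mul, one_mul] at this

theorem IsLeftInverse.apply_comp_left (h : N.IsLeftInverse X φ) {Z Y Y' : N.Cocycle}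
    {t s : N.Field0} (ht : t ∈ N.homs (X.tensor Z).val (X.tensor Y).val)
    (hs : s ∈ N.homs Y.val Y'.val) : φ Z.val Y'.val (X.amp s * t) = s * φ Z.val Y.val t := by
  simpa using h.apply_comp ht hs (N.one_mem_homs Z.val)

theorem IsLeftInverse.apply_comp_right (h : N.IsLeftInverse X φ) {Z Y Z' : N.Cocycle}
    {t r : N.Field0} (ht : t ∈ N.homs (X.tensor Z).val (X.tensor Y).val)
    (hr : r ∈ N.homs Z'.val Z.val) : φ Z'.val Y.val (t * X.amp r) = φ Z.val Y.val t * r := by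
  simpa using h.apply_comp ht (N.one_mem_homs Y.val) hr

theorem IsLeftInverse.apply_one (h : N.IsLeftInverse X φ) (Z : N.Cocycle) :
    φ Z.val Z.val 1 = φ N.unitField N.unitField 1 := by
  have := h.apply_tensor Cocycle.unit Cocycle.unit Z (N.one_mem_homs (X.tensor Cocycle.unit).val)
  rwa [unit_tensor] at this

/-- The image of `ε(X, X)` under a left inverse: the statistics operator. -/
theorem IsLeftInverse.statistics_mem (h : N.IsLeftInverse X φ) :
    φ X.val X.val (N.eps X.val X.val) ∈ N.homs X.val X.val :=
  h.mem X X _ (eps_mem_homs X X)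

/-- A left inverse applied to the first factor of an arrow `T : X ⊗ Z → X ⊗ W`, into which an
identity `1_X` has been inserted as the second factor. -/
theorem IsLeftInverse.apply_conj_eps (h : N.IsLeftInverse X φ) {Z W : N.Cocycle} {T : N.Field0}
    (hT : T ∈ N.homs (X.tensor Z).val (X.tensor W).val) :
    φ (X.tensor Z).val (X.tensor W).val (N.eps X.val X.val * X.amp T * N.eps X.val X.val) =
      X.amp (φ Z.val W.val T) := by
  have e1 := eps_mul_eps X X
  -- naturality of `ε(X, -)` moves the inserted factor to the far right
  have h1 := eps_natural (N.one_mem_homs X.val) hT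
  rw [one_mul, map_one, mul_one, eps_tensor_right, eps_tensor_right] at h1
  have h2 : N.eps X.val X.val * X.amp T * N.eps X.val X.val =
      X.amp (N.eps W.val X.val) * T * X.amp (N.eps X.val Z.val) := by
    have hW : X.amp (N.eps W.val X.val) * X.amp (N.eps X.val W.val) = 1 := by
      rw [← map_mul, eps_mul_eps, map_one]
    calc _ = X.amp (N.eps W.val X.val) * (X.amp (N.eps X.val W.val) * N.eps X.val X.val * X.amp T) *
          N.eps X.val X.val := by
          simp only [← mul_assoc]; rw [hW, one_mul]
      _ = _ := by
          rw [h1]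
          simp only [mul_assoc]
          rw [e1, mul_one]
  have hm := h.mem Z W T hT
  have hT' := homs_tensor_right hT X
  rw [tensor_assoc, tensor_assoc] at hT'
  rw [h2, h.apply_comp hT' (eps_mem_homs W X) (eps_mem_homs X Z), h.apply_tensor Z W X hT]
  have h3 := eps_natural (N.one_mem_homs X.val) hm
  rw [one_mul, map_one, mul_one] at h3
  rw [mul_assoc, ← h3, ← mul_assoc, eps_mul_eps, one_mul]

theorem IsLeftInverse.apply_amp_mul_eps (h : N.IsLeftInverse X φ) {Z W : N.Cocycle} {T : N.Field0}
    (hT : T ∈ N.homs (X.tensor Z).val (X.tensor W).val) :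
    φ (X.tensor Z).val (X.tensor W).val (X.amp T * N.eps X.val X.val) =
      T * φ X.val X.val (N.eps X.val X.val) := by
  have he := homs_tensor_right (eps_mem_homs X X) Z
  rw [tensor_assoc] at he
  rw [h.apply_comp_left he hT, h.apply_tensor X X Z (eps_mem_homs X X)]

theorem IsLeftInverse.apply_eps_mul_amp (h : N.IsLeftInverse X φ) {Z W : N.Cocycle} {T : N.Field0}
    (hT : T ∈ N.homs (X.tensor Z).val (X.tensor W).val) :
    φ (X.tensor Z).val (X.tensor W).val (N.eps X.val X.val * X.amp T) =
      φ X.val X.val (N.eps X.val X.val) * T := by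
  have he := homs_tensor_right (eps_mem_homs X X) W
  rw [tensor_assoc] at he
  rw [h.apply_comp_right he hT, h.apply_tensor X X W (eps_mem_homs X X)]

/-- Left inverses are hermitian, as are all positive maps. -/
theorem IsPositiveLeftInverse.apply_star (h : N.IsPositiveLeftInverse X φ) (Z : N.Cocycle)
    {t : N.Field0} (ht : t ∈ N.homs (X.tensor Z).val (X.tensor Z).val) :
    φ Z.val Z.val (star t) = star (φ Z.val Z.val t) := by
  have hsq : ∀ s ∈ N.homs (X.tensor Z).val (X.tensor Z).val,
      star (φ Z.val Z.val (star s * s)) = φ Z.val Z.val (star s * s) := fun s hs => by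
    have h0 := h.nonneg Z _ (N.mul_mem_homs (star_mem_homs hs) hs) (star_mul_self_nonneg_field s)
    exact funext fun a => (IsSelfAdjoint.of_nonneg (h0 a)).star_eq
  have hsa : ∀ s ∈ N.homs (X.tensor Z).val (X.tensor Z).val, star s = s →
      star (φ Z.val Z.val s) = φ Z.val Z.val s := fun s hs hss => by
    have hp := add_mem hs (N.one_mem_homs (X.tensor Z).val)
    have hn := sub_mem hs (N.one_mem_homs (X.tensor Z).val)
    have e : (4 : ℂ) • s = star (s + 1) * (s + 1) - star (s - 1) * (s - 1) := by
      have : (4 : ℂ) • s = s + s + s + s := by module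
      rw [this]
      simp only [star_add, star_sub, hss, star_one]
      noncomm_ring
    have e' := congrArg (φ Z.val Z.val) e
    rw [h.map_smul Z Z 4 s hs, h.toIsLeftInverse.map_sub Z Z
      (N.mul_mem_homs (star_mem_homs hp) hp) (N.mul_mem_homs (star_mem_homs hn) hn)] at e'
    have e2 := congrArg star e'
    rw [star_sub, hsq _ hp, hsq _ hn, ← e', star_smul] at e2
    have h4 : star (4 : ℂ) = 4 := by simp
    rw [h4] at e2
    exact smul_right_injective _ (by norm_num : (4 : ℂ) ≠ 0) e2
  have hst := star_mem_homs (X := X.tensor Z) (Y := X.tensor Z) ht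
  have h1 := hsa (t + star t) (add_mem ht hst) (by rw [star_add, star_star, add_comm])
  have h2 := hsa (Complex.I • (t - star t)) (Submodule.smul_mem _ _ (sub_mem ht hst)) (by
    rw [star_smul, star_sub, star_star, Complex.star_def, Complex.conj_I]; module)
  rw [h.map_add Z Z _ ht _ hst, star_add] at h1
  rw [h.map_smul Z Z _ _ (sub_mem ht hst), h.toIsLeftInverse.map_sub Z Z ht hst, star_smul,
    star_sub, Complex.star_def, Complex.conj_I] at h2
  have h3 : star (φ Z.val Z.val t) - star (φ Z.val Z.val (star t)) =
      -(φ Z.val Z.val t - φ Z.val Z.val (star t)) := by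
    have h2' := congrArg (Complex.I • ·) h2
    simp only [smul_smul] at h2'
    simpa using h2'
  have h4 : (2 : ℂ) • φ Z.val Z.val (star t) = (2 : ℂ) • star (φ Z.val Z.val t) := by
    have h5 : star (φ Z.val Z.val t) + star (φ Z.val Z.val (star t)) +
        (star (φ Z.val Z.val t) - star (φ Z.val Z.val (star t))) =
        φ Z.val Z.val t + φ Z.val Z.val (star t) +
        -(φ Z.val Z.val t - φ Z.val Z.val (star t)) := by rw [h1, h3]
    calc (2 : ℂ) • φ Z.val Z.val (star t) = φ Z.val Z.val t + φ Z.val Z.val (star t) +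
        -(φ Z.val Z.val t - φ Z.val Z.val (star t)) := by module
      _ = _ := by rw [← h5]; module
  exact smul_right_injective _ (two_ne_zero : (2 : ℂ) ≠ 0) h4

theorem IsPositiveLeftInverse.mono (h : N.IsPositiveLeftInverse X φ) (Z : N.Cocycle)
    {s t : N.Field0} (hs : s ∈ N.homs (X.tensor Z).val (X.tensor Z).val)
    (ht : t ∈ N.homs (X.tensor Z).val (X.tensor Z).val) (hst : s ≤ t) :
    φ Z.val Z.val s ≤ φ Z.val Z.val t := by
  have := h.nonneg Z _ (sub_mem ht hs) (sub_nonneg.mpr hst)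
  rwa [h.toIsLeftInverse.map_sub Z Z ht hs, sub_nonneg] at this

theorem smul_nonneg_field {r : ℝ} (hr : 0 ≤ r) {t : K → H →L[ℂ] H} (ht : 0 ≤ t) :
    0 ≤ (r : ℂ) • t := fun a => by
  have := smul_nonneg hr (ht a)
  rwa [← Complex.coe_smul] at this

/-- The Cauchy–Schwarz inequality for the operator valued form `(s, t) ↦ φ(s* t)`; it holds because
`φ` is a bimodule map. -/
theorem IsPositiveLeftInverse.cauchySchwarz (h : N.IsPositiveLeftInverse X φ) {m : ℝ} (hm : 0 < m)
    (h1 : φ N.unitField N.unitField 1 = (m : ℂ) • 1) (Z : N.Cocycle) {S : N.Field0}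
    (hS : S ∈ N.homs (X.tensor Z).val (X.tensor Z).val) :
    star (φ Z.val Z.val S) * φ Z.val Z.val S ≤ (m : ℂ) • φ Z.val Z.val (star S * S) := by
  set T := φ Z.val Z.val S with hTdef
  have hT : T ∈ N.homs Z.val Z.val := h.mem Z Z S hS
  have hT' := star_mem_homs hT
  have hS' := star_mem_homs (X := X.tensor Z) (Y := X.tensor Z) hS
  have hA := amp_mem_homs X hT
  have hA' := amp_mem_homs X hT'
  have hone : φ Z.val Z.val 1 = (m : ℂ) • 1 := (h.apply_one Z).trans h1
  have hD : (m : ℂ) • S - X.amp T ∈ N.homs (X.tensor Z).val (X.tensor Z).val :=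
    sub_mem (Submodule.smul_mem _ _ hS) hA
  have h0 := h.nonneg Z _ (N.mul_mem_homs (star_mem_homs hD) hD) (star_mul_self_nonneg_field _)
  have hexp : star ((m : ℂ) • S - X.amp T) * ((m : ℂ) • S - X.amp T) =
      ((m : ℂ) * m) • (star S * S) - (m : ℂ) • (star S * X.amp T) -
        ((m : ℂ) • (X.amp (star T) * S) - X.amp (star T) * 1 * X.amp T) := by
    rw [star_sub, star_smul, ← map_star (X.amp), Complex.star_def, Complex.conj_ofReal]
    simp only [sub_mul, mul_sub, smul_mul_assoc, mul_smul_comm, mul_one]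
    module
  have m1 := N.mul_mem_homs hS' hS
  have m2 := N.mul_mem_homs hS' hA
  have m3 := N.mul_mem_homs hA' hS
  have m4 := N.mul_mem_homs (N.mul_mem_homs hA' (N.one_mem_homs (X.tensor Z).val)) hA
  have sm {c : ℂ} {t : N.Field0} (ht : t ∈ N.homs (X.tensor Z).val (X.tensor Z).val) :
      c • t ∈ N.homs (X.tensor Z).val (X.tensor Z).val := Submodule.smul_mem _ _ ht
  rw [hexp, h.toIsLeftInverse.map_sub Z Z (sub_mem (sm m1) (sm m2)) (sub_mem (sm m3) m4),
    h.toIsLeftInverse.map_sub Z Z (sm m1) (sm m2), h.toIsLeftInverse.map_sub Z Z (sm m3) m4,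
    h.map_smul Z Z _ _ m1, h.map_smul Z Z _ _ m2, h.map_smul Z Z _ _ m3,
    h.apply_comp_right hS' hT, h.apply_comp_left hS hT',
    h.apply_comp (N.one_mem_homs (X.tensor Z).val) hT' hT, h.apply_star Z hS, hone, ← hTdef] at h0
  have h2 : (m : ℂ) • ((m : ℂ) • φ Z.val Z.val (star S * S) - star T * T) =
      ((m : ℂ) * m) • φ Z.val Z.val (star S * S) - (m : ℂ) • (star T * T) -
        ((m : ℂ) • (star T * T) - star T * (m : ℂ) • 1 * T) := by
    rw [mul_smul_comm, smul_mul_assoc, mul_one]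
    module
  rw [← h2] at h0
  have h3 := smul_nonneg_field (inv_nonneg.mpr hm.le) h0
  rw [smul_smul, ← Complex.ofReal_mul, inv_mul_cancel₀ hm.ne', Complex.ofReal_one, one_smul] at h3
  exact sub_nonneg.mp h3

/-- The Pimsner–Popa bound: `λ* T* T λ ≤ m (1_X ⊗ φ(T* T))`, with the statistics operator
`λ = φ(ε(X, X))` and the mass `m = φ(1)`. -/
theorem IsPositiveLeftInverse.pimsnerPopa (h : N.IsPositiveLeftInverse X φ) {m : ℝ} (hm : 0 < m)
    (h1 : φ N.unitField N.unitField 1 = (m : ℂ) • 1) (Z : N.Cocycle) {T : N.Field0}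
    (hT : T ∈ N.homs (X.tensor Z).val (X.tensor Z).val) :
    star (T * φ X.val X.val (N.eps X.val X.val)) * (T * φ X.val X.val (N.eps X.val X.val)) ≤
      (m : ℂ) • X.amp (φ Z.val Z.val (star T * T)) := by
  have he := homs_tensor_right (eps_mem_homs X X) Z
  rw [tensor_assoc] at he
  have hS := N.mul_mem_homs (amp_mem_homs X hT) he
  have key := h.cauchySchwarz hm h1 (X.tensor Z) hS
  have hsq : star (X.amp T * N.eps X.val X.val) * (X.amp T * N.eps X.val X.val) =
      N.eps X.val X.val * X.amp (star T * T) * N.eps X.val X.val := by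
    rw [star_mul, star_eps, ← map_star, map_mul]
    simp only [mul_assoc]
  rw [hsq, h.apply_conj_eps (N.mul_mem_homs (star_mem_homs hT) hT), h.apply_amp_mul_eps hT] at key
  exact key

/-! ### Left inverses of compressed objects -/

/-- The compression of a left inverse of `X` by `w : Y → X`. -/
noncomputable def compress (φ : N.Field1 → N.Field1 → N.Field0 → N.Field0) (w : N.Field0) :
    N.Field1 → N.Field1 → N.Field0 → N.Field0 := fun Z W t => φ Z W (w * t * star w)

theorem compress_mem_homs {X Y : N.Cocycle} {w : N.Field0} (hw : w ∈ N.homs Y.val X.val)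
    {Z W : N.Cocycle} {t : N.Field0} (ht : t ∈ N.homs (Y.tensor Z).val (Y.tensor W).val) :
    w * t * star w ∈ N.homs (X.tensor Z).val (X.tensor W).val :=
  N.mul_mem_homs (N.mul_mem_homs (homs_tensor_right hw W) ht)
    (homs_tensor_right (star_mem_homs hw) Z)

theorem IsPositiveLeftInverse.compress (h : N.IsPositiveLeftInverse X φ) {Y : N.Cocycle}
    {w : N.Field0} (hw : w ∈ N.homs Y.val X.val) : N.IsPositiveLeftInverse Y (compress φ w) where
  mem Z W t ht := h.mem Z W _ (compress_mem_homs hw ht)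
  map_add Z W t ht t' ht' := by
    rw [ObservableNet.compress, mul_add, add_mul]
    exact h.map_add Z W _ (compress_mem_homs hw ht) _ (compress_mem_homs hw ht')
  map_smul Z W c t ht := by
    rw [ObservableNet.compress, mul_smul_comm, smul_mul_assoc]
    exact h.map_smul Z W c _ (compress_mem_homs hw ht)
  tensor_one Z W V t ht := by
    rw [ObservableNet.compress, ObservableNet.compress]
    change φ _ _ (w * (t * (Y.tensor Z).amp 1) * star w) = _ * Z.amp 1
    rw [map_one, map_one, mul_one, mul_one]
    exact h.apply_tensor Z W V (compress_mem_homs hw ht)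
  comp Z W Z' W' t ht s hs r hr := by
    rw [ObservableNet.compress, ObservableNet.compress,
      ← h.apply_comp (compress_mem_homs hw ht) hs hr]
    congr 1
    change w * (1 * Y.amp s * t * (1 * Y.amp r)) * star w = _
    have h1 := homs_amp_comm hw (homs_le_localFields hs)
    have h2 := homs_amp_comm (star_mem_homs hw) (homs_le_localFields hr)
    calc _ = w * Y.amp s * t * (Y.amp r * star w) := by
          rw [one_mul, one_mul]; simp only [mul_assoc]
      _ = _ := by rw [h1, ← h2]; simp only [mul_assoc]
  nonneg Z t ht h0 := by
    refine h.nonneg Z _ (compress_mem_homs hw ht) fun a => ?_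
    simpa using star_right_conjugate_nonneg (h0 a) (w a)

/-- The statistics operator of a compressed left inverse. -/
theorem IsLeftInverse.compress_eps (h : N.IsLeftInverse X φ) {Y : N.Cocycle}
    {w : N.Field0} (hw : w ∈ N.homs Y.val X.val) :
    compress φ w Y.val Y.val (N.eps Y.val Y.val) =
      star w * φ X.val X.val (N.eps X.val X.val) * w := by
  have hw' := star_mem_homs hw
  rw [compress, ← h.apply_comp (eps_mem_homs X X) hw' hw]
  congr 1
  have h1 := eps_natural hw' (N.one_mem_homs Y.val)
  have h2 := eps_natural (N.one_mem_homs X.val) hw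
  rw [map_one, mul_one, one_mul] at h1
  rw [map_one, mul_one, one_mul] at h2
  rw [mul_assoc, h1, ← mul_assoc, homs_amp_comm hw (homs_le_localFields hw'), mul_assoc, ← h2,
    mul_assoc]

open ComplexOrder in
/-- The value of a positive left inverse at a positive element of `(X, X)` is a number. -/
theorem IsPositiveLeftInverse.exists_scalar (h : N.IsPositiveLeftInverse X φ) {t : N.Field0}
    (ht : t ∈ N.homs X.val X.val) (h0 : 0 ≤ t) :
    ∃ r : ℝ, 0 ≤ r ∧ φ N.unitField N.unitField t = (r : ℂ) • 1 := by
  obtain ⟨a₀⟩ := IsIndexSet.nonempty (K := K)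
  have := nontrivial_operators N
  have ht' : t ∈ N.homs (X.tensor Cocycle.unit).val (X.tensor Cocycle.unit).val := by
    rwa [tensor_unit]
  obtain ⟨c, hc⟩ := homs_unit_eq_smul_one (h.mem Cocycle.unit Cocycle.unit t ht')
  have hpos := h.nonneg Cocycle.unit t ht' h0 a₀
  rw [hc] at hpos
  have hc0 : 0 ≤ c := by
    have hs := spectrum_nonneg_of_nonneg (𝕜 := ℂ) hpos (x := c) (by
      change c ∈ spectrum ℂ (c • (1 : H →L[ℂ] H))
      rw [← Algebra.algebraMap_eq_smul_one, spectrum.scalar_eq]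
      rfl)
    exact hs
  refine ⟨c.re, (Complex.nonneg_iff.mp hc0).1, ?_⟩
  have hc' : ((c.re : ℝ) : ℂ) = c := Complex.ext rfl (by simpa using (Complex.nonneg_iff.mp hc0).2)
  rw [hc']
  exact hc

/-- Nonnegative combinations of positive left inverses are positive left inverses. -/
theorem IsPositiveLeftInverse.add_smul {ψ : N.Field1 → N.Field1 → N.Field0 → N.Field0}
    (h : N.IsPositiveLeftInverse X φ) (h' : N.IsPositiveLeftInverse X ψ) {p q : ℝ} (hp : 0 ≤ p)
    (hq : 0 ≤ q) :
    N.IsPositiveLeftInverse X fun Z W t => (p : ℂ) • φ Z W t + (q : ℂ) • ψ Z W t where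
  mem Z W t ht := add_mem (Submodule.smul_mem _ _ (h.mem Z W t ht))
    (Submodule.smul_mem _ _ (h'.mem Z W t ht))
  map_add Z W t ht t' ht' := by
    rw [h.map_add Z W t ht t' ht', h'.map_add Z W t ht t' ht']
    module
  map_smul Z W c t ht := by
    rw [h.map_smul Z W c t ht, h'.map_smul Z W c t ht]
    module
  tensor_one Z W V t ht := by
    rw [h.tensor_one Z W V t ht, h'.tensor_one Z W V t ht]
    simp only [tensorHom_eq, map_one, mul_one]
  comp Z W Z' W' t ht s hs r hr := by
    rw [h.comp Z W Z' W' t ht s hs r hr, h'.comp Z W Z' W' t ht s hs r hr]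
    simp only [mul_add, add_mul, mul_smul_comm, smul_mul_assoc]
  nonneg Z t ht h0 := add_nonneg (smul_nonneg_field hp (h.nonneg Z t ht h0))
    (smul_nonneg_field hq (h'.nonneg Z t ht h0))

/-- A positive left inverse with positive mass and with statistics operator of scalar square can be
normalized to a standard one. -/
theorem IsPositiveLeftInverse.hasFiniteStatistics (h : N.IsPositiveLeftInverse X φ) {m c : ℝ}
    (hm : 0 < m) (hc : 0 < c) (h1 : φ N.unitField N.unitField 1 = (m : ℂ) • 1)
    (hs : φ X.val X.val (N.eps X.val X.val) * φ X.val X.val (N.eps X.val X.val) = (c : ℂ) • 1) :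
    N.HasFiniteStatistics X := by
  have hφ := h.add_smul h (inv_nonneg.mpr hm.le) le_rfl
  have hval : ∀ Z W t, ((m⁻¹ : ℝ) : ℂ) • φ Z W t + ((0 : ℝ) : ℂ) • φ Z W t =
      ((m⁻¹ : ℝ) : ℂ) • φ Z W t := fun Z W t => by simp
  simp only [hval] at hφ
  refine ⟨_,
    { toIsLeftInverse := hφ.toIsLeftInverse, positive := ?_, normalized := ?_, standard := ?_ }⟩
  · intro Y s hs
    have hss := N.mul_mem_homs (star_mem_homs (X := X.tensor Y) (Y := X.tensor Y) hs) hs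
    exact exists_star_mul_self (hφ.mem Y Y _ hss)
      (hφ.nonneg Y _ hss (star_mul_self_nonneg_field s))
  · rw [h1, smul_smul, ← Complex.ofReal_mul, inv_mul_cancel₀ hm.ne', Complex.ofReal_one, one_smul]
  · refine ⟨m⁻¹ * m⁻¹ * c, by positivity, ?_⟩
    rw [smul_mul_smul_comm, hs, smul_smul]
    push_cast
    rfl

end LeftInverse

/-! ### Finite statistics of the unit, of tensor products and of direct sums -/

theorem IsStandardLeftInverse.statistics {X : N.Cocycle}
    {φ : N.Field1 → N.Field1 → N.Field0 → N.Field0} (h : N.IsStandardLeftInverse X φ) :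
    φ N.unitField N.unitField 1 = ((1 : ℝ) : ℂ) • 1 ∧
    star (φ X.val X.val (N.eps X.val X.val)) = φ X.val X.val (N.eps X.val X.val) := by
  refine ⟨by rw [h.normalized, Complex.ofReal_one, one_smul], ?_⟩
  rw [← h.isPositiveLeftInverse.apply_star X (eps_mem_homs X X), star_eps]

/-- The identity map is a standard left inverse of the unit. -/
theorem hasFiniteStatistics_unit : N.HasFiniteStatistics Cocycle.unit := by
  have h : N.IsPositiveLeftInverse Cocycle.unit (fun _ _ t => t) :=
    { mem := fun Z Y t ht => by
        change t ∈ N.homs (Cocycle.unit.tensor Z).val (Cocycle.unit.tensor Y).val at ht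
        rwa [unit_tensor, unit_tensor] at ht
      map_add := fun _ _ _ _ _ _ => rfl
      map_smul := fun _ _ _ _ _ => rfl
      tensor_one := fun Z Y W t ht => by
        change t * (Cocycle.unit.tensor Z).amp 1 = t * Z.amp 1
        rw [map_one, map_one]
      comp := fun Z Y Z' Y' t ht s hs r hr => by
        change 1 * Cocycle.unit.amp s * t * (1 * Cocycle.unit.amp r) = _
        rw [amp_unit, amp_unit, one_mul, one_mul]
      nonneg := fun Y t ht h0 => h0 }
  refine h.hasFiniteStatistics one_pos one_pos (by simp) ?_
  rw [Cocycle.unit_val]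
  have := eps_unit_right (Cocycle.unit : N.Cocycle)
  rw [Cocycle.unit_val] at this
  simp [this]

/-- Left inverses of `X` and `Y` compose to a left inverse of `X ⊗ Y`. -/
theorem IsPositiveLeftInverse.comp_tensor {X Y : N.Cocycle}
    {φ ψ : N.Field1 → N.Field1 → N.Field0 → N.Field0} (hX : N.IsPositiveLeftInverse X φ)
    (hY : N.IsPositiveLeftInverse Y ψ) :
    N.IsPositiveLeftInverse (X.tensor Y)
      fun Z W t => ψ Z W (φ (N.tensorObj Y.val Z) (N.tensorObj Y.val W) t) := by
  have hmem : ∀ (Z W : N.Cocycle) (t : N.Field0),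
      t ∈ N.homs (N.tensorObj (X.tensor Y).val Z.val) (N.tensorObj (X.tensor Y).val W.val) →
      t ∈ N.homs (X.tensor (Y.tensor Z)).val (X.tensor (Y.tensor W)).val := fun Z W t ht => by
    rw [← tensor_assoc, ← tensor_assoc]
    exact ht
  refine
    { mem := fun Z W t ht => hY.mem Z W _ (hX.mem (Y.tensor Z) (Y.tensor W) t (hmem Z W t ht))
      map_add := fun Z W t ht t' ht' => ?_
      map_smul := fun Z W c t ht => ?_
      tensor_one := fun Z W V t ht => ?_
      comp := fun Z W Z' W' t ht s hs r hr => ?_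
      nonneg := fun Z t ht h0 => hY.nonneg Z _ (hX.mem (Y.tensor Z) (Y.tensor Z) t (hmem Z Z t ht))
        (hX.nonneg (Y.tensor Z) t (hmem Z Z t ht) h0) }
  · have h1 := hmem Z W t ht
    have h2 := hmem Z W t' ht'
    have e := hX.map_add (Y.tensor Z) (Y.tensor W) t h1 t' h2
    rw [Cocycle.tensor_val, Cocycle.tensor_val] at e
    simp only [e]
    exact hY.map_add Z W _ (hX.mem (Y.tensor Z) (Y.tensor W) t h1) _
      (hX.mem (Y.tensor Z) (Y.tensor W) t' h2)
  · have h1 := hmem Z W t ht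
    have e := hX.map_smul (Y.tensor Z) (Y.tensor W) c t h1
    rw [Cocycle.tensor_val, Cocycle.tensor_val] at e
    simp only [e]
    exact hY.map_smul Z W c _ (hX.mem (Y.tensor Z) (Y.tensor W) t h1)
  · have h1 := hmem Z W t ht
    have e := hX.apply_tensor (Y.tensor Z) (Y.tensor W) V h1
    rw [tensor_assoc, tensor_assoc] at e
    simp only [tensorHom_eq (Z), map_one, mul_one]
    change ψ _ _ (φ (Y.tensor (Z.tensor V)).val (Y.tensor (W.tensor V)).val
      (t * ((X.tensor Y).tensor Z).amp 1)) = _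
    rw [map_one, mul_one, e]
    exact hY.apply_tensor Z W V (hX.mem (Y.tensor Z) (Y.tensor W) t h1)
  · have h1 := hmem Z W t ht
    have e := hX.apply_comp h1 (amp_mem_homs Y hs) (amp_mem_homs Y hr)
    change ψ _ _ (φ (Y.tensor Z').val (Y.tensor W').val
      (1 * (X.tensor Y).amp s * t * (1 * (X.tensor Y).amp r))) = _
    rw [one_mul, one_mul, amp_tensor X Y (homs_le_localFields hs),
      amp_tensor X Y (homs_le_localFields hr), e]
    exact hY.apply_comp (hX.mem (Y.tensor Z) (Y.tensor W) t h1) hs hr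

/-- The composite of standard left inverses of `X` and `Y` is standard, since its statistics
operator is the tensor product of those of `X` and `Y`. -/
theorem hasFiniteStatistics_tensor {X Y : N.Cocycle} (hX : N.HasFiniteStatistics X)
    (hY : N.HasFiniteStatistics Y) : N.HasFiniteStatistics (X.tensor Y) := by
  obtain ⟨φ, hφ⟩ := hX
  obtain ⟨ψ, hψ⟩ := hY
  obtain ⟨c, hc, hcφ⟩ := hφ.standard
  obtain ⟨d, hd, hdψ⟩ := hψ.standard
  have hφ' := hφ.isPositiveLeftInverse
  have hψ' := hψ.isPositiveLeftInverse
  set l := φ X.val X.val (N.eps X.val X.val) with hl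
  set l' := ψ Y.val Y.val (N.eps Y.val Y.val) with hl'
  have ml : l ∈ N.homs X.val X.val := hφ.toIsLeftInverse.statistics_mem
  have ml' : l' ∈ N.homs Y.val Y.val := hψ.toIsLeftInverse.statistics_mem
  have hsq : l * X.amp l' * (l * X.amp l') = ((c * d : ℝ) : ℂ) • 1 := by
    calc _ = l * (X.amp l' * l) * X.amp l' := by simp only [mul_assoc]
      _ = l * l * X.amp (l' * l') := by
        rw [← homs_amp_comm ml (homs_le_localFields ml'), map_mul]; simp only [mul_assoc]
      _ = _ := by
        rw [hcφ, hdψ, map_smul, map_one, smul_mul_smul_comm, one_mul, Complex.ofReal_mul]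
  refine (hφ'.comp_tensor hψ').hasFiniteStatistics (m := 1) one_pos (mul_pos hc hd) ?_ ?_
  · have e := hφ'.apply_one (Y.tensor Cocycle.unit)
    rw [hφ.normalized, Cocycle.tensor_val, Cocycle.unit_val] at e
    rw [e, hψ.normalized, Complex.ofReal_one, one_smul]
  · -- the statistics operator of `X ⊗ Y` is `λ_X ⊗ λ_Y`
    have key : ψ (X.tensor Y).val (X.tensor Y).val
        (φ (Y.tensor (X.tensor Y)).val (Y.tensor (X.tensor Y)).val
          (N.eps (X.tensor Y).val (X.tensor Y).val)) = l * X.amp l' := by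
      -- expansion of the symmetry by the hexagon identities
      have h1 : N.eps (X.tensor Y).val (X.tensor Y).val = X.amp (N.eps X.val Y.val) *
          (N.eps X.val X.val * X.amp (X.amp (N.eps Y.val Y.val) * N.eps Y.val X.val)) := by
        rw [eps_tensor_left, eps_tensor_right, eps_tensor_right, mul_assoc]
      have m1 : X.amp (N.eps Y.val Y.val) * N.eps Y.val X.val ∈
          N.homs (Y.tensor (X.tensor Y)).val (X.tensor (Y.tensor Y)).val := by
        have := homs_tensor_right (eps_mem_homs Y X) Y
        rw [tensor_assoc, tensor_assoc] at this
        exact N.mul_mem_homs (amp_mem_homs X (eps_mem_homs Y Y)) this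
      have m2 : N.eps X.val Y.val ∈
          N.homs (X.tensor (Y.tensor Y)).val (Y.tensor (X.tensor Y)).val := by
        have := homs_tensor_right (eps_mem_homs X Y) Y
        rwa [tensor_assoc, tensor_assoc] at this
      have m3 : N.eps X.val X.val ∈ N.homs (X.tensor (X.tensor (Y.tensor Y))).val
          (X.tensor (X.tensor (Y.tensor Y))).val := by
        have := homs_tensor_right (eps_mem_homs X X) (Y.tensor Y)
        rwa [tensor_assoc] at this
      have m4 := N.mul_mem_homs m3 (amp_mem_homs X m1)
      rw [h1, hφ'.apply_comp_left m4 m2, hφ'.apply_comp_right m3 m1,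
        hφ'.apply_tensor X X (Y.tensor Y) (eps_mem_homs X X), ← hl]
      -- naturality of `ε(X, -)` brings the symmetry of `Y` to the front
      have h2 := eps_natural (N.one_mem_homs X.val) (eps_mem_homs Y Y)
      have h3 := eps_natural ml (N.one_mem_homs Y.val)
      rw [map_one, mul_one, one_mul] at h3
      rw [map_one, mul_one, one_mul, Cocycle.tensor_val, ← Cocycle.tensor_val, eps_tensor_right]
        at h2
      have h4 : N.eps X.val Y.val * X.amp (N.eps Y.val Y.val) =
          Y.amp (N.eps Y.val X.val) * (N.eps Y.val Y.val * Y.amp (N.eps X.val Y.val) *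
            N.eps X.val Y.val) := by
        have hu : Y.amp (N.eps Y.val X.val) * Y.amp (N.eps X.val Y.val) = 1 := by
          rw [← map_mul, eps_mul_eps, map_one]
        rw [mul_assoc (N.eps Y.val Y.val), ← h2]
        simp only [← mul_assoc]
        rw [hu, one_mul]
      have h5 : N.eps X.val Y.val * (l * (X.amp (N.eps Y.val Y.val) * N.eps Y.val X.val)) =
          Y.amp (l * N.eps Y.val X.val) * N.eps Y.val Y.val * Y.amp (N.eps X.val Y.val) := by
        calc _ = N.eps X.val Y.val * l * X.amp (N.eps Y.val Y.val) * N.eps Y.val X.val := by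
              simp only [mul_assoc]
          _ = Y.amp l * (N.eps X.val Y.val * X.amp (N.eps Y.val Y.val)) * N.eps Y.val X.val := by
              rw [h3]; simp only [mul_assoc]
          _ = _ := by
              rw [h4, map_mul]
              simp only [mul_assoc]
              rw [eps_mul_eps, mul_one]
      have m5 : N.eps Y.val Y.val ∈ N.homs (Y.tensor (Y.tensor X)).val
          (Y.tensor (Y.tensor X)).val := by
        have := homs_tensor_right (eps_mem_homs Y Y) X
        rwa [tensor_assoc] at this
      have m6 : l * N.eps Y.val X.val ∈ N.homs (Y.tensor X).val (X.tensor Y).val :=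
        N.mul_mem_homs (homs_tensor_right ml Y) (eps_mem_homs Y X)
      rw [h5, hψ'.apply_comp m5 m6 (eps_mem_homs X Y), hψ'.apply_tensor Y Y X (eps_mem_homs Y Y),
        ← hl']
      have h6 := eps_natural ml' (N.one_mem_homs X.val)
      rw [map_one, mul_one, one_mul] at h6
      rw [mul_assoc l, h6, mul_assoc, mul_assoc, eps_mul_eps, mul_one]
    have hgoal := hsq
    rw [← key] at hgoal
    exact hgoal

/-- The sum of the left inverses compressed to the two summands is standard, if they are weighted so
that the squares of the two statistics operators agree. -/
theorem hasFiniteStatistics_directSum {X Y Z : N.Cocycle} (hX : N.HasFiniteStatistics X)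
    (hY : N.HasFiniteStatistics Y) {w v : N.Field0} (hw : w ∈ N.homs X.val Z.val)
    (hv : v ∈ N.homs Y.val Z.val) (hw1 : star w * w = 1) (hv1 : star v * v = 1)
    (hwv : w * star w + v * star v = 1) : N.HasFiniteStatistics Z := by
  obtain ⟨φ, hφ⟩ := hX
  obtain ⟨ψ, hψ⟩ := hY
  obtain ⟨c, hc, hcφ⟩ := hφ.standard
  obtain ⟨d, hd, hdψ⟩ := hψ.standard
  have hφ' := hφ.isPositiveLeftInverse
  have hψ' := hψ.isPositiveLeftInverse
  have hw' := star_mem_homs hw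
  have hv' := star_mem_homs hv
  have horth : star w * v = 0 := by
    have h : star w * (w * star w + v * star v) * v = star w * v := by rw [hwv, mul_one]
    have h' : star w * (w * star w + v * star v) * v =
        star w * w * (star w * v) + star w * v * (star v * v) := by
      simp only [mul_add, add_mul, mul_assoc]
    rw [h', hw1, hv1, one_mul, mul_one] at h
    simpa using h
  have horth' : star v * w = 0 := by simpa using congrArg star horth
  -- the weights make the two statistics operators have the same absolute value
  have hp := Real.sqrt_pos.mpr hd
  have hq := Real.sqrt_pos.mpr hc
  refine ((hφ'.compress hw').add_smul (hψ'.compress hv') hp.le hq.le).hasFiniteStatistics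
    (m := √d + √c) (c := c * d) (by positivity) (by positivity) ?_ ?_
  · simp only [compress, star_star, mul_one, hw1, hv1, hφ.normalized, hψ.normalized,
      Complex.ofReal_add, _root_.add_smul]
  · simp only [hφ'.compress_eps hw', hψ'.compress_eps hv', star_star]
    set l := φ X.val X.val (N.eps X.val X.val)
    set l' := ψ Y.val Y.val (N.eps Y.val Y.val)
    have e1 : w * l * star w * (w * l * star w) = (c : ℂ) • (w * star w) := by
      calc _ = w * l * (star w * w) * l * star w := by simp only [mul_assoc]
        _ = w * (l * l) * star w := by rw [hw1, mul_one]; simp only [mul_assoc]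
        _ = _ := by rw [hcφ, mul_smul_comm, mul_one, smul_mul_assoc]
    have e2 : v * l' * star v * (v * l' * star v) = (d : ℂ) • (v * star v) := by
      calc _ = v * l' * (star v * v) * l' * star v := by simp only [mul_assoc]
        _ = v * (l' * l') * star v := by rw [hv1, mul_one]; simp only [mul_assoc]
        _ = _ := by rw [hdψ, mul_smul_comm, mul_one, smul_mul_assoc]
    have e3 : w * l * star w * (v * l' * star v) = 0 := by
      calc _ = w * l * (star w * v) * l' * star v := by simp only [mul_assoc]
        _ = _ := by rw [horth]; simp
    have e4 : v * l' * star v * (w * l * star w) = 0 := by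
      calc _ = v * l' * (star v * w) * l * star w := by simp only [mul_assoc]
        _ = _ := by rw [horth']; simp
    have s1 : ((√d : ℝ) : ℂ) * ((√d : ℝ) : ℂ) = d := by
      rw [← Complex.ofReal_mul, Real.mul_self_sqrt hd.le]
    have s2 : ((√c : ℝ) : ℂ) * ((√c : ℝ) : ℂ) = c := by
      rw [← Complex.ofReal_mul, Real.mul_self_sqrt hc.le]
    simp only [mul_add, add_mul, smul_mul_smul_comm, e1, e2, e3, e4, smul_zero, add_zero, zero_add,
      s1, s2, smul_smul]
    rw [mul_comm (d : ℂ), ← smul_add, hwv, Complex.ofReal_mul]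

/-! ### Finiteness of the spectra of self-intertwiners -/

section Finite

variable {X : N.Cocycle} {φ : N.Field1 → N.Field1 → N.Field0 → N.Field0}

theorem norm_sq_le_of_star_mul_self_le {A : H →L[ℂ] H} {r : ℝ} (hr : 0 ≤ r)
    (h : star A * A ≤ (r : ℂ) • 1) : ‖A‖ ^ 2 ≤ r := by
  have h1 := CStarAlgebra.norm_le_norm_of_nonneg_of_le (star_mul_self_nonneg A) h
  rw [CStarRing.norm_star_mul_self, ← sq] at h1
  refine h1.trans ?_
  rw [norm_smul, Complex.norm_real, Real.norm_of_nonneg hr]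
  exact mul_le_of_le_one_right hr ContinuousLinearMap.norm_id_le

/-- The Pimsner–Popa bound for self-intertwiners: `φ(t* t) ≥ c ‖t‖²`. -/
theorem IsStandardLeftInverse.norm_bound (h : N.IsStandardLeftInverse X φ) {c : ℝ} (hc : 0 < c)
    (hs : φ X.val X.val (N.eps X.val X.val) * φ X.val X.val (N.eps X.val X.val) = (c : ℂ) • 1)
    {t : N.Field0} (ht : t ∈ N.homs X.val X.val) (a : K) :
    ∃ r : ℝ, φ N.unitField N.unitField (star t * t) = (r : ℂ) • 1 ∧ c * ‖t a‖ ^ 2 ≤ r := by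
  have htt := N.mul_mem_homs (star_mem_homs ht) ht
  obtain ⟨r, hr, hr'⟩ :=
    h.isPositiveLeftInverse.exists_scalar htt (star_mul_self_nonneg_field t)
  refine ⟨r, hr', ?_⟩
  obtain ⟨h1, hl⟩ := h.statistics
  set l := φ X.val X.val (N.eps X.val X.val)
  have ht' : t ∈ N.homs (X.tensor Cocycle.unit).val (X.tensor Cocycle.unit).val := by
    rwa [tensor_unit]
  have key := h.isPositiveLeftInverse.pimsnerPopa one_pos h1 Cocycle.unit ht'
  rw [Cocycle.unit_val, hr', map_smul, map_one, Complex.ofReal_one, one_smul] at key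
  have h2 := norm_sq_le_of_star_mul_self_le (A := (t * l) a) hr (key a)
  have h3 : (t * l) a * star ((t * l) a) = (c : ℂ) • (t a * star (t a)) := by
    have : t * l * star (t * l) = (c : ℂ) • (t * star t) := by
      rw [star_mul, hl]
      calc _ = t * (l * l) * star t := by simp only [mul_assoc]
        _ = _ := by rw [hs, mul_smul_comm, mul_one, smul_mul_assoc]
    exact congrFun this a
  have h4 : ‖(t * l) a‖ ^ 2 = c * ‖t a‖ ^ 2 := by
    rw [sq, ← CStarRing.norm_self_mul_star, h3, norm_smul, Complex.norm_real,
      Real.norm_of_nonneg hc.le, CStarRing.norm_self_mul_star, sq]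
  rwa [h4] at h2

/-- There is a bound on the number of self-intertwiners of norm at least one whose squares add up to
at most one. -/
theorem IsStandardLeftInverse.card_mul_le (h : N.IsStandardLeftInverse X φ) {c : ℝ} (hc : 0 < c)
    (hs : φ X.val X.val (N.eps X.val X.val) * φ X.val X.val (N.eps X.val X.val) = (c : ℂ) • 1)
    {ι : Type*} (s : Finset ι) (t : ι → N.Field0) (ht : ∀ i ∈ s, t i ∈ N.homs X.val X.val) (a : K)
    (hn : ∀ i ∈ s, 1 ≤ ‖t i a‖) (hle : ∑ i ∈ s, star (t i) * t i ≤ 1) : s.card * c ≤ 1 := by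
  have := nontrivial_operators N
  have hmem : ∀ i ∈ s, star (t i) * t i ∈
      N.homs (X.tensor Cocycle.unit).val (X.tensor Cocycle.unit).val := fun i hi => by
    rw [tensor_unit]
    exact N.mul_mem_homs (star_mem_homs (ht i hi)) (ht i hi)
  have h1 := h.isPositiveLeftInverse.mono Cocycle.unit (sum_mem hmem)
    (N.one_mem_homs (X.tensor Cocycle.unit).val) hle
  rw [h.toIsLeftInverse.map_sum Cocycle.unit Cocycle.unit s _ hmem, Cocycle.unit_val,
    h.normalized] at h1
  have h2 : ∀ i ∈ s, ((c : ℂ) • (1 : H →L[ℂ] H)) ≤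
      φ N.unitField N.unitField (star (t i) * t i) a := fun i hi => by
    obtain ⟨r, hr, hcr⟩ := h.norm_bound hc hs (ht i hi) a
    have hcr' : c ≤ r := by
      refine le_trans ?_ hcr
      have := one_le_pow₀ (n := 2) (hn i hi)
      nlinarith
    rw [hr, Pi.smul_apply, Pi.one_apply, ← sub_nonneg, ← sub_smul, ← Complex.ofReal_sub,
      Complex.coe_smul]
    exact smul_nonneg (sub_nonneg.mpr hcr') zero_le_one
  have h3 : (s.card : ℂ) • ((c : ℂ) • (1 : H →L[ℂ] H)) ≤ 1 := by
    refine le_trans ?_ (h1 a)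
    rw [Finset.sum_apply]
    refine le_trans (le_of_eq ?_) (Finset.sum_le_sum h2)
    rw [Finset.sum_const, ← Nat.cast_smul_eq_nsmul ℂ]
  rw [smul_smul] at h3
  have h4 := CStarAlgebra.norm_le_norm_of_nonneg_of_le (a := ((s.card : ℂ) * c) • (1 : H →L[ℂ] H))
    (by
      have : ((s.card : ℂ) * c) = ((s.card * c : ℝ) : ℂ) := by push_cast; rfl
      rw [this, Complex.coe_smul]
      exact smul_nonneg (by positivity) zero_le_one) h3
  rw [norm_smul, CStarRing.norm_one, mul_one, norm_mul, Complex.norm_natCast, Complex.norm_real,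
    Real.norm_of_nonneg hc.le] at h4
  exact h4

/-- Disjoint bump functions of height one at the points of a finite set. -/
theorem exists_bumps (F : Finset ℝ) : ∃ f : ℝ → ℝ → ℝ, (∀ x, Continuous (f x)) ∧
    (∀ x, f x x = 1) ∧ ∀ y, ∑ x ∈ F, f x y * f x y ≤ 1 := by
  classical
  obtain ⟨δ, hδ, hsep⟩ : ∃ δ > 0, ∀ p ∈ F ×ˢ F, p.1 ≠ p.2 → 2 * δ < |p.1 - p.2| := by
    have h : ∀ᶠ δ in nhdsWithin (0 : ℝ) (Set.Ioi 0),
        ∀ p ∈ F ×ˢ F, p.1 ≠ p.2 → 2 * δ < |p.1 - p.2| := by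
      rw [Filter.eventually_all_finset]
      intro p _
      by_cases hp : p.1 = p.2
      · exact Filter.Eventually.of_forall fun δ hne => absurd hp hne
      · have hpos : 0 < |p.1 - p.2| / 2 := by
          have := abs_pos.mpr (sub_ne_zero.mpr hp)
          positivity
        filter_upwards [Ioo_mem_nhdsGT hpos] with δ hδ _
        have := hδ.2
        linarith
    obtain ⟨δ, h1, h2⟩ := (h.and self_mem_nhdsWithin).exists
    exact ⟨δ, h2, h1⟩
  refine ⟨fun x y => max 0 (1 - |y - x| / δ), fun x => by fun_prop, fun x => by simp, fun y => ?_⟩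
  have hle : ∀ x, max 0 (1 - |y - x| / δ) * max 0 (1 - |y - x| / δ) ≤ 1 := fun x => by
    have h0 : 0 ≤ max 0 (1 - |y - x| / δ) := le_max_left _ _
    have h1 : max 0 (1 - |y - x| / δ) ≤ 1 := max_le zero_le_one (by
      have : 0 ≤ |y - x| / δ := by positivity
      linarith)
    nlinarith
  have hzero : ∀ x, δ ≤ |y - x| → max 0 (1 - |y - x| / δ) = 0 := fun x hx => by
    apply max_eq_left
    rw [sub_nonpos, le_div_iff₀ hδ, one_mul]
    exact hx
  by_cases hex : ∃ x ∈ F, |y - x| < δ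
  · obtain ⟨x, hx, hxy⟩ := hex
    rw [Finset.sum_eq_single_of_mem x hx fun z hz hzx => ?_]
    · exact hle x
    · beta_reduce
      rw [hzero z, mul_zero]
      have h1 := hsep (x, z) (by simp [hx, hz]) (Ne.symm hzx)
      have h2 : |x - z| ≤ |y - x| + |y - z| := by
        rw [abs_sub_comm y x]; exact abs_sub_le x y z
      simp only at h1
      linarith
  · push Not at hex
    rw [Finset.sum_eq_zero fun x hx => by beta_reduce; rw [hzero x (hex x hx), mul_zero]]
    exact zero_le_one

/-- Bump functions at more than `1 / c` points of the spectrum would violate the bound on the number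
of self-intertwiners of norm at least one. -/
theorem HasFiniteStatistics.finite_spectrum (hX : N.HasFiniteStatistics X) {t : N.Field0}
    (ht : t ∈ N.homs X.val X.val) (a : K) (hsa : IsSelfAdjoint (t a)) :
    (spectrum ℝ (t a)).Finite := by
  obtain ⟨φ, h⟩ := hX
  obtain ⟨c, hc, hs⟩ := h.standard
  by_contra hinf
  obtain ⟨n, hn⟩ := exists_nat_gt (1 / c)
  obtain ⟨F, hF, hcard⟩ := Set.Infinite.exists_subset_card_eq hinf n
  obtain ⟨f, hf, hf1, hfs⟩ := exists_bumps F
  choose s hs1 hs2 using fun x => exists_homs_cfc ht a (f x)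
  have hss : ∀ x, (star (s x) * s x) a = cfc (fun y => f x y * f x y) (t a) := fun x => by
    have hx : IsSelfAdjoint (cfc (f x) (t a)) := cfc_predicate _ _
    rw [Pi.mul_apply, Pi.star_apply, hs2, hx.star_eq, ← cfc_mul _ _ _ (hf x).continuousOn
      (hf x).continuousOn]
  have hmem : ∀ x, star (s x) * s x ∈ N.homs X.val X.val := fun x =>
    N.mul_mem_homs (star_mem_homs (hs1 x)) (hs1 x)
  have hbound := h.card_mul_le hc hs F s (fun x _ => hs1 x) a (fun x hx => by
      rw [hs2]
      have := norm_apply_le_norm_cfc (f x) (t a) (hF hx) (hf x).continuousOn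
      rwa [hf1, norm_one] at this) (by
      have h0 : 0 ≤ 1 - ∑ x ∈ F, star (s x) * s x := by
        rw [homs_nonneg_iff (sub_mem (N.one_mem_homs _) (sum_mem fun x _ => hmem x)) a,
          Pi.sub_apply, sub_nonneg, Finset.sum_apply]
        simp only [hss]
        rw [← cfc_sum (fun x y => f x y * f x y) (t a) F
          fun x _ => ((hf x).mul (hf x)).continuousOn]
        refine cfc_le_one _ _ fun y _ => ?_
        rw [Finset.sum_apply]
        exact hfs y
      exact sub_nonneg.mp h0)
  rw [hcard] at hbound
  rw [div_lt_iff₀ hc] at hn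
  linarith

/-- The spectral decomposition of a self-adjoint self-intertwiner of an object with finite
statistics. -/
theorem HasFiniteStatistics.exists_spectral (hX : N.HasFiniteStatistics X) {t : N.Field0}
    (ht : t ∈ N.homs X.val X.val) (hsa : star t = t) :
    ∃ (F : Finset ℝ) (r : ℝ → N.Field0), (∀ μ, r μ ∈ N.homs X.val X.val) ∧
      (∀ μ, star (r μ) = r μ) ∧ (∀ μ, r μ * r μ = r μ) ∧
      (∀ μ ∈ F, t * r μ = (μ : ℂ) • r μ) ∧ (∀ μ ∈ F, r μ ≠ 0) ∧ ∑ μ ∈ F, r μ = 1 ∧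
      (0 ≤ t → ∀ μ ∈ F, 0 ≤ μ) := by
  classical
  obtain ⟨a⟩ := IsIndexSet.nonempty (K := K)
  have hsa' : IsSelfAdjoint (t a) := congrFun hsa a
  have hfin := hX.finite_spectrum ht a hsa'
  have hcont : ∀ f : ℝ → ℝ, ContinuousOn f (spectrum ℝ (t a)) := fun f => hfin.continuousOn f
  choose r hr1 hr2 using fun μ : ℝ => exists_homs_cfc ht a (fun x => if x = μ then 1 else 0)
  have hst : ∀ μ, star (r μ) = r μ := fun μ => by
    refine homs_ext (star_mem_homs (hr1 μ)) (hr1 μ) a ?_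
    have : IsSelfAdjoint (r μ a) := hr2 μ ▸ cfc_predicate _ _
    exact this
  refine ⟨hfin.toFinset, r, hr1, hst, fun μ => ?_, fun μ hμ => ?_, fun μ hμ h0 => ?_, ?_, ?_⟩
  · refine homs_ext (N.mul_mem_homs (hr1 μ) (hr1 μ)) (hr1 μ) a ?_
    rw [Pi.mul_apply, hr2, ← cfc_mul _ _ _ (hcont _) (hcont _)]
    exact cfc_congr fun x _ => by split_ifs <;> simp
  · refine homs_ext (N.mul_mem_homs ht (hr1 μ)) (Submodule.smul_mem _ _ (hr1 μ)) a ?_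
    rw [Pi.mul_apply, Pi.smul_apply, hr2, Complex.coe_smul, ← cfc_const_mul _ _ _ (hcont _)]
    conv_lhs => rw [← cfc_id ℝ (t a) hsa']
    rw [cfc_id ℝ (t a) hsa']
    conv_lhs => enter [1]; rw [← cfc_id ℝ (t a) hsa']
    rw [← cfc_mul _ _ _ (hcont _) (hcont _)]
    refine cfc_congr fun x _ => ?_
    dsimp only [id]
    split_ifs with h
    · rw [h]
    · simp
  · have h1 := norm_apply_le_norm_cfc (fun x => if x = μ then (1 : ℝ) else 0) (t a)
      (hfin.mem_toFinset.mp hμ) (hcont _)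
    rw [← hr2, h0] at h1
    simp at h1
    exact absurd h1 (by norm_num)
  · refine homs_ext (sum_mem fun μ _ => hr1 μ) (N.one_mem_homs _) a ?_
    rw [Finset.sum_apply]
    simp only [hr2]
    rw [← cfc_sum _ _ _ fun _ _ => hcont _, Pi.one_apply, ← cfc_one ℝ (t a) hsa']
    refine cfc_congr fun x hx => ?_
    rw [Finset.sum_apply]
    simp [hx]
  · exact fun h0 μ hμ => spectrum_nonneg_of_nonneg (h0 a) (hfin.mem_toFinset.mp hμ)

end Finite

end ObservableNet

/-! ### Symmetrizers generated by a shifted involution -/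

section Symmetrizer

variable {R : Type*} [Ring R] (σ : R →+* R) (s : R)

/-- If `s` is the transposition of the first two of a sequence of objects and `σ` shifts the
sequence by one, this is the transposition of the objects with indices `0` and `i + 1`. -/
def starTransposition : ℕ → R
  | 0 => s
  | i + 1 => s * σ (starTransposition i) * s

/-- The Jucys–Murphy element: the sum of the transpositions of the object with index `0` with the
next `n` objects. -/
def jucysMurphy (n : ℕ) : R := ∑ i ∈ Finset.range n, starTransposition σ s i

/-- The sum of all permutations of the first `n + 1` objects. -/
def symmetrizer : ℕ → R
  | 0 => 1
  | n + 1 => (1 + jucysMurphy σ s (n + 1)) * σ (symmetrizer n)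

theorem jucysMurphy_zero : jucysMurphy σ s 0 = 0 := rfl

theorem jucysMurphy_succ (n : ℕ) :
    jucysMurphy σ s (n + 1) = s + s * σ (jucysMurphy σ s n) * s := by
  rw [jucysMurphy, Finset.sum_range_succ', jucysMurphy, map_sum, Finset.mul_sum, Finset.sum_mul,
    add_comm]
  rfl

/-- The relations of a symmetry `s` and of the shift `σ` on a subring `L`: `s` is an involution, it
satisfies the braid relation with its shift, and it commutes with what is shifted twice. -/
structure IsShiftedInvolution (L : Subring R) : Prop where
  mul_self : s * s = 1
  braid : σ s * s * σ s = s * σ s * s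
  map_mem : ∀ x ∈ L, σ x ∈ L
  mem : s ∈ L
  commute : ∀ x ∈ L, Commute s (σ (σ x))

variable {σ s} {L : Subring R}

theorem IsShiftedInvolution.starTransposition_mem (h : IsShiftedInvolution σ s L) (i : ℕ) :
    starTransposition σ s i ∈ L := by
  induction i with
  | zero => exact h.mem
  | succ i ih => exact mul_mem (mul_mem h.mem (h.map_mem _ ih)) h.mem

theorem IsShiftedInvolution.jucysMurphy_mem (h : IsShiftedInvolution σ s L) (n : ℕ) :
    jucysMurphy σ s n ∈ L :=
  sum_mem fun i _ => h.starTransposition_mem i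

/-- The braid relation for the shift of any of the transpositions. -/
theorem IsShiftedInvolution.starTransposition_braid (h : IsShiftedInvolution σ s L) (i : ℕ) :
    σ (starTransposition σ s i) * s * σ (starTransposition σ s i) =
      s * σ (starTransposition σ s i) * s := by
  induction i with
  | zero => exact h.braid
  | succ i ih =>
    have hc := h.commute _ (h.starTransposition_mem i)
    have ih' := congrArg σ ih
    simp only [map_mul] at ih'
    simp only [starTransposition, map_mul]
    have hbraid := h.braid
    set t := σ (σ (starTransposition σ s i))
    set s' := σ s
    have hc' : s * t = t * s := hc
    calc s' * t * s' * s * (s' * t * s') = s' * t * (s' * s * s') * t * s' := by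
          simp only [mul_assoc]
      _ = s' * (t * s) * s' * (s * t) * s' := by rw [hbraid]; simp only [mul_assoc]
      _ = s' * (s * t) * s' * (t * s) * s' := by rw [hc']
      _ = s' * s * (t * s' * t) * s * s' := by simp only [mul_assoc]
      _ = s' * s * s' * t * (s' * s * s') := by rw [ih']; simp only [mul_assoc]
      _ = s * s' * (s * t) * (s * s' * s) := by rw [hbraid]; simp only [mul_assoc]
      _ = s * s' * t * (s * s) * s' * s := by rw [hc']; simp only [mul_assoc]
      _ = _ := by rw [h.mul_self, mul_one]; simp only [mul_assoc]

/-- The Jucys–Murphy element commutes with the permutations that fix the object with index `0`. -/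
theorem IsShiftedInvolution.commute_jucysMurphy (h : IsShiftedInvolution σ s L) (i n : ℕ)
    (hi : i < n) :
    Commute (σ (starTransposition σ s i)) (jucysMurphy σ s (n + 1)) := by
  have zero_case : ∀ k, Commute (σ s) (jucysMurphy σ s (k + 2)) := fun k => by
    have hc : s * σ (σ (jucysMurphy σ s k)) = σ (σ (jucysMurphy σ s k)) * s :=
      h.commute _ (h.jucysMurphy_mem k)
    rw [jucysMurphy_succ, jucysMurphy_succ, map_add, map_mul, map_mul]
    have hbraid := h.braid
    have hs := h.mul_self
    set j := σ (σ (jucysMurphy σ s k))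
    set s' := σ s
    have hs' : s * s * s' = s' := by rw [hs, one_mul]
    rw [commute_iff_eq]
    have e1 : s' * (s * s' * s) = s * s' := by
      calc _ = (s' * s * s') * s := by simp only [mul_assoc]
        _ = s * s' * (s * s) := by rw [hbraid]; simp only [mul_assoc]
        _ = _ := by rw [hs, mul_one]
    have e2 : (s * s' * s) * s' = s' * s := by
      calc _ = s * (s' * s * s') := by simp only [mul_assoc]
        _ = s * s * s' * s := by rw [hbraid]; simp only [mul_assoc]
        _ = _ := by rw [hs']
    have e3 : s' * (s * (s' * j * s') * s) = s * (s' * j * s') * s * s' := by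
      calc _ = (s' * s * s') * j * s' * s := by simp only [mul_assoc]
        _ = s * s' * (s * j) * s' * s := by rw [hbraid]; simp only [mul_assoc]
        _ = s * s' * j * (s * s' * s) := by rw [hc]; simp only [mul_assoc]
        _ = _ := by rw [← hbraid]; simp only [mul_assoc]
    simp only [mul_add, add_mul, e1, e3, e2]
    abel
  induction i generalizing n with
  | zero =>
    obtain ⟨k, rfl⟩ := Nat.exists_eq_add_of_lt hi
    rw [zero_add]
    exact zero_case k
  | succ i ih =>
    obtain ⟨k, rfl⟩ : ∃ k, n = k + 1 := ⟨n - 1, by omega⟩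
    have h1 := zero_case k
    have h2 : Commute (σ (σ (starTransposition σ s i))) (jucysMurphy σ s (k + 2)) := by
      have hc := (h.commute _ (h.starTransposition_mem i)).symm
      rw [jucysMurphy_succ]
      exact hc.add_right ((hc.mul_right ((ih k (by omega)).map σ)).mul_right hc)
    simp only [starTransposition, map_mul]
    exact (h1.mul_left h2).mul_left h1

/-- The symmetrizer absorbs transpositions. -/
theorem IsShiftedInvolution.starTransposition_mul_symmetrizer (h : IsShiftedInvolution σ s L)
    (i n : ℕ) (hi : i < n) :
    starTransposition σ s i * symmetrizer σ s n = symmetrizer σ s n := by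
  induction n generalizing i with
  | zero => exact absurd hi (Nat.not_lt_zero i)
  | succ n ih =>
    have hσ : ∀ j < n, σ (starTransposition σ s j) * σ (symmetrizer σ s n) =
        σ (symmetrizer σ s n) := fun j hj => by rw [← map_mul, ih j hj]
    have h0 : s * symmetrizer σ s (n + 1) = symmetrizer σ s (n + 1) := by
      have hsum : σ (jucysMurphy σ s n) * s * σ (symmetrizer σ s n) =
          s * σ (jucysMurphy σ s n) * s * σ (symmetrizer σ s n) := by
        simp only [jucysMurphy, map_sum, Finset.sum_mul, Finset.mul_sum]
        refine Finset.sum_congr rfl fun j hj => ?_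
        rw [← h.starTransposition_braid, mul_assoc _ (σ _) (σ _),
          hσ j (Finset.mem_range.mp hj)]
      rw [symmetrizer, jucysMurphy_succ]
      calc _ = s * σ (symmetrizer σ s n) + (s * s) * σ (symmetrizer σ s n) +
            (s * s) * (σ (jucysMurphy σ s n) * s * σ (symmetrizer σ s n)) := by noncomm_ring
        _ = _ := by rw [h.mul_self, one_mul, one_mul, hsum]; noncomm_ring
    have h1 : ∀ j < n, σ (starTransposition σ s j) * symmetrizer σ s (n + 1) =
        symmetrizer σ s (n + 1) := fun j hj => by
      have hc := (Commute.one_right (σ (starTransposition σ s j))).add_right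
        (h.commute_jucysMurphy j n hj)
      rw [symmetrizer, ← mul_assoc, hc.eq, mul_assoc, hσ j hj]
    cases i with
    | zero => exact h0
    | succ i =>
      rw [starTransposition, mul_assoc, mul_assoc, h0, h1 i (by omega), h0]

theorem IsShiftedInvolution.one_add_jucysMurphy_mul_symmetrizer (h : IsShiftedInvolution σ s L)
    (n : ℕ) :
    (1 + jucysMurphy σ s n) * symmetrizer σ s n = (n + 1) • symmetrizer σ s n := by
  rw [add_mul, one_mul, jucysMurphy, Finset.sum_mul, Finset.sum_congr rfl fun i hi =>
    h.starTransposition_mul_symmetrizer i n (Finset.mem_range.mp hi),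
    Finset.sum_const, Finset.card_range, add_smul, one_smul, add_comm]

end Symmetrizer

namespace ObservableNet

variable {P : Type w} {K : Type v} {H : Type u} [Group P] [PartialOrder K] [CausalRelations K]
  [IsIndexSet K] [MulAction P K] [IsSymmetry P K] [NormedAddCommGroup H] [InnerProductSpace ℂ H]
  [CompleteSpace H] {N : ObservableNet P K H}

open CausalRelations (perp)

open Cocycle (components homMk)

/-! ### The statistics operator is central -/

section Symmetrizers

variable (Y : N.Cocycle)

/-- The shift `t ↦ 1_Y ⊗ t`, as a ring homomorphism. -/
noncomputable abbrev Cocycle.shift : (K → H →L[ℂ] H) →+* (K → H →L[ℂ] H) :=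
  RingHomClass.toRingHom Y.amp

/-- The braid relation is the naturality of `ε(Y, -)` at the arrow `ε(Y, Y)`. -/
theorem isShiftedInvolution_eps :
    IsShiftedInvolution Y.shift (N.eps Y.val Y.val) N.localFields.toSubring where
  mul_self := eps_mul_eps Y Y
  braid := by
    have h := eps_natural (N.one_mem_homs Y.val) (eps_mem_homs Y Y)
    rwa [one_mul, map_one, mul_one, eps_tensor_right, ← mul_assoc] at h
  map_mem x hx := Y.amp_mem_localFields hx
  mem := eps_mem_localFields Y Y
  commute x hx := by
    have h := homs_amp_comm (eps_mem_homs Y Y) hx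
    rwa [amp_tensor Y Y hx] at h

/-- The tensor powers. -/
noncomputable def Cocycle.power : ℕ → N.Cocycle
  | 0 => Cocycle.unit
  | n + 1 => Y.tensor (Cocycle.power n)

theorem power_tensor (n : ℕ) : (Y.power n).tensor Y = Y.power (n + 1) := by
  induction n with
  | zero => rw [Cocycle.power, Cocycle.power, unit_tensor, Cocycle.power, tensor_unit]
  | succ n ih => rw [Cocycle.power, tensor_assoc, ih]; rfl

variable {Y}

theorem homs_power_succ {n : ℕ} {t : N.Field0} (ht : t ∈ N.homs (Y.power n).val (Y.power n).val) :
    t ∈ N.homs (Y.power (n + 1)).val (Y.power (n + 1)).val := by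
  have := homs_tensor_right ht Y
  rwa [power_tensor] at this

variable (Y)

theorem eps_mem_homs_power (n : ℕ) :
    N.eps Y.val Y.val ∈ N.homs (Y.power (n + 2)).val (Y.power (n + 2)).val := by
  induction n with
  | zero =>
    have := eps_mem_homs Y Y
    rwa [← tensor_unit (Y.tensor Y), tensor_assoc] at this
  | succ n ih => exact homs_power_succ ih

theorem starTransposition_mem_homs (i : ℕ) :
    starTransposition Y.shift (N.eps Y.val Y.val) i ∈
      N.homs (Y.power (i + 2)).val (Y.power (i + 2)).val := by
  induction i with
  | zero => exact eps_mem_homs_power Y 0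
  | succ i ih =>
    exact N.mul_mem_homs (N.mul_mem_homs (eps_mem_homs_power Y _) (amp_mem_homs Y ih))
      (eps_mem_homs_power Y _)

theorem jucysMurphy_mem_homs (n : ℕ) : jucysMurphy Y.shift (N.eps Y.val Y.val) n ∈
    N.homs (Y.power (n + 1)).val (Y.power (n + 1)).val := by
  induction n with
  | zero => exact zero_mem _
  | succ n ih =>
    rw [jucysMurphy, Finset.sum_range_succ]
    exact add_mem (homs_power_succ ih) (starTransposition_mem_homs Y n)

theorem symmetrizer_mem_homs (n : ℕ) : symmetrizer Y.shift (N.eps Y.val Y.val) n ∈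
    N.homs (Y.power (n + 1)).val (Y.power (n + 1)).val := by
  induction n with
  | zero => exact N.one_mem_homs _
  | succ n ih =>
    exact N.mul_mem_homs (add_mem (N.one_mem_homs _) (jucysMurphy_mem_homs Y _))
      (amp_mem_homs Y ih)

theorem star_starTransposition (i : ℕ) :
    star (starTransposition Y.shift (N.eps Y.val Y.val) i) =
      starTransposition Y.shift (N.eps Y.val Y.val) i := by
  induction i with
  | zero => exact star_eps Y Y
  | succ i ih =>
    change star (_ * Y.amp _ * _) = _ * Y.amp _ * _
    rw [star_mul, star_mul, ← map_star, ih, star_eps, mul_assoc]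

theorem star_jucysMurphy (n : ℕ) :
    star (jucysMurphy Y.shift (N.eps Y.val Y.val) n) =
      jucysMurphy Y.shift (N.eps Y.val Y.val) n := by
  rw [jucysMurphy, star_sum]
  exact Finset.sum_congr rfl fun i _ => star_starTransposition Y i

variable {Y} {ψ : N.Field1 → N.Field1 → N.Field0 → N.Field0}

theorem IsLeftInverse.apply_jucysMurphy (h : N.IsLeftInverse Y ψ)
    (he : ψ Y.val Y.val (N.eps Y.val Y.val) = 0) (n : ℕ) :
    ψ (Y.power n).val (Y.power n).val (jucysMurphy Y.shift (N.eps Y.val Y.val) n) = 0 := by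
  induction n with
  | zero => exact h.map_zero _ _
  | succ n ih =>
    have hJ := jucysMurphy_mem_homs Y n
    have hε := eps_mem_homs_power Y n
    have h1 : ψ (Y.power (n + 1)).val (Y.power (n + 1)).val (N.eps Y.val Y.val) = 0 :=
      (h.apply_tensor Y Y (Y.power n) (eps_mem_homs Y Y)).trans he
    have h2 : ψ (Y.power (n + 1)).val (Y.power (n + 1)).val
        (N.eps Y.val Y.val * Y.amp (jucysMurphy Y.shift (N.eps Y.val Y.val) n) *
          N.eps Y.val Y.val) = 0 :=
      (h.apply_conj_eps hJ).trans (by rw [ih, _root_.map_zero])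
    rw [jucysMurphy_succ]
    refine (h.map_add _ _ _ hε _
      (N.mul_mem_homs (N.mul_mem_homs hε (amp_mem_homs Y hJ)) hε)).trans ?_
    rw [h1]
    exact (zero_add _).trans h2

theorem IsLeftInverse.apply_jucysMurphy_sq (h : N.IsLeftInverse Y ψ) {m : ℝ}
    (h1 : ψ N.unitField N.unitField 1 = (m : ℂ) • 1)
    (he : ψ Y.val Y.val (N.eps Y.val Y.val) = 0) (n : ℕ) :
    ψ (Y.power n).val (Y.power n).val (jucysMurphy Y.shift (N.eps Y.val Y.val) n *
      jucysMurphy Y.shift (N.eps Y.val Y.val) n) = ((n * m : ℝ) : ℂ) • 1 := by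
  induction n with
  | zero =>
    rw [jucysMurphy_zero, mul_zero]
    exact (h.map_zero _ _).trans (by simp)
  | succ n ih =>
    have hJ := jucysMurphy_mem_homs Y n
    have hε := eps_mem_homs_power Y n
    have ee := eps_mul_eps Y Y
    rw [jucysMurphy_succ]
    set J := jucysMurphy Y.shift (N.eps Y.val Y.val) n
    set ε := N.eps Y.val Y.val
    have hJJ := N.mul_mem_homs hJ hJ
    have hA := amp_mem_homs Y hJ
    have hexp : (ε + ε * Y.amp J * ε) * (ε + ε * Y.amp J * ε) =
        1 + Y.amp J * ε + (ε * Y.amp J + ε * Y.amp (J * J) * ε) := by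
      have ee' : ∀ T, ε * (ε * T) = T := fun T => by rw [← mul_assoc, ee, one_mul]
      simp only [mul_add, add_mul, map_mul, mul_assoc, ee, ee', mul_one]
      abel
    have v1 : ψ (Y.power (n + 1)).val (Y.power (n + 1)).val 1 = (m : ℂ) • 1 :=
      (h.apply_one _).trans h1
    have v2 : ψ (Y.power (n + 1)).val (Y.power (n + 1)).val (Y.amp J * ε) = 0 :=
      (h.apply_amp_mul_eps hJ).trans (by rw [he, mul_zero])
    have v3 : ψ (Y.power (n + 1)).val (Y.power (n + 1)).val (ε * Y.amp J) = 0 :=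
      (h.apply_eps_mul_amp hJ).trans (by rw [he, zero_mul])
    have v4 : ψ (Y.power (n + 1)).val (Y.power (n + 1)).val (ε * Y.amp (J * J) * ε) =
        ((n * m : ℝ) : ℂ) • 1 :=
      (h.apply_conj_eps hJJ).trans (by rw [ih, _root_.map_smul, map_one])
    change ψ _ _ ((ε + ε * Y.amp J * ε) * (ε + ε * Y.amp J * ε)) = _
    have m2 := N.mul_mem_homs hA hε
    have m3 := N.mul_mem_homs hε hA
    have m4 := N.mul_mem_homs (N.mul_mem_homs hε (amp_mem_homs Y hJJ)) hε
    rw [hexp]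
    refine (h.map_add _ _ _ (add_mem (N.one_mem_homs _) m2) _ (add_mem m3 m4)).trans ?_
    refine (congrArg₂ _ (h.map_add _ _ _ (N.one_mem_homs _) _ m2)
      (h.map_add _ _ _ m3 _ m4)).trans ?_
    rw [v1, v2, v3]
    refine (congrArg _ (congrArg _ v4)).trans ?_
    push_cast
    module

/-- If `ψ(ε(Y, Y)) = 0`, then `ψ` maps the symmetrizer of `n + 2` factors to `m` times that of `n +
1` factors. -/
theorem IsLeftInverse.symmetrizer_ne_zero (h : N.IsLeftInverse Y ψ) {m : ℝ} (hm : 0 < m)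
    (h1 : ψ N.unitField N.unitField 1 = (m : ℂ) • 1)
    (he : ψ Y.val Y.val (N.eps Y.val Y.val) = 0) (n : ℕ) :
    symmetrizer Y.shift (N.eps Y.val Y.val) n ≠ 0 := by
  have := nontrivial_operators N
  have := IsIndexSet.nonempty (K := K)
  induction n with
  | zero => exact one_ne_zero
  | succ n ih =>
    intro h0
    have hE := symmetrizer_mem_homs Y n
    have hJ := jucysMurphy_mem_homs Y (n + 1)
    have hv : ψ (Y.power (n + 1)).val (Y.power (n + 1)).val
        (1 + jucysMurphy Y.shift (N.eps Y.val Y.val) (n + 1)) = (m : ℂ) • 1 := by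
      refine (h.map_add _ _ _ (N.one_mem_homs _) _ hJ).trans ?_
      rw [h.apply_jucysMurphy he (n + 1), h.apply_one, h1, add_zero]
    have key := h.apply_comp_right (add_mem (N.one_mem_homs _) hJ) hE
    rw [hv] at key
    change ψ _ _ (symmetrizer Y.shift (N.eps Y.val Y.val) (n + 1)) = _ at key
    rw [h0, h.map_zero, smul_mul_assoc, one_mul] at key
    exact ih ((smul_eq_zero.mp key.symm).resolve_left (by exact_mod_cast hm.ne'))

/-- A left inverse whose statistics operator vanishes has infinite statistics, hence satisfies no
Pimsner–Popa bound: it violates the bound for `1 + J`, with `J` the Jucys–Murphy element, since `J`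
has the eigenvalue `n` on the symmetrizer, whereas the left inverse maps `(1 + J)²` to
`(n + 1) m`. -/
theorem IsLeftInverse.not_bound_of_statistics_eq_zero (h : N.IsLeftInverse Y ψ) {m k : ℝ}
    (hm : 0 < m) (hk : 0 < k) (h1 : ψ N.unitField N.unitField 1 = (m : ℂ) • 1)
    (he : ψ Y.val Y.val (N.eps Y.val Y.val) = 0)
    (hpp : ∀ (Z : N.Cocycle), ∀ T ∈ N.homs (Y.tensor Z).val (Y.tensor Z).val,
      (k : ℂ) • (star T * T) ≤ Y.amp (ψ Z.val Z.val (star T * T))) : False := by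
  obtain ⟨n, hn⟩ := exists_nat_gt (m / k)
  have hJ := jucysMurphy_mem_homs Y n
  have hJJ := N.mul_mem_homs hJ hJ
  have hE := (isShiftedInvolution_eps Y).one_add_jucysMurphy_mul_symmetrizer n
  have hE0 := h.symmetrizer_ne_zero hm h1 he n
  have hs := star_jucysMurphy Y n
  have v1 := h.apply_jucysMurphy he n
  have v2 := h.apply_jucysMurphy_sq h1 he n
  set J := jucysMurphy Y.shift (N.eps Y.val Y.val) n
  set E := symmetrizer Y.shift (N.eps Y.val Y.val) n
  have hT := add_mem (N.one_mem_homs (Y.power (n + 1)).val) hJ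
  have key := hpp (Y.power n) _ hT
  have hval : ψ (Y.power n).val (Y.power n).val (star (1 + J) * (1 + J)) =
      ((n + 1 : ℝ) * m : ℝ) • 1 := by
    have hexp : star (1 + J) * (1 + J) = (1 + J) + (J + J * J) := by
      rw [star_add, star_one, hs]; noncomm_ring
    rw [hexp]
    refine (h.map_add _ _ _ hT _ (add_mem hJ hJJ)).trans ?_
    refine (congrArg₂ _ (h.map_add _ _ _ (N.one_mem_homs _) _ hJ)
      (h.map_add _ _ _ hJ _ hJJ)).trans ?_
    rw [v1, v2, h.apply_one, h1, ← Complex.coe_smul]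
    push_cast
    module
  rw [hval, ← Complex.coe_smul, _root_.map_smul, map_one] at key
  obtain ⟨a, ha⟩ := Function.ne_iff.mp hE0
  have hle : star ((1 + J) a) * (1 + J) a ≤ (((n + 1) * m / k : ℝ) : ℂ) • 1 := by
    have h3 := smul_nonneg_field (inv_nonneg.mpr hk.le) (sub_nonneg.mpr key) a
    rw [smul_sub, smul_smul, smul_smul, ← Complex.ofReal_mul, ← Complex.ofReal_mul,
      inv_mul_cancel₀ hk.ne', Complex.ofReal_one, one_smul] at h3
    have h4 := sub_nonneg.mp h3
    rwa [inv_mul_eq_div] at h4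
  have hnorm := norm_sq_le_of_star_mul_self_le (by positivity) hle
  have hEa : (1 + J) a * E a = ((n + 1 : ℕ) : ℂ) • E a := by
    have := congrFun hE a
    rw [Pi.mul_apply, Pi.smul_apply, ← Nat.cast_smul_eq_nsmul ℂ] at this
    exact this
  have hEn : 0 < ‖E a‖ := norm_pos_iff.mpr ha
  have h5 : ((n : ℝ) + 1) * ‖E a‖ ≤ ‖(1 + J) a‖ * ‖E a‖ := by
    refine le_trans (le_of_eq ?_) (norm_mul_le _ _)
    rw [hEa, norm_smul, Complex.norm_natCast]
    push_cast
    rfl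
  have h6 : (n : ℝ) + 1 ≤ ‖(1 + J) a‖ := le_of_mul_le_mul_right h5 hEn
  have h7 : ((n : ℝ) + 1) * (n + 1) ≤ (n + 1) * (m / k) := by
    rw [← mul_div_assoc]
    refine le_trans ?_ hnorm
    nlinarith
  have h8 := le_of_mul_le_mul_left h7 (by positivity)
  linarith

end Symmetrizers

section Decomposition

variable {X : N.Cocycle} {φ : N.Field1 → N.Field1 → N.Field0 → N.Field0}

theorem amp_nonneg (X : N.Cocycle) {Z : N.Cocycle} {t : N.Field0} (ht : t ∈ N.homs Z.val Z.val)
    (h0 : 0 ≤ t) : 0 ≤ X.amp t := by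
  obtain ⟨r, -, rfl⟩ := exists_star_mul_self ht h0
  rw [map_mul, map_star]
  exact star_mul_self_nonneg_field (N := N) _

theorem eq_zero_of_star_mul_self {t : K → H →L[ℂ] H} (h : star t * t = 0) : t = 0 :=
  funext fun a => CStarRing.star_mul_self_eq_zero_iff (t a) |>.mp (congrFun h a)

/-- The mass of a nonzero projection is bounded below. -/
theorem IsStandardLeftInverse.le_of_projection (h : N.IsStandardLeftInverse X φ) {c : ℝ}
    (hc : 0 < c)
    (hs : φ X.val X.val (N.eps X.val X.val) * φ X.val X.val (N.eps X.val X.val) = (c : ℂ) • 1)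
    {e : N.Field0} (he : e ∈ N.homs X.val X.val) (hp : star e * e = e) (h0 : e ≠ 0) :
    ∃ r : ℝ, c ≤ r ∧ φ N.unitField N.unitField e = (r : ℂ) • 1 := by
  obtain ⟨a, ha⟩ := Function.ne_iff.mp h0
  obtain ⟨r, hr, hcr⟩ := h.norm_bound hc hs he a
  rw [hp] at hr
  have hn : ‖e a‖ * ‖e a‖ = ‖e a‖ := by
    rw [← CStarRing.norm_star_mul_self]
    exact congrArg norm (congrFun hp a)
  have hn1 : ‖e a‖ = 1 := mul_right_cancel₀ (norm_ne_zero_iff.mpr ha) (by rw [hn, one_mul])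
  rw [hn1] at hcr
  exact ⟨r, by linarith, hr⟩

/-- The eigenspaces of the statistics operator are disjoint: a nonzero intertwiner `u` from one to
the other would give two left inverses of a common subobject with statistics operators of opposite
sign, hence a left inverse with vanishing statistics operator. -/
theorem IsStandardLeftInverse.eq_zero_of_statistics (h : N.IsStandardLeftInverse X φ) {d : ℝ}
    (hd : 0 < d) (hs : φ X.val X.val (N.eps X.val X.val) * φ X.val X.val (N.eps X.val X.val) =
      ((d * d : ℝ) : ℂ) • 1) {u : N.Field0} (hu : u ∈ N.homs X.val X.val)
    (h1 : φ X.val X.val (N.eps X.val X.val) * u = (d : ℂ) • u)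
    (h2 : u * φ X.val X.val (N.eps X.val X.val) = -((d : ℂ) • u)) : u = 0 := by
  by_contra hu0
  have hφ := h.isPositiveLeftInverse
  obtain ⟨-, hl⟩ := h.statistics
  have ce1 := @IsLeftInverse.compress_eps _ _ _ _ _ _ _ _ _ _ _ _ N X φ h.toIsLeftInverse
  set l := φ X.val X.val (N.eps X.val X.val)
  have hh := N.mul_mem_homs (star_mem_homs hu) hu
  have hh0 := star_mul_self_nonneg_field u
  have hlh : l * (star u * u) = -((d : ℂ) • (star u * u)) := by
    have := congrArg star h2
    rw [star_mul, hl, star_neg, star_smul, Complex.star_def, Complex.conj_ofReal] at this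
    rw [← mul_assoc, this, neg_mul, smul_mul_assoc]
  obtain ⟨F, r, hr, hrs, hrr, hFr, hF0, hsum, hpos⟩ :=
    HasFiniteStatistics.exists_spectral ⟨φ, h⟩ hh (by rw [star_mul, star_star])
  obtain ⟨μ, hμF, hμ⟩ : ∃ μ ∈ F, 0 < μ := by
    by_contra hex
    push Not at hex
    refine hu0 (eq_zero_of_star_mul_self ?_)
    rw [← mul_one (star u * u), ← hsum, Finset.mul_sum]
    refine Finset.sum_eq_zero fun μ hμ => ?_
    rw [hFr μ hμ, le_antisymm (hex μ hμ) (hpos hh0 μ hμ), Complex.ofReal_zero, zero_smul]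
  have hp : star (r μ) * r μ = r μ := by rw [hrs, hrr]
  obtain ⟨Y, w, hw, hw1, hw2⟩ := exists_subobject (hr μ) hp (hF0 μ hμF)
  have hrw : r μ * w = w := by rw [← hw2, mul_assoc, hw1, mul_one]
  have hhw : star u * u * w = (μ : ℂ) • w := by
    rw [← hrw, ← mul_assoc, hFr μ hμF, smul_mul_assoc]
  have hμ' : (μ : ℂ) ≠ 0 := by exact_mod_cast hμ.ne'
  have hlw : l * w = -((d : ℂ) • w) := by
    have e1 : (μ : ℂ) • (l * w) = (μ : ℂ) • -((d : ℂ) • w) := by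
      rw [← mul_smul_comm, ← hhw, ← mul_assoc, hlh, neg_mul, smul_mul_assoc, hhw, smul_neg,
        smul_comm]
    exact smul_right_injective _ hμ' e1
  have huw := N.mul_mem_homs hu hw
  have hΨ1 := hφ.compress huw
  have hΨ2 := hφ.compress hw
  have hΨ := hΨ1.add_smul hΨ2 zero_le_one hμ.le
  have v1 : compress φ (u * w) Y.val Y.val (N.eps Y.val Y.val) = ((d * μ : ℝ) : ℂ) • 1 := by
    rw [ce1 huw, star_mul]
    calc _ = star w * star u * (l * u) * w := by simp only [mul_assoc]
      _ = (d : ℂ) • (star w * (star u * u * w)) := by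
        rw [h1]; simp only [mul_smul_comm, smul_mul_assoc, mul_assoc]
      _ = _ := by
        rw [hhw, mul_smul_comm, hw1, smul_smul]; push_cast; rfl
  have v2 : compress φ w Y.val Y.val (N.eps Y.val Y.val) = -((d : ℂ) • 1) := by
    rw [ce1 hw, mul_assoc, hlw, mul_neg, mul_smul_comm, hw1]
  obtain ⟨r1, hr1, hr1'⟩ := hφ.exists_scalar
    (N.mul_mem_homs huw (star_mem_homs huw)) (by
      simpa using star_mul_self_nonneg_field (star (u * w)))
  obtain ⟨r2, hr2, hr2'⟩ := h.le_of_projection (mul_pos hd hd) hs (hr μ) hp (hF0 μ hμF)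
  have hr2pos : 0 < r2 := (mul_pos hd hd).trans_le hr2
  rw [← hw2] at hr2'
  have m1 : compress φ (u * w) N.unitField N.unitField 1 = (r1 : ℂ) • 1 := by
    rw [compress, mul_one]; exact hr1'
  have m2 : compress φ w N.unitField N.unitField 1 = (r2 : ℂ) • 1 := by
    rw [compress, mul_one]; exact hr2'
  refine hΨ.toIsLeftInverse.not_bound_of_statistics_eq_zero (m := r1 + μ * r2)
    (k := μ * (r2⁻¹ * (d * d))) (by positivity) (by positivity) ?_ ?_ fun Z T hT => ?_
  · rw [m1, m2]
    push_cast
    module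
  · rw [v1, v2]
    push_cast
    module
  · have hTT := N.mul_mem_homs (star_mem_homs (X := Y.tensor Z) (Y := Y.tensor Z) hT) hT
    have key := hΨ2.pimsnerPopa hr2pos m2 Z hT
    have hsq : star (T * -((d : ℂ) • (1 : N.Field0))) * (T * -((d : ℂ) • (1 : N.Field0))) =
        ((d * d : ℝ) : ℂ) • (star T * T) := by
      rw [mul_neg, mul_smul_comm, mul_one, star_neg, star_smul, Complex.star_def,
        Complex.conj_ofReal, neg_mul_neg, smul_mul_smul_comm]
      push_cast
      rfl
    rw [v2, hsq] at key
    have n1 := amp_nonneg Y (hΨ1.mem Z Z _ hTT)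
      (hΨ1.nonneg Z _ hTT (star_mul_self_nonneg_field T))
    have n2 := smul_nonneg_field (mul_nonneg hμ.le (inv_nonneg.mpr hr2pos.le))
      (sub_nonneg.mpr key)
    have n3 := add_nonneg n1 n2
    rw [← sub_nonneg]
    refine n3.trans (le_of_eq ?_)
    rw [map_add, map_smul, map_smul, smul_sub, smul_smul, smul_smul, Complex.ofReal_one, one_smul]
    have e2 : ((μ * r2⁻¹ : ℝ) : ℂ) * (r2 : ℂ) = μ := by
      rw [← Complex.ofReal_mul, mul_assoc, inv_mul_cancel₀ hr2pos.ne', mul_one]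
    rw [e2, ← Complex.ofReal_mul, mul_assoc μ, add_sub_assoc]

/-- The statistics operator is central. -/
theorem IsStandardLeftInverse.statistics_commute (h : N.IsStandardLeftInverse X φ) {t : N.Field0}
    (ht : t ∈ N.homs X.val X.val) :
    φ X.val X.val (N.eps X.val X.val) * t = t * φ X.val X.val (N.eps X.val X.val) := by
  obtain ⟨c, hc, hs⟩ := h.standard
  obtain ⟨-, hl⟩ := h.statistics
  have hml := h.toIsLeftInverse.statistics_mem
  obtain ⟨d, hd, rfl⟩ : ∃ d : ℝ, 0 < d ∧ c = d * d :=
    ⟨√c, Real.sqrt_pos.mpr hc, (Real.mul_self_sqrt hc.le).symm⟩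
  have key := fun {u} hu => h.eq_zero_of_statistics hd hs (u := u) hu
  set l := φ X.val X.val (N.eps X.val X.val)
  -- `l + d` and `d - l` are multiples of the two spectral projections of `l`
  have hcorner : ∀ t ∈ N.homs X.val X.val, (l + (d : ℂ) • 1) * t * ((d : ℂ) • 1 - l) = 0 := by
    intro t ht
    have hone := Submodule.smul_mem _ (d : ℂ) (N.one_mem_homs X.val)
    refine key (N.mul_mem_homs (N.mul_mem_homs (add_mem hml hone) ht) (sub_mem hone hml)) ?_ ?_
    · have : l * (l + (d : ℂ) • 1) = (d : ℂ) • (l + (d : ℂ) • 1) := by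
        rw [mul_add, hs, mul_smul_comm, mul_one]
        push_cast
        module
      rw [← mul_assoc, ← mul_assoc, this, smul_mul_assoc, smul_mul_assoc]
    · have : ((d : ℂ) • 1 - l) * l = -((d : ℂ) • ((d : ℂ) • 1 - l)) := by
        rw [sub_mul, hs, smul_mul_assoc, one_mul]
        push_cast
        module
      rw [mul_assoc, this, mul_neg, mul_smul_comm]
  have e1 := hcorner t ht
  have e2 := congrArg star (hcorner _ (star_mem_homs ht))
  simp only [star_mul, star_sub, star_add, star_smul, star_one, star_star, hl, Complex.star_def,
    Complex.conj_ofReal, star_zero] at e2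
  have e3 : (2 * d : ℂ) • (l * t - t * l) = 0 := by
    have : (2 * d : ℂ) • (l * t - t * l) =
        (l + (d : ℂ) • 1) * t * ((d : ℂ) • 1 - l) -
          ((d : ℂ) • 1 - l) * (t * (l + (d : ℂ) • 1)) := by
      simp only [add_mul, mul_add, sub_mul, mul_sub, smul_mul_assoc, mul_smul_comm, one_mul,
        mul_one, mul_assoc]
      module
    rw [this, e1, e2, sub_zero]
  have hd' : (2 * d : ℂ) ≠ 0 := mul_ne_zero two_ne_zero (by exact_mod_cast hd.ne')
  exact sub_eq_zero.mp ((smul_eq_zero.mp e3).resolve_left hd')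

/-! ### Subobjects and decomposition into irreducibles -/

/-- The compression of a standard left inverse to a subobject is standard up to normalization,
because the statistics operator commutes with the projection onto the subobject. -/
theorem hasFiniteStatistics_subobject {X Y : N.Cocycle} (hX : N.HasFiniteStatistics X)
    {w : N.Field0} (hw : w ∈ N.homs Y.val X.val) (hw1 : star w * w = 1) :
    N.HasFiniteStatistics Y := by
  obtain ⟨φ, h⟩ := hX
  obtain ⟨c, hc, hs⟩ := h.standard
  have := nontrivial_operators N
  have := IsIndexSet.nonempty (K := K)
  have hw' := star_mem_homs hw
  have hww := N.mul_mem_homs hw hw'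
  have hp : star (w * star w) * (w * star w) = w * star w := by
    rw [star_mul, star_star, mul_assoc, ← mul_assoc (star w), hw1, one_mul]
  have h0 : w * star w ≠ 0 := fun h0 => by
    have : star w * (w * star w) * w = 1 := by
      rw [← mul_assoc, hw1, one_mul, hw1]
    rw [h0, mul_zero, zero_mul] at this
    exact zero_ne_one this
  obtain ⟨r, hr, hr'⟩ := h.le_of_projection hc hs hww hp h0
  have hcomm := h.statistics_commute hww
  refine (h.isPositiveLeftInverse.compress hw).hasFiniteStatistics (m := r) (c := c)
    (hc.trans_le hr) hc (by rw [compress, mul_one]; exact hr') ?_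
  rw [h.toIsLeftInverse.compress_eps hw]
  set l := φ X.val X.val (N.eps X.val X.val)
  calc _ = star w * (l * (w * star w)) * l * w := by simp only [mul_assoc]
    _ = (star w * w) * (star w * (l * l) * w) := by rw [hcomm]; simp only [mul_assoc]
    _ = _ := by rw [hs, hw1, one_mul, mul_smul_comm, mul_one, smul_mul_assoc, hw1]

/-- An object with finite statistics which is not irreducible has a nontrivial projection. -/
theorem HasFiniteStatistics.exists_projection (hX : N.HasFiniteStatistics X)
    (hirr : ¬ ∀ t ∈ N.homs X.val X.val, ∃ c : ℂ, t = c • 1) :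
    ∃ f ∈ N.homs X.val X.val, star f = f ∧ f * f = f ∧ f ≠ 0 ∧ f ≠ 1 := by
  have := nontrivial_operators N
  have := IsIndexSet.nonempty (K := K)
  by_contra hno
  push Not at hno
  have hsa : ∀ t ∈ N.homs X.val X.val, star t = t → ∃ c : ℂ, t = c • 1 := fun t ht hts => by
    obtain ⟨F, r, hr, hrs, hrr, hFr, hF0, hsum, -⟩ := hX.exists_spectral ht hts
    obtain ⟨μ, hμ⟩ : F.Nonempty := by
      rw [Finset.nonempty_iff_ne_empty]
      rintro rfl
      exact zero_ne_one hsum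
    have h1 := hno _ (hr μ) (hrs μ) (hrr μ) (hF0 μ hμ)
    have h2 := hFr μ hμ
    rw [h1, mul_one] at h2
    exact ⟨_, h2⟩
  refine hirr fun t ht => ?_
  have ht' := star_mem_homs ht
  obtain ⟨x, hx⟩ := hsa (t + star t) (add_mem ht ht') (by rw [star_add, star_star, add_comm])
  obtain ⟨y, hy⟩ := hsa (Complex.I • (t - star t)) (Submodule.smul_mem _ _ (sub_mem ht ht')) (by
    rw [star_smul, star_sub, star_star, Complex.star_def, Complex.conj_I]
    module)
  refine ⟨(x - Complex.I * y) / 2, ?_⟩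
  have h3 : t = (2⁻¹ : ℂ) • ((t + star t) - Complex.I • (Complex.I • (t - star t))) := by
    rw [smul_smul, Complex.I_mul_I]
    module
  rw [h3, hx, hy]
  module

/-- Decomposition of the subobjects of `X` by induction on their mass, each nonzero subobject having
mass at least `c`. -/
theorem IsStandardLeftInverse.exists_decomposition (h : N.IsStandardLeftInverse X φ) {c : ℝ}
    (hc : 0 < c)
    (hs : φ X.val X.val (N.eps X.val X.val) * φ X.val X.val (N.eps X.val X.val) = (c : ℂ) • 1)
    (k : ℕ) : ∀ (Y : N.Cocycle), ∀ w ∈ N.homs Y.val X.val, star w * w = 1 → ∀ r : ℝ,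
      φ N.unitField N.unitField (w * star w) = (r : ℂ) • 1 → r < k * c →
      ∃ (n : ℕ) (Z : Fin n → N.Cocycle) (v : Fin n → N.Field0),
        (∀ i, v i ∈ N.homs (Z i).val Y.val) ∧
        (∀ i, ∀ t ∈ N.homs (Z i).val (Z i).val, ∃ z : ℂ, t = z • 1) ∧
        (∀ i, star (v i) * v i = 1) ∧ ∑ i, v i * star (v i) = 1 := by
  have := nontrivial_operators N
  have := IsIndexSet.nonempty (K := K)
  have hscal : ∀ r s : ℝ, (r : ℂ) • (1 : N.Field0) = (s : ℂ) • 1 → r = s := fun r s hrs => by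
    have := smul_left_injective ℂ (one_ne_zero (α := K → H →L[ℂ] H)) hrs
    exact_mod_cast this
  -- a subobject of `Y` has positive mass in `X`
  have hmass : ∀ (Y : N.Cocycle), ∀ w ∈ N.homs Y.val X.val, star w * w = 1 →
      ∀ f ∈ N.homs Y.val Y.val, star f = f → f * f = f → f ≠ 0 →
      w * f * star w ∈ N.homs X.val X.val ∧
      ∃ r : ℝ, c ≤ r ∧ φ N.unitField N.unitField (w * f * star w) = (r : ℂ) • 1 := by
    intro Y w hw hw1 f hf hfs hff hf0
    have hm := N.mul_mem_homs (N.mul_mem_homs hw hf) (star_mem_homs hw)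
    refine ⟨hm, h.le_of_projection hc hs hm ?_ fun h0 => hf0 ?_⟩
    · rw [star_mul, star_mul, star_star, hfs]
      calc _ = w * (f * (star w * w) * f) * star w := by simp only [mul_assoc]
        _ = _ := by rw [hw1, mul_one, hff]
    · calc f = (star w * w) * f * (star w * w) := by rw [hw1, one_mul, mul_one]
        _ = star w * (w * f * star w) * w := by simp only [mul_assoc]
        _ = 0 := by rw [h0, mul_zero, zero_mul]
  induction k with
  | zero =>
    intro Y w hw hw1 r hr hrk
    obtain ⟨-, r', hr', hr''⟩ := hmass Y w hw hw1 1 (N.one_mem_homs _) (star_one _) (one_mul 1)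
      one_ne_zero
    rw [mul_one, hr] at hr''
    have := hscal _ _ hr''
    rw [Nat.cast_zero, zero_mul] at hrk
    linarith
  | succ k ih =>
    intro Y w hw hw1 r hr hrk
    by_cases hirr : ∀ t ∈ N.homs Y.val Y.val, ∃ z : ℂ, t = z • 1
    · exact ⟨1, fun _ => Y, fun _ => 1, fun _ => N.one_mem_homs _, fun _ => hirr,
        fun _ => by rw [star_one, one_mul], by simp⟩
    obtain ⟨f, hf, hfs, hff, hf0, hf1⟩ :=
      (hasFiniteStatistics_subobject ⟨φ, h⟩ hw hw1).exists_projection hirr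
    have hg : 1 - f ∈ N.homs Y.val Y.val := sub_mem (N.one_mem_homs _) hf
    have hgs : star (1 - f) = 1 - f := by rw [star_sub, star_one, hfs]
    have hgg : (1 - f) * (1 - f) = 1 - f := by
      rw [mul_sub, sub_mul, sub_mul, hff]; simp
    have hg0 : 1 - f ≠ 0 := sub_ne_zero.mpr hf1.symm
    obtain ⟨hmf, r₁, hr₁, hr₁'⟩ := hmass Y w hw hw1 f hf hfs hff hf0
    obtain ⟨hmg, r₂, hr₂, hr₂'⟩ := hmass Y w hw hw1 (1 - f) hg hgs hgg hg0
    have hsum : r₁ + r₂ = r := by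
      refine hscal _ _ ?_
      rw [← hr, Complex.ofReal_add, _root_.add_smul, ← hr₁', ← hr₂']
      refine (h.map_add Cocycle.unit Cocycle.unit _ (homs_tensor_right hmf Cocycle.unit) _
        (homs_tensor_right hmg Cocycle.unit)).symm.trans ?_
      rw [← add_mul, ← mul_add, add_sub_cancel, mul_one]
      rfl
    obtain ⟨Y₁, v₁, hv₁, hv₁', hvf⟩ := exists_subobject hf (by rw [hfs, hff]) hf0
    obtain ⟨Y₂, v₂, hv₂, hv₂', hvg⟩ := exists_subobject hg (by rw [hgs, hgg]) hg0
    have hiso : ∀ v : N.Field0, star v * v = 1 → star (w * v) * (w * v) = 1 := fun v hv => by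
      rw [star_mul, mul_assoc, ← mul_assoc (star w), hw1, one_mul, hv]
    have hrange : ∀ v f : N.Field0, v * star v = f → w * v * star (w * v) = w * f * star w := by
      rintro v f rfl
      rw [star_mul]; simp only [mul_assoc]
    push_cast at hrk
    obtain ⟨n₁, Z₁, x₁, a₁, b₁, c₁, d₁⟩ := ih Y₁ (w * v₁) (N.mul_mem_homs hw hv₁) (hiso _ hv₁') r₁
      (by rw [hrange _ _ hvf, hr₁']) (by linarith)
    obtain ⟨n₂, Z₂, x₂, a₂, b₂, c₂, d₂⟩ := ih Y₂ (w * v₂) (N.mul_mem_homs hw hv₂) (hiso _ hv₂') r₂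
      (by rw [hrange _ _ hvg, hr₂']) (by linarith)
    have hiso' : ∀ v x : N.Field0, star v * v = 1 → star x * x = 1 →
        star (v * x) * (v * x) = 1 := fun v x hv hx => by
      rw [star_mul, mul_assoc, ← mul_assoc (star v), hv, one_mul, hx]
    refine ⟨n₁ + n₂, Fin.append Z₁ Z₂,
      Fin.append (fun i => v₁ * x₁ i) (fun i => v₂ * x₂ i), fun i => ?_, fun i => ?_,
      fun i => ?_, ?_⟩
    · refine i.addCases (fun j => ?_) (fun j => ?_)
      · rw [Fin.append_left, Fin.append_left]
        exact N.mul_mem_homs hv₁ (a₁ j)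
      · rw [Fin.append_right, Fin.append_right]
        exact N.mul_mem_homs hv₂ (a₂ j)
    · refine i.addCases (fun j => ?_) (fun j => ?_)
      · rw [Fin.append_left]
        exact b₁ j
      · rw [Fin.append_right]
        exact b₂ j
    · refine i.addCases (fun j => ?_) (fun j => ?_)
      · rw [Fin.append_left]
        exact hiso' _ _ hv₁' (c₁ j)
      · rw [Fin.append_right]
        exact hiso' _ _ hv₂' (c₂ j)
    · have hcollect : ∀ (n : ℕ) (x : Fin n → N.Field0) (v : N.Field0),
          ∑ i, x i * star (x i) = 1 → ∑ i, v * x i * star (v * x i) = v * star v := by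
        intro n x v hx
        calc _ = v * (∑ i, x i * star (x i)) * star v := by
              rw [Finset.mul_sum, Finset.sum_mul]
              exact Finset.sum_congr rfl fun i _ => by rw [star_mul]; simp only [mul_assoc]
          _ = _ := by rw [hx, mul_one]
      rw [Fin.sum_univ_add]
      simp only [Fin.append_left, Fin.append_right]
      rw [hcollect _ _ _ d₁, hcollect _ _ _ d₂, hvf, hvg, add_sub_cancel]

theorem HasFiniteStatistics.exists_decomposition (hX : N.HasFiniteStatistics X) :
    ∃ (n : ℕ) (Z : Fin n → N.Cocycle) (v : Fin n → N.Field0),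
      (∀ i, v i ∈ N.homs (Z i).val X.val) ∧
      (∀ i, ∀ t ∈ N.homs (Z i).val (Z i).val, ∃ z : ℂ, t = z • 1) ∧
      (∀ i, star (v i) * v i = 1) ∧ ∑ i, v i * star (v i) = 1 := by
  obtain ⟨φ, h⟩ := hX
  obtain ⟨c, hc, hs⟩ := h.standard
  obtain ⟨k, hk⟩ := exists_nat_gt (1 / c)
  rw [div_lt_iff₀ hc] at hk
  exact h.exists_decomposition hc hs k X 1 (N.one_mem_homs _) (by rw [star_one, one_mul]) 1
    (by rw [star_one, one_mul, h.statistics.1]) hk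

end Decomposition

/-! ### The C*-category of covariant 1-cocycles with finite statistics -/

namespace FinStat

theorem comp_mem {X Y : N.FinStat} (f : X ⟶ Y) : FinStat.comp f ∈ N.homs X.obj.val Y.obj.val :=
  components_mem f.hom

theorem comp_injective {X Y : N.FinStat} {f g : X ⟶ Y} (h : FinStat.comp f = FinStat.comp g) :
    f = g :=
  N.HasFiniteStatistics.hom_ext (components_injective h)

/-- The arrow of `Z¹_{c,f}(𝒜_K)` with given components. -/
def mkHom {X Y : N.FinStat} (t : N.Field0) (ht : t ∈ N.homs X.obj.val Y.obj.val) : X ⟶ Y :=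
  ObjectProperty.homMk (Cocycle.homMk t ht)

theorem comp_mkHom {X Y : N.FinStat} (t : N.Field0) (ht : t ∈ N.homs X.obj.val Y.obj.val) :
    FinStat.comp (mkHom (X := X) (Y := Y) t ht) = t := rfl

theorem comp_add {X Y : N.FinStat} (f g : X ⟶ Y) :
    FinStat.comp (f + g) = FinStat.comp f + FinStat.comp g := rfl

theorem comp_sub {X Y : N.FinStat} (f g : X ⟶ Y) :
    FinStat.comp (f - g) = FinStat.comp f - FinStat.comp g := rfl

theorem comp_smul {X Y : N.FinStat} (c : ℂ) (f : X ⟶ Y) :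
    FinStat.comp (c • f) = c • FinStat.comp f := rfl

theorem comp_sum {X Y : N.FinStat} {ι : Type*} (s : Finset ι) (f : ι → (X ⟶ Y)) :
    FinStat.comp (∑ i ∈ s, f i) = ∑ i ∈ s, FinStat.comp (f i) := by
  classical
  induction s using Finset.induction_on with
  | empty => rfl
  | insert i s hi ih => rw [Finset.sum_insert hi, Finset.sum_insert hi, comp_add, ih]

/-- The C*-structure of `Z¹_{c,f}(𝒜_K)`. The norm is computed at the component with index `a₀`, on
which it does not depend. -/
noncomputable def cstar (N : ObservableNet P K H) (a₀ : K) : CStarCategory N.FinStat where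
  adj f := mkHom (star (FinStat.comp f)) (star_mem_homs (comp_mem f))
  norm f := ‖FinStat.comp f a₀‖
  adj_add f g := comp_injective (star_add (FinStat.comp f) (FinStat.comp g))
  adj_smul c f := comp_injective (star_smul c (FinStat.comp f))
  adj_adj f := comp_injective (star_star (FinStat.comp f))
  adj_comp f g := comp_injective (star_mul (FinStat.comp g) (FinStat.comp f))
  norm_add_le f g := norm_add_le _ _
  norm_smul c f := norm_smul c (FinStat.comp f a₀)
  eq_zero_of_norm f hf :=
    comp_injective (homs_ext (comp_mem f) (zero_mem _) a₀ (norm_eq_zero.mp hf))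
  complete {X Y} f hf := by
    have hcauchy : CauchySeq fun i => FinStat.comp (f i) a₀ := by
      rw [Metric.cauchySeq_iff]
      intro ε hε
      obtain ⟨n, hn⟩ := hf ε hε
      exact ⟨n, fun i hi j hj => by rw [dist_eq_norm]; exact hn i hi j hj⟩
    obtain ⟨T, hT⟩ := cauchySeq_tendsto_of_complete hcauchy
    have hmem := (isClosed_setOf_extend_mem X.obj Y.obj a₀).mem_of_tendsto hT
      (Filter.Eventually.of_forall fun i => by
        have h := comp_mem (f i)
        rw [homs_eq_extend h a₀] at h
        exact h)
    refine ⟨mkHom _ hmem, fun ε hε => ?_⟩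
    obtain ⟨n, hn⟩ := Metric.tendsto_atTop.mp hT ε hε
    refine ⟨n, fun i hi => ?_⟩
    rw [comp_sub, comp_mkHom, Pi.sub_apply, extend_self, ← dist_eq_norm]
    exact hn i hi
  norm_comp_le f g := norm_mul_le _ _
  norm_adj_comp f := by
    rw [sq, ← CStarRing.norm_star_mul_self]
    rfl
  positive {X Y} f := by
    obtain ⟨r, hr, h⟩ := exists_star_mul_self
      (N.mul_mem_homs (star_mem_homs (comp_mem f)) (comp_mem f))
      (star_mul_self_nonneg_field (N := N) (FinStat.comp f))
    exact ⟨mkHom r hr, comp_injective h⟩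

theorem comp_adj (a₀ : K) {X Y : N.FinStat} (f : X ⟶ Y) :
    FinStat.comp ((cstar N a₀).adj f) = star (FinStat.comp f) := rfl

theorem isOperatorCStar (a₀ : K) : IsOperatorCStar (cstar N a₀) :=
  ⟨fun _ _ _ => rfl, fun _ _ t a => norm_homs (comp_mem t) a₀ a⟩

instance : N.HasFiniteStatistics.IsMonoidal where
  prop_unit := hasFiniteStatistics_unit
  prop_tensor _ _ h₁ h₂ := hasFiniteStatistics_tensor h₁ h₂

theorem isCocycleTensor : N.IsCocycleTensor where
  unit := rfl
  obj _ _ := rfl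
  hom _ _ := rfl
  associator _ _ _ := rfl
  leftUnitor _ := rfl
  rightUnitor _ := rfl
  symmetry _ _ := rfl

open MonoidalCategory in
theorem comp_tensorHom {X Y Z W : N.FinStat} (f : X ⟶ Y) (g : Z ⟶ W) :
    FinStat.comp (f ⊗ₘ g) = FinStat.comp f * X.obj.amp (FinStat.comp g) := rfl

theorem isSymmetricTensor (a₀ : K) : (cstar N a₀).IsSymmetricTensor where
  add_tensor f f' g := comp_injective (by
    rw [comp_add, comp_tensorHom, comp_tensorHom, comp_tensorHom, comp_add, add_mul])
  tensor_add f g g' := comp_injective (by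
    rw [comp_add, comp_tensorHom, comp_tensorHom, comp_tensorHom, comp_add, map_add, mul_add])
  smul_tensor c f g := comp_injective (by
    rw [comp_smul, comp_tensorHom, comp_tensorHom, comp_smul, smul_mul_assoc])
  tensor_smul c f g := comp_injective (by
    rw [comp_smul, comp_tensorHom, comp_tensorHom, comp_smul, map_smul, mul_smul_comm])
  adj_tensor f g := comp_injective (by
    rw [comp_adj, comp_tensorHom, comp_tensorHom, comp_adj, comp_adj, star_mul, ← map_star,
      homs_amp_comm (star_mem_homs (comp_mem f)) (star_mem (homs_le_localFields (comp_mem g)))])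
  adj_associator X Y Z := comp_injective (star_one _)
  adj_leftUnitor X := comp_injective (star_one _)
  adj_rightUnitor X := comp_injective (star_one _)
  adj_braiding X Y := comp_injective (star_eps X.obj Y.obj)
  irreducible_unit f := by
    obtain ⟨c, hc⟩ := homs_unit_eq_smul_one (comp_mem f)
    exact ⟨c, comp_injective hc⟩

theorem hasSubobjects (a₀ : K) : (cstar N a₀).HasSubobjects := by
  intro X e he h0
  have hp : star (FinStat.comp e) * FinStat.comp e = FinStat.comp e := congrArg FinStat.comp he
  obtain ⟨Y, w, hw, hw1, hw2⟩ := exists_subobject (comp_mem e) hp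
    fun h => h0 (comp_injective h)
  exact ⟨⟨Y, hasFiniteStatistics_subobject X.property hw hw1⟩, mkHom w hw, comp_injective hw1,
    comp_injective hw2⟩

theorem hasDirectSums (a₀ : K) : (cstar N a₀).HasDirectSums := by
  intro X Y
  obtain ⟨Z, w, v, hw, hv, hw1, hv1, hwv⟩ := exists_directSum X.obj Y.obj
  exact ⟨⟨Z, hasFiniteStatistics_directSum X.property Y.property hw hv hw1 hv1 hwv⟩, mkHom w hw,
    mkHom v hv, comp_injective hw1, comp_injective hv1, comp_injective hwv⟩

theorem isFiniteSumOfIrreducibles (a₀ : K) (X : N.FinStat) :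
    (cstar N a₀).IsFiniteSumOfIrreducibles X := by
  obtain ⟨n, Z, v, hv, hirr, hiso, hsum⟩ := HasFiniteStatistics.exists_decomposition X.property
  refine ⟨n, fun i => ⟨Z i, hasFiniteStatistics_subobject X.property (hv i) (hiso i)⟩,
    fun i => mkHom (v i) (hv i), fun i f => ?_, fun i => comp_injective (hiso i),
    comp_injective ?_⟩
  · obtain ⟨z, hz⟩ := hirr i _ (comp_mem f)
    exact ⟨z, comp_injective hz⟩
  · rw [comp_sum]
    exact hsum

end FinStat

end ObservableNet

theorem mainTheorem8 {P : Type w} {K : Type v} {H : Type u} [Group P] [PartialOrder K]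
    [CausalRelations K] [IsIndexSet K] [MulAction P K] [IsSymmetry P K] [NormedAddCommGroup H]
    [InnerProductSpace ℂ H] [CompleteSpace H] (N : ObservableNet P K H) :
    (∃ (S : CStarCategory N.FinStat) (_ : MonoidalCategory N.FinStat)
        (_ : SymmetricCategory N.FinStat),
      ObservableNet.IsOperatorCStar S ∧ N.IsCocycleTensor ∧ S.IsSymmetricTensor ∧
      S.HasSubobjects ∧ S.HasDirectSums ∧ ∀ X : N.FinStat, S.IsFiniteSumOfIrreducibles X) ∧
    N.FinStatClosedUnderSubobjects ∧ N.FinStatClosedUnderDirectSums := by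
  obtain ⟨a₀⟩ := IsIndexSet.nonempty (K := K)
  exact ⟨⟨ObservableNet.FinStat.cstar N a₀, inferInstance, inferInstance,
    ObservableNet.FinStat.isOperatorCStar a₀, ObservableNet.FinStat.isCocycleTensor,
    ObservableNet.FinStat.isSymmetricTensor a₀, ObservableNet.FinStat.hasSubobjects a₀,
    ObservableNet.FinStat.hasDirectSums a₀,
    ObservableNet.FinStat.isFiniteSumOfIrreducibles a₀⟩,
    fun _ _ hX _ hw hw1 => ObservableNet.hasFiniteStatistics_subobject hX hw hw1,
    fun _ _ _ hX hY _ hw _ hv hw1 hv1 hwv =>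
      ObservableNet.hasFiniteStatistics_directSum hX hY hw hv hw1 hv1 hwv⟩
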